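/- Let $\rho,\sigma$ be states (density matrices) of a $d$-level quantum system $\mathbb{C}^d$ with Hamiltonian $H=H^\dagger$. Write $S(\rho)=-\mathrm{Tr}[\rho\log\rho]$, $E(\rho)=\mathrm{Tr}[H\rho]$, $\|X\|_1=\mathrm{Tr}\sqrt{X^\dagger X}$, let $\|\cdot\|$ be the operator norm, and let $H^{(n)}=\sum_{i=1}^n 1^{\otimes (i-1)}\otimes H\otimes 1^{\otimes (n-i)}$ be the Hamiltonian of $n$ non-interacting copies. An ancilla for $n$ copies is a finite-dimensional quantum system $\mathbb{C}^{D_n}$ with a Hamiltonian $H_{\mathrm{anc}}$ (all depending on $n$); its size is $\log D_n$, and it consists of $k_n$ qudits if $D_n=d^{k_n}$. A unitary $U$ on $(\mathbb{C}^d)^{\otimes n}\otimes\mathbb{C}^{D_n}$ is energy-preserving if $[U,\,H^{(n)}\otimes 1+1\otimes H_{\mathrm{anc}}]=0$. Asymptotic notation refers to $n\to\infty$. The following are equivalent: 1. $S(\rho)=S(\sigma)$ and $E(\rho)=E(\sigma)$. 2. For every $n$ there are an ancilla of $O(\sqrt{n\log n})$ many qudits with $\|H_{\mathrm{anc}}\|=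 O(n^{2/3})$, an ancilla state $\eta$, and an energy-preserving unitary $U$, such that $$\big\|\mathrm{Tr}_{\mathrm{anc}}\big[U(\rho^{\otimes n}\otimes\eta)U^\dagger\big]-\sigma^{\otimes n}\big\|_1\xrightarrow{\;n\to\infty\;}0.$$ 2'. The same as 2, with an ancilla of arbitrary dimension and size $\log D_n=O(\sqrt{n\log n})$ in place of $O(\sqrt{n\log n})$ qudits. 3. For every $n$ there are an ancilla of $o(n)$ many qudits with $\|H_{\mathrm{anc}}\|= o(n)$, ancilla states $\eta$ and $\nu$, and energy-preserving unitaries $U$ and $V$, such that $$\big\|\mathrm{Tr}_{\mathrm{anc}}\big[U(\rho^{\otimes n}\otimes\eta)U^\dagger-V(\sigma^{\otimes n}\otimes\nu)V^\dagger\big]\big\|_1\xrightarrow{\;n\to\infty\;}0.$$ 3'. The same as 3, with an ancilla of arbitrary dimension and size $\log D_n=o(n)$ in place of $o(n)$ qudits. -/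

import Mathlib

open Filter Asymptotics Topology Matrix
open scoped Kronecker ComplexOrder

namespace QThermo

noncomputable section

/-- A quantum state (density matrix): positive semidefinite with unit trace. -/
def IsState {ι : Type*} [Fintype ι] (ρ : Matrix ι ι ℂ) : Prop :=
  ρ.PosSemidef ∧ ρ.trace = 1

/-- Von Neumann entropy `S(ρ) = - Tr (ρ log ρ)`, with the logarithm taken by functional calculus
(`log 0 = 0`, so that `0 log 0 = 0`). -/
def entropy {ι : Type*} [Fintype ι] [DecidableEq ι] (ρ : Matrix ι ι ℂ) : ℝ :=
  -(ρ * cfc Real.log ρ).trace.re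

/-- Average energy `E(ρ) = Tr (H ρ)`. -/
def energy {ι : Type*} [Fintype ι] (H ρ : Matrix ι ι ℂ) : ℝ :=
  (H * ρ).trace.re

/-- Trace norm `‖X‖₁ = Tr √(X† X)`. -/
def traceNorm {ι : Type*} [Fintype ι] [DecidableEq ι] (X : Matrix ι ι ℂ) : ℝ :=
  (cfc Real.sqrt (Xᴴ * X)).trace.re

/-- Operator norm of a matrix acting on the Hilbert space `ℂ^ι`. -/
def opNorm {ι : Type*} [Fintype ι] [DecidableEq ι] (X : Matrix ι ι ℂ) : ℝ :=
  ‖Matrix.toEuclideanCLM (𝕜 := ℂ) X‖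

/-- The tensor product `A 0 ⊗ ⋯ ⊗ A (n - 1)` of operators on `ℂ^d`, as an operator on
`(ℂ^d)^{⊗ n}`, whose standard basis is indexed by the words `Fin n → Fin d`. -/
def tensorFamily {d n : ℕ} (A : Fin n → Matrix (Fin d) (Fin d) ℂ) :
    Matrix (Fin n → Fin d) (Fin n → Fin d) ℂ :=
  Matrix.of fun x y => ∏ i, A i (x i) (y i)

/-- The tensor power `ρ^{⊗ n}`. -/
def tensorPower {d : ℕ} (n : ℕ) (ρ : Matrix (Fin d) (Fin d) ℂ) :
    Matrix (Fin n → Fin d) (Fin n → Fin d) ℂ :=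
  tensorFamily fun _ => ρ

/-- The Hamiltonian of `n` non-interacting copies,
`∑ i, 1 ⊗ ⋯ ⊗ 1 ⊗ H ⊗ 1 ⊗ ⋯ ⊗ 1` with `H` on the `i`-th copy. -/
def copiesHam {d : ℕ} (n : ℕ) (H : Matrix (Fin d) (Fin d) ℂ) :
    Matrix (Fin n → Fin d) (Fin n → Fin d) ℂ :=
  ∑ i : Fin n, tensorFamily (Function.update (fun _ => 1) i H)

/-- The Hamiltonian of a system and an ancilla that do not interact, `H_S ⊗ 1 + 1 ⊗ H_A`. -/
def jointHam {ι κ : Type*} [DecidableEq ι] [DecidableEq κ]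
    (HS : Matrix ι ι ℂ) (HA : Matrix κ κ ℂ) : Matrix (ι × κ) (ι × κ) ℂ :=
  HS ⊗ₖ (1 : Matrix κ κ ℂ) + (1 : Matrix ι ι ℂ) ⊗ₖ HA

/-- Partial trace over the second tensor factor (the ancilla). -/
def trAnc {ι κ : Type*} [Fintype κ] (M : Matrix (ι × κ) (ι × κ) ℂ) : Matrix ι ι ℂ :=
  Matrix.of fun x y => ∑ a, M (x, a) (y, a)

/-- `U` is unitary and commutes with the Hamiltonian `K`. -/
def EnergyPreserving {ι : Type*} [Fintype ι] [DecidableEq ι] (K U : Matrix ι ι ℂ) : Prop :=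
  U ∈ Matrix.unitaryGroup ι ℂ ∧ U * K = K * U

/-- For each `n` there are, on an ancilla with Hilbert space `ℂ^(D n)`, a Hamiltonian `HA n` with
`‖HA n‖ = O(n^(2/3))` and a state `η n`, and there is an energy-preserving unitary `U n` on `n`
copies and the ancilla, such that `‖Tr_anc (U (ρ^{⊗n} ⊗ η) U†) - σ^{⊗n}‖₁ → 0`. -/
def OneSidedConversion {d : ℕ} (H ρ σ : Matrix (Fin d) (Fin d) ℂ) (D : ℕ → ℕ) : Prop :=
  ∃ (HA η : ∀ n, Matrix (Fin (D n)) (Fin (D n)) ℂ)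
    (U : ∀ n, Matrix ((Fin n → Fin d) × Fin (D n)) ((Fin n → Fin d) × Fin (D n)) ℂ),
    (∀ n, (HA n).IsHermitian) ∧
    (fun n => opNorm (HA n)) =O[atTop] (fun n : ℕ => (n : ℝ) ^ (2 / 3 : ℝ)) ∧
    (∀ n, IsState (η n)) ∧
    (∀ n, EnergyPreserving (jointHam (copiesHam n H) (HA n)) (U n)) ∧
    Tendsto (fun n => traceNorm
        (trAnc (U n * (tensorPower n ρ ⊗ₖ η n) * (U n)ᴴ) - tensorPower n σ))
      atTop (𝓝 0)

/-- For each `n` there are, on an ancilla with Hilbert space `ℂ^(D n)`, a Hamiltonian `HA n` with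
`‖HA n‖ = o(n)` and states `η n`, `ν n`, and there are energy-preserving unitaries `U n`, `V n` on
`n` copies and the ancilla, such that
`‖Tr_anc (U (ρ^{⊗n} ⊗ η) U† - V (σ^{⊗n} ⊗ ν) V†)‖₁ → 0`. -/
def TwoSidedConversion {d : ℕ} (H ρ σ : Matrix (Fin d) (Fin d) ℂ) (D : ℕ → ℕ) : Prop :=
  ∃ (HA η ν : ∀ n, Matrix (Fin (D n)) (Fin (D n)) ℂ)
    (U V : ∀ n, Matrix ((Fin n → Fin d) × Fin (D n)) ((Fin n → Fin d) × Fin (D n)) ℂ),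
    (∀ n, (HA n).IsHermitian) ∧
    (fun n => opNorm (HA n)) =o[atTop] (fun n : ℕ => (n : ℝ)) ∧
    (∀ n, IsState (η n)) ∧ (∀ n, IsState (ν n)) ∧
    (∀ n, EnergyPreserving (jointHam (copiesHam n H) (HA n)) (U n)) ∧
    (∀ n, EnergyPreserving (jointHam (copiesHam n H) (HA n)) (V n)) ∧
    Tendsto (fun n => traceNorm
        (trAnc (U n * (tensorPower n ρ ⊗ₖ η n) * (U n)ᴴ
          - V n * (tensorPower n σ ⊗ₖ ν n) * (V n)ᴴ)))
      atTop (𝓝 0)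

end

end QThermo

set_option linter.unusedSectionVars false

open scoped Matrix.Norms.L2Operator

/-! The weakest statement (two-sided, log-dimension `o(n)`) implies equality of entropy and energy,
and equality implies the strongest one (one-sided, `O(√(n log n))` qudits). The other implications
are changes of asymptotic bounds or the choice `V = 1`.

Converse. Total energy is conserved exactly and the ancilla can exchange only `O(‖H_anc‖) = o(n)`,
so dividing by `n` gives equal energies (`abs_trace_sub_le_of_energyPreserving`). For the entropy,
suppose `S(ρ) < S(σ)`. Up to small trace, the final state obtained from `ρ` lives on a subspace of
dimension `exp(n S(ρ) + o(n))`, whereas the one obtained from `σ` has exponentially small weight on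
every subspace of that size (`one_sub_le_of_typical`). The two cannot be close.

Construction. In an eigenbasis of `H` and with `w ≈ √(n log n)`, both tensor powers are close to
operators on the span of the words with energy within `w` of `n E`, of rank at most `exp(n S + w)`
and norm at most `exp(-n S + w)` (`compression_of_typical`). Two such spectra agree up to the factor
`exp(2w)`. A maximally mixed register of dimension about `exp(3w)` cuts the eigenvalues of the first
into small pieces, which are packed into the eigenvalues of the second
(`exists_distribution_matching`). This gives a unitary `W` that need not conserve energy, but
changes it by at most `2w`.

An energy reference restores conservation: the ancilla holds a uniform superposition of levels, and
each transition of `W` is compensated by a shift of the level (`frameUnitary`). This simulates `W`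
well when the set of levels is almost invariant under the shifts. Iterated sumsets of the set of
energy differences grow only polynomially, because energies are integer combinations of the `d`
eigenvalues of `H`; hence some sumset is almost invariant (`exists_frame_levels`). With about
`n^{1/12}` iterations the levels are `O(n^{1/12} w) = O(n^{2/3})`. -/

namespace QThermo

/-! ### Operator norm estimates -/

section Norms

variable {m n : Type*} [Fintype m] [Fintype n] [DecidableEq m] [DecidableEq n]

theorem norm_one_le : ‖(1 : Matrix n n ℂ)‖ ≤ 1 := by
  rw [← diagonal_one, l2_opNorm_diagonal]
  refine (pi_norm_le_iff_of_nonneg zero_le_one).2 fun i => by simp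

theorem norm_le_one_of_isometry {U : Matrix m n ℂ} (h : Uᴴ * U = 1) : ‖U‖ ≤ 1 := by
  have h1 := l2_opNorm_conjTranspose_mul_self U
  rw [h] at h1
  have h2 := norm_one_le (n := n)
  nlinarith [norm_nonneg U]

theorem norm_conjTranspose_le_one {U : Matrix m n ℂ} (h : ‖U‖ ≤ 1) : ‖Uᴴ‖ ≤ 1 := by
  rwa [l2_opNorm_conjTranspose]

theorem norm_conj_le {l : Type*} [Fintype l] [DecidableEq l] {U : Matrix m n ℂ} {V : Matrix n l ℂ}
    (Y : Matrix n n ℂ) (hU : ‖U‖ ≤ 1) (hV : ‖V‖ ≤ 1) : ‖U * Y * V‖ ≤ ‖Y‖ := by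
  calc ‖U * Y * V‖ ≤ ‖U‖ * ‖Y‖ * ‖V‖ :=
        (l2_opNorm_mul _ _).trans (by gcongr; exact l2_opNorm_mul _ _)
    _ ≤ 1 * ‖Y‖ * 1 := by gcongr
    _ = ‖Y‖ := by ring

theorem norm_entry_le (A : Matrix m n ℂ) (i : m) (j : n) : ‖A i j‖ ≤ ‖A‖ := by
  have h := l2_opNorm_mulVec A (EuclideanSpace.single j (1 : ℂ))
  have h2 : ‖EuclideanSpace.single j (1 : ℂ)‖ = 1 := by simp
  rw [h2, mul_one] at h
  refine le_trans ?_ h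
  have := PiLp.norm_apply_le (p := 2) ((EuclideanSpace.equiv m ℂ).symm
    (A *ᵥ (EuclideanSpace.single j (1 : ℂ)))) i
  simpa using this

/-- `A ↦ A ⊗ 1` is a star homomorphism between C⋆-algebras, hence contractive. -/
theorem norm_kronecker_one_le (A : Matrix m m ℂ) : ‖A ⊗ₖ (1 : Matrix n n ℂ)‖ ≤ ‖A‖ := by
  let f : Matrix m m ℂ →⋆ₙₐ[ℂ] Matrix (m × n) (m × n) ℂ :=
    { toFun := fun A => A ⊗ₖ (1 : Matrix n n ℂ)
      map_smul' := fun c A => smul_kronecker c A 1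
      map_zero' := zero_kronecker _
      map_add' := fun A B => add_kronecker A B 1
      map_mul' := fun A B => by rw [← mul_kronecker_mul, one_mul]
      map_star' := fun A => by
        simp [star_eq_conjTranspose, conjTranspose_kronecker] }
  exact NonUnitalStarAlgHom.norm_apply_le f A

theorem norm_one_kronecker_le (A : Matrix m m ℂ) : ‖(1 : Matrix n n ℂ) ⊗ₖ A‖ ≤ ‖A‖ := by
  let f : Matrix m m ℂ →⋆ₙₐ[ℂ] Matrix (n × m) (n × m) ℂ :=
    { toFun := fun A => (1 : Matrix n n ℂ) ⊗ₖ A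
      map_smul' := fun c A => kronecker_smul c 1 A
      map_zero' := kronecker_zero _
      map_add' := fun A B => kronecker_add 1 A B
      map_mul' := fun A B => by rw [← mul_kronecker_mul, one_mul]
      map_star' := fun A => by
        simp [star_eq_conjTranspose, conjTranspose_kronecker] }
  exact NonUnitalStarAlgHom.norm_apply_le f A

theorem trace_conj_diagonal_mul (V : Matrix m n ℂ) (μ : n → ℂ) (Y : Matrix m m ℂ) :
    (V * diagonal μ * Vᴴ * Y).trace = ∑ i, μ i * (Vᴴ * Y * V) i i := by
  rw [Matrix.mul_assoc, Matrix.mul_assoc, trace_mul_comm, Matrix.mul_assoc]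
  simp [trace]

theorem norm_trace_conj_diagonal_mul_le {V : Matrix m n ℂ} (hV : Vᴴ * V = 1) (μ : n → ℝ)
    (Y : Matrix m m ℂ) :
    ‖(V * diagonal (fun i => (μ i : ℂ)) * Vᴴ * Y).trace‖ ≤ (∑ i, |μ i|) * ‖Y‖ := by
  have hV1 := norm_le_one_of_isometry hV
  rw [trace_conj_diagonal_mul, Finset.sum_mul]
  refine (norm_sum_le _ _).trans (Finset.sum_le_sum fun i _ => ?_)
  rw [norm_mul, Complex.norm_real, Real.norm_eq_abs]
  gcongr
  exact (norm_entry_le _ _ _).trans (norm_conj_le _ (norm_conjTranspose_le_one hV1) hV1)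

end Norms

/-! ### Spectral decomposition and trace norm -/

section Spectral

variable {m n : Type*} [Fintype m] [Fintype n] [DecidableEq m] [DecidableEq n]

/-- A single unitary diagonalises `X` together with every function of it, so functional calculus
becomes arithmetic of diagonal matrices. -/
theorem exists_spectral {X : Matrix n n ℂ} (hX : X.IsHermitian) :
    ∃ V : Matrix n n ℂ, Vᴴ * V = 1 ∧ V * Vᴴ = 1 ∧
      X = V * diagonal (fun i => (hX.eigenvalues i : ℂ)) * Vᴴ ∧
      ∀ f : ℝ → ℝ, cfc f X = V * diagonal (fun i => (f (hX.eigenvalues i) : ℂ)) * Vᴴ := by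
  refine ⟨hX.eigenvectorUnitary, ?_, ?_, ?_, ?_⟩
  · rw [← star_eq_conjTranspose]; exact Unitary.coe_star_mul_self _
  · rw [← star_eq_conjTranspose]; exact Unitary.coe_mul_star_self _
  · have := hX.spectral_theorem
    rw [Unitary.conjStarAlgAut_apply] at this
    exact this
  · intro f
    rw [hX.cfc_eq, IsHermitian.cfc, Unitary.conjStarAlgAut_apply]
    rfl

theorem isHermitian_conj_diagonal (V : Matrix m n ℂ) (μ : n → ℝ) :
    (V * diagonal (fun i => (μ i : ℂ)) * Vᴴ).IsHermitian := by
  apply isHermitian_mul_mul_conjTranspose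
  exact isHermitian_diagonal_of_self_adjoint _ (by ext i; simp)

theorem posSemidef_conj_diagonal (V : Matrix m n ℂ) {μ : n → ℝ} (h : ∀ i, 0 ≤ μ i) :
    (V * diagonal (fun i => (μ i : ℂ)) * Vᴴ).PosSemidef := by
  apply PosSemidef.mul_mul_conjTranspose_same
  exact PosSemidef.diagonal fun i => by simpa using h i

theorem trace_conj_diagonal {V : Matrix m n ℂ} (hV : Vᴴ * V = 1) (μ : n → ℝ) :
    (V * diagonal (fun i => (μ i : ℂ)) * Vᴴ).trace = ((∑ i, μ i : ℝ) : ℂ) := by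
  rw [trace_mul_comm, ← Matrix.mul_assoc, hV, Matrix.one_mul, trace_diagonal]
  push_cast; rfl

theorem norm_conj_diagonal_le {V : Matrix m n ℂ} (hV : Vᴴ * V = 1) {μ : n → ℝ} {c : ℝ}
    (hc : 0 ≤ c) (h : ∀ i, |μ i| ≤ c) : ‖V * diagonal (fun i => (μ i : ℂ)) * Vᴴ‖ ≤ c := by
  have hV1 := norm_le_one_of_isometry hV
  refine (norm_conj_le _ hV1 (norm_conjTranspose_le_one hV1)).trans ?_
  rw [l2_opNorm_diagonal]
  refine (pi_norm_le_iff_of_nonneg hc).2 fun i => by simpa using h i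

theorem traceNorm_eq_sum {X : Matrix n n ℂ} (hX : X.IsHermitian) :
    traceNorm X = ∑ i, |hX.eigenvalues i| := by
  obtain ⟨V, hV, -, -, hf⟩ := exists_spectral hX
  have h1 : Xᴴ * X = cfc (fun x : ℝ => x ^ 2) X := by
    rw [hX.eq, cfc_pow_id (R := ℝ) X 2 (ha := hX.isSelfAdjoint), sq]
  have h2 : cfc Real.sqrt (Xᴴ * X) = cfc (fun x : ℝ => |x|) X := by
    rw [h1, ← cfc_comp' Real.sqrt (fun x : ℝ => x ^ 2) X (ha := hX.isSelfAdjoint)]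
    simp only [Real.sqrt_sq_eq_abs]
  rw [traceNorm, h2, hf, trace_conj_diagonal hV, Complex.ofReal_re]

theorem norm_trace_mul_le {X : Matrix n n ℂ} (hX : X.IsHermitian) (Y : Matrix n n ℂ) :
    ‖(X * Y).trace‖ ≤ traceNorm X * ‖Y‖ := by
  obtain ⟨V, hV, -, hXV, -⟩ := exists_spectral hX
  rw [traceNorm_eq_sum hX]
  conv_lhs => rw [hXV]
  exact norm_trace_conj_diagonal_mul_le hV _ Y

/-- Duality with the operator norm: the test operator `Y = sign X` attains the trace norm. The
triangle inequality and the monotonicity properties below follow by moving maps onto `Y`. -/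
theorem traceNorm_le {X : Matrix n n ℂ} (hX : X.IsHermitian) {t : ℝ}
    (h : ∀ Y : Matrix n n ℂ, ‖Y‖ ≤ 1 → ‖(X * Y).trace‖ ≤ t) : traceNorm X ≤ t := by
  obtain ⟨V, hV, -, hXV, hf⟩ := exists_spectral hX
  rw [traceNorm_eq_sum hX]
  set s : n → ℝ := fun i => SignType.sign (hX.eigenvalues i)
  have hs : ∀ i, |s i| ≤ 1 := fun i => by
    simp only [s]; rcases lt_trichotomy (hX.eigenvalues i) 0 with h | h | h <;> simp [h]
  refine le_trans ?_ (h _ (norm_conj_diagonal_le hV zero_le_one hs))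
  have : X * (V * diagonal (fun i => (s i : ℂ)) * Vᴴ)
      = V * diagonal (fun i => ((|hX.eigenvalues i| : ℝ) : ℂ)) * Vᴴ := by
    conv_lhs => rw [hXV]
    calc V * diagonal (fun i => (hX.eigenvalues i : ℂ)) * Vᴴ * (V * diagonal (fun i => (s i : ℂ)) * Vᴴ)
        = V * diagonal (fun i => (hX.eigenvalues i : ℂ)) * (Vᴴ * V) *
          (diagonal (fun i => (s i : ℂ)) * Vᴴ) := by simp only [Matrix.mul_assoc]
      _ = V * (diagonal (fun i => (hX.eigenvalues i : ℂ)) * diagonal (fun i => (s i : ℂ))) * Vᴴ := by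
          rw [hV]; simp only [Matrix.mul_assoc, Matrix.one_mul]
      _ = _ := by
          rw [diagonal_mul_diagonal]
          congr 3; ext i
          simp only [s]
          rw [← Complex.ofReal_mul, mul_comm, sign_mul_self]
  rw [this, trace_conj_diagonal hV, Complex.norm_real]
  exact le_abs_self _

theorem traceNorm_nonneg {X : Matrix n n ℂ} (hX : X.IsHermitian) : 0 ≤ traceNorm X := by
  rw [traceNorm_eq_sum hX]; positivity

theorem traceNorm_add_le {X Z : Matrix n n ℂ} (hX : X.IsHermitian) (hZ : Z.IsHermitian) :
    traceNorm (X + Z) ≤ traceNorm X + traceNorm Z := by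
  refine traceNorm_le (hX.add hZ) fun Y hY => ?_
  rw [add_mul, trace_add]
  refine (norm_add_le _ _).trans (add_le_add ?_ ?_)
  · exact (norm_trace_mul_le hX Y).trans (mul_le_of_le_one_right (traceNorm_nonneg hX) hY)
  · exact (norm_trace_mul_le hZ Y).trans (mul_le_of_le_one_right (traceNorm_nonneg hZ) hY)

theorem traceNorm_neg {X : Matrix n n ℂ} : traceNorm (-X) = traceNorm X := by
  simp [traceNorm]

theorem traceNorm_sub_comm {X Z : Matrix n n ℂ} : traceNorm (X - Z) = traceNorm (Z - X) := by
  rw [← traceNorm_neg, neg_sub]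

theorem traceNorm_sub_le {X Z : Matrix n n ℂ} (hX : X.IsHermitian) (hZ : Z.IsHermitian) :
    traceNorm (X - Z) ≤ traceNorm X + traceNorm Z := by
  rw [sub_eq_add_neg, ← traceNorm_neg (X := Z)]
  exact traceNorm_add_le hX hZ.neg

theorem traceNorm_sub_le_add {X Y Z : Matrix n n ℂ} (hX : X.IsHermitian) (hY : Y.IsHermitian)
    (hZ : Z.IsHermitian) : traceNorm (X - Z) ≤ traceNorm (X - Y) + traceNorm (Y - Z) := by
  rw [← sub_add_sub_cancel X Y Z]
  exact traceNorm_add_le (hX.sub hY) (hY.sub hZ)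

theorem traceNorm_conj_le {X : Matrix n n ℂ} (hX : X.IsHermitian) {J : Matrix m n ℂ}
    (hJ : ‖J‖ ≤ 1) : traceNorm (J * X * Jᴴ) ≤ traceNorm X := by
  refine traceNorm_le (isHermitian_mul_mul_conjTranspose _ hX) fun Y hY => ?_
  rw [Matrix.mul_assoc, Matrix.mul_assoc, trace_mul_comm, Matrix.mul_assoc]
  refine (norm_trace_mul_le hX _).trans (mul_le_of_le_one_right (traceNorm_nonneg hX) ?_)
  exact (norm_conj_le _ (norm_conjTranspose_le_one hJ) hJ).trans hY

theorem traceNorm_conj_diagonal_le {V : Matrix m n ℂ} (hV : Vᴴ * V = 1) (μ : n → ℝ) :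
    traceNorm (V * diagonal (fun i => (μ i : ℂ)) * Vᴴ) ≤ ∑ i, |μ i| :=
  traceNorm_le (isHermitian_conj_diagonal V μ) fun Y hY =>
    (norm_trace_conj_diagonal_mul_le hV μ Y).trans
      (mul_le_of_le_one_right (Finset.sum_nonneg fun _ _ => abs_nonneg _) hY)

theorem PosSemidef_traceNorm {X : Matrix n n ℂ} (hX : X.PosSemidef) :
    traceNorm X = X.trace.re := by
  rw [traceNorm_eq_sum hX.1, hX.1.trace_eq_sum_eigenvalues]
  simp only [abs_of_nonneg (hX.eigenvalues_nonneg _)]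
  simp

theorem PosSemidef_trace_eq {X : Matrix n n ℂ} (hX : X.PosSemidef) :
    X.trace = (X.trace.re : ℂ) := by
  have := hX.trace_nonneg
  rw [Complex.nonneg_iff] at this
  apply Complex.ext <;> simp [this.2.symm]

theorem PosSemidef_trace_re_nonneg {X : Matrix n n ℂ} (hX : X.PosSemidef) :
    0 ≤ X.trace.re := (Complex.nonneg_iff.1 hX.trace_nonneg).1

theorem norm_trace_mul_le_of_posSemidef {X : Matrix n n ℂ} (hX : X.PosSemidef)
    (Y : Matrix n n ℂ) : ‖(X * Y).trace‖ ≤ X.trace.re * ‖Y‖ := by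
  rw [← PosSemidef_traceNorm hX]; exact norm_trace_mul_le hX.1 Y

/-- The eigenvalues of the tensor product are products, and those of `η` sum to one. -/
theorem traceNorm_kronecker_le {X : Matrix n n ℂ} (hX : X.IsHermitian) {η : Matrix m m ℂ}
    (hη : IsState η) : traceNorm (X ⊗ₖ η) ≤ traceNorm X := by
  obtain ⟨V, hV, -, hXV, -⟩ := exists_spectral hX
  obtain ⟨W, hW, -, hYW, -⟩ := exists_spectral hη.1.1
  have h1 : X ⊗ₖ η = (V ⊗ₖ W) * diagonal (fun i : n × m =>
      ((hX.eigenvalues i.1 * hη.1.1.eigenvalues i.2 : ℝ) : ℂ)) * (V ⊗ₖ W)ᴴ := by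
    conv_lhs => rw [hXV, hYW]
    rw [mul_kronecker_mul, mul_kronecker_mul, diagonal_kronecker_diagonal, conjTranspose_kronecker]
    simp
  rw [h1]
  refine (traceNorm_conj_diagonal_le ?_ _).trans ?_
  · rw [conjTranspose_kronecker, ← mul_kronecker_mul, hV, hW, one_kronecker_one]
  · rw [traceNorm_eq_sum hX, Fintype.sum_prod_type]
    simp only [abs_mul, ← Finset.mul_sum]
    have h2 : ∑ i, |hη.1.1.eigenvalues i| = 1 := by
      rw [← traceNorm_eq_sum, PosSemidef_traceNorm hη.1, hη.2]; simp
    simp [h2]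

end Spectral

/-! ### Partial trace -/

section PartialTrace

variable {m n k : Type*} [Fintype m] [Fintype n] [Fintype k]

theorem trAnc_sub (M N : Matrix (m × n) (m × n) ℂ) : trAnc (M - N) = trAnc M - trAnc N := by
  ext i j; simp [trAnc]

theorem trAnc_add (M N : Matrix (m × n) (m × n) ℂ) : trAnc (M + N) = trAnc M + trAnc N := by
  ext i j; simp [trAnc, Finset.sum_add_distrib]

theorem trAnc_conjTranspose (M : Matrix (m × n) (m × n) ℂ) : trAnc Mᴴ = (trAnc M)ᴴ := by
  ext i j; simp [trAnc]

theorem trace_trAnc (M : Matrix (m × n) (m × n) ℂ) : (trAnc M).trace = M.trace := by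
  simp [trAnc, trace, Fintype.sum_prod_type]

theorem IsHermitian.trAnc {M : Matrix (m × n) (m × n) ℂ} (hM : M.IsHermitian) :
    (trAnc M).IsHermitian := by
  rw [Matrix.IsHermitian, ← trAnc_conjTranspose, hM.eq]

variable [DecidableEq n]

theorem trAnc_conj_kronecker_one (A : Matrix k m ℂ) (B : Matrix m k ℂ)
    (M : Matrix (m × n) (m × n) ℂ) :
    trAnc ((A ⊗ₖ (1 : Matrix n n ℂ)) * M * (B ⊗ₖ (1 : Matrix n n ℂ))) = A * trAnc M * B := by
  ext i j
  simp only [trAnc, of_apply, mul_apply, kronecker_apply, Fintype.sum_prod_type, one_apply,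
    mul_ite, mul_one, mul_zero, ite_mul, zero_mul, Finset.sum_ite_eq, Finset.mem_univ, if_true,
    Finset.sum_mul, Finset.mul_sum]
  rw [Finset.sum_comm]
  refine Finset.sum_congr rfl fun x _ => ?_
  refine Eq.trans (Finset.sum_congr rfl fun y _ => ?_) Finset.sum_comm
  rw [Finset.sum_comm]
  simp

theorem trace_trAnc_mul (M : Matrix (m × n) (m × n) ℂ) (Y : Matrix m m ℂ) :
    (trAnc M * Y).trace = (M * (Y ⊗ₖ (1 : Matrix n n ℂ))).trace := by
  classical
  have := trAnc_conj_kronecker_one (1 : Matrix m m ℂ) Y M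
  rw [one_kronecker_one, Matrix.one_mul, Matrix.one_mul] at this
  rw [← this, trace_trAnc]

variable [DecidableEq m]

/-- The partial trace is dual to `Y ↦ Y ⊗ 1`, which does not increase the operator norm. -/
theorem traceNorm_trAnc_le {M : Matrix (m × n) (m × n) ℂ} (hM : M.IsHermitian) :
    traceNorm (trAnc M) ≤ traceNorm M := by
  refine traceNorm_le (IsHermitian.trAnc hM) fun Y hY => ?_
  rw [trace_trAnc_mul]
  exact (norm_trace_mul_le hM _).trans (mul_le_of_le_one_right (traceNorm_nonneg hM)
    ((norm_kronecker_one_le Y).trans hY))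

theorem PosSemidef.trAnc {M : Matrix (m × n) (m × n) ℂ} (hM : M.PosSemidef) :
    (trAnc M).PosSemidef := by
  classical
  have : QThermo.trAnc M = ∑ a, M.submatrix (fun i => (i, a)) (fun i => (i, a)) := by
    ext i j; simp [QThermo.trAnc, Matrix.sum_apply]
  rw [this]
  exact posSemidef_sum _ fun a _ => hM.submatrix _

end PartialTrace


/-! ### Tensor powers and the Hamiltonian of `n` copies -/

section Tensor

variable {d n : ℕ}

theorem sum_prod_words {R : Type*} [CommSemiring R] (F : Fin n → Fin d → R) :
    ∑ x : Fin n → Fin d, ∏ i, F i (x i) = ∏ i, ∑ y, F i y := by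
  rw [Finset.prod_univ_sum, Fintype.piFinset_univ]

theorem tensorFamily_mul (A B : Fin n → Matrix (Fin d) (Fin d) ℂ) :
    tensorFamily A * tensorFamily B = tensorFamily fun i => A i * B i := by
  ext x y
  simp only [tensorFamily, mul_apply, of_apply, ← Finset.prod_mul_distrib]
  exact sum_prod_words fun i z => A i (x i) z * B i z (y i)

theorem tensorFamily_conjTranspose (A : Fin n → Matrix (Fin d) (Fin d) ℂ) :
    (tensorFamily A)ᴴ = tensorFamily fun i => (A i)ᴴ := by
  ext x y
  simp [tensorFamily, conjTranspose_apply]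

theorem trace_tensorFamily (A : Fin n → Matrix (Fin d) (Fin d) ℂ) :
    (tensorFamily A).trace = ∏ i, (A i).trace := by
  simp only [trace, diag_apply, tensorFamily, of_apply]
  exact sum_prod_words fun i z => A i z z

theorem tensorFamily_diagonal (v : Fin n → Fin d → ℂ) :
    (tensorFamily fun i => diagonal (v i)) = diagonal fun x => ∏ i, v i (x i) := by
  ext x y
  simp only [tensorFamily, of_apply, diagonal_apply]
  split_ifs with h
  · subst h; simp
  · obtain ⟨i, hi⟩ := Function.ne_iff.1 h
    exact Finset.prod_eq_zero (Finset.mem_univ i) (by simp [hi])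

theorem tensorFamily_one : (tensorFamily fun _ : Fin n => (1 : Matrix (Fin d) (Fin d) ℂ)) = 1 := by
  have := tensorFamily_diagonal (n := n) (d := d) fun _ _ => 1
  simpa [diagonal_one] using this

theorem tensorPower_mul (A B : Matrix (Fin d) (Fin d) ℂ) :
    tensorPower n A * tensorPower n B = tensorPower n (A * B) := tensorFamily_mul _ _

theorem tensorPower_conjTranspose (A : Matrix (Fin d) (Fin d) ℂ) :
    (tensorPower n A)ᴴ = tensorPower n Aᴴ := tensorFamily_conjTranspose _

theorem tensorPower_one : tensorPower n (1 : Matrix (Fin d) (Fin d) ℂ) = 1 := tensorFamily_one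

theorem tensorPower_diagonal (v : Fin d → ℝ) :
    tensorPower n (diagonal fun i => (v i : ℂ)) =
      diagonal fun x => ((∏ i, v (x i) : ℝ) : ℂ) := by
  rw [tensorPower, tensorFamily_diagonal]; push_cast; rfl

theorem tensorPower_isometry {V : Matrix (Fin d) (Fin d) ℂ} (hV : Vᴴ * V = 1) :
    (tensorPower n V)ᴴ * tensorPower n V = 1 := by
  rw [tensorPower_conjTranspose, tensorPower_mul, hV, tensorPower_one]

theorem tensorPower_conj (V A : Matrix (Fin d) (Fin d) ℂ) :
    tensorPower n (V * A * Vᴴ) = tensorPower n V * tensorPower n A * (tensorPower n V)ᴴ := by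
  rw [tensorPower_conjTranspose, tensorPower_mul, tensorPower_mul]

theorem IsState.tensorPower {ρ : Matrix (Fin d) (Fin d) ℂ} (hρ : IsState ρ) (n : ℕ) :
    IsState (tensorPower n ρ) := by
  constructor
  · obtain ⟨V, hV, -, h, -⟩ := exists_spectral hρ.1.1
    rw [h, tensorPower_conj, tensorPower_diagonal]
    exact posSemidef_conj_diagonal _ fun x =>
      Finset.prod_nonneg fun i _ => hρ.1.eigenvalues_nonneg _
  · rw [QThermo.tensorPower, trace_tensorFamily, Finset.prod_const, hρ.2, one_pow]

theorem copiesHam_conj {V : Matrix (Fin d) (Fin d) ℂ} (hV : V * Vᴴ = 1)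
    (H : Matrix (Fin d) (Fin d) ℂ) :
    copiesHam n (V * H * Vᴴ) = tensorPower n V * copiesHam n H * (tensorPower n V)ᴴ := by
  simp only [copiesHam, Finset.mul_sum, Finset.sum_mul, tensorPower_conjTranspose]
  refine Finset.sum_congr rfl fun i _ => ?_
  rw [tensorPower, tensorPower, tensorFamily_mul, tensorFamily_mul]
  congr 1; ext1 j
  by_cases h : j = i
  · subst h; simp
  · simp [h, hV]

theorem copiesHam_diagonal (h : Fin d → ℝ) :
    copiesHam n (diagonal fun i => (h i : ℂ)) =
      diagonal fun x => ((∑ i, h (x i) : ℝ) : ℂ) := by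
  have : ∀ i : Fin n, tensorFamily (Function.update (fun _ => (1 : Matrix (Fin d) (Fin d) ℂ)) i
      (diagonal fun i => (h i : ℂ))) = diagonal fun x => (h (x i) : ℂ) := fun i => by
    have h1 : (Function.update (fun _ => (1 : Matrix (Fin d) (Fin d) ℂ)) i
      (diagonal fun i => (h i : ℂ))) = fun j => diagonal
        (Function.update (fun _ _ => (1 : ℂ)) i (fun k => (h k : ℂ)) j) := by
      ext1 j
      by_cases hj : j = i
      · subst hj; simp
      · simp [hj]
    rw [h1, tensorFamily_diagonal]
    congr 1; ext x
    rw [Finset.prod_eq_single i] <;> simp +contextual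
  simp only [copiesHam, this]
  ext x y
  rw [Matrix.sum_apply]
  by_cases hxy : x = y
  · subst hxy; simp
  · simp [hxy]

theorem norm_copiesHam_le {H : Matrix (Fin d) (Fin d) ℂ} (hH : H.IsHermitian) :
    ∃ c : ℝ, ∀ n, ‖copiesHam n H‖ ≤ n * c := by
  obtain ⟨V, hV', hV, h, -⟩ := exists_spectral hH
  refine ⟨∑ i, |hH.eigenvalues i|, fun n => ?_⟩
  conv_lhs => rw [h, copiesHam_conj hV, copiesHam_diagonal]
  refine norm_conj_diagonal_le (tensorPower_isometry hV') (by positivity) fun x => ?_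
  refine (Finset.abs_sum_le_sum_abs _ _).trans ?_
  refine (Finset.sum_le_card_nsmul _ _ (∑ i, |hH.eigenvalues i|) fun i _ =>
    Finset.single_le_sum (f := fun i => |hH.eigenvalues i|) (fun _ _ => abs_nonneg _)
      (Finset.mem_univ _)).trans ?_
  simp

theorem trace_copiesHam_mul (H : Matrix (Fin d) (Fin d) ℂ) {ρ : Matrix (Fin d) (Fin d) ℂ}
    (hρ : ρ.trace = 1) : (copiesHam n H * tensorPower n ρ).trace = n * (H * ρ).trace := by
  simp only [copiesHam, Finset.sum_mul, trace_sum, tensorPower, tensorFamily_mul,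
    trace_tensorFamily]
  have : ∀ i : Fin n, ∏ j, (Function.update (fun _ => (1 : Matrix (Fin d) (Fin d) ℂ)) i H j
      * ρ).trace = (H * ρ).trace := fun i => by
    rw [Finset.prod_eq_single i] <;> simp +contextual [hρ]
  simp [this]

end Tensor

/-! ### Classical typicality: Chebyshev bounds for words -/

section Typicality

variable {d : ℕ}

theorem sum_prod_eq_one {p : Fin d → ℝ} (hp : ∑ i, p i = 1) (n : ℕ) :
    ∑ x : Fin n → Fin d, ∏ i, p (x i) = 1 := by
  rw [sum_prod_words fun _ => p]; simp [hp]

/-- Induction on the first letter; independence and centring remove the cross term of the square,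
which is why the first moment is carried along. -/
theorem sum_prod_mul_sq {p f : Fin d → ℝ} (hp : ∑ i, p i = 1) (hf : ∑ i, p i * f i = 0) (n : ℕ) :
    ∑ x : Fin n → Fin d, (∏ i, p (x i)) * (∑ i, f (x i)) = 0 ∧
    ∑ x : Fin n → Fin d, (∏ i, p (x i)) * (∑ i, f (x i)) ^ 2 = n * ∑ i, p i * f i ^ 2 := by
  induction n with
  | zero => simp
  | succ n ih =>
    have key : ∀ G : (Fin (n + 1) → Fin d) → ℝ,
        ∑ x, G x = ∑ y : Fin d, ∑ x : Fin n → Fin d, G (Fin.cons y x) := fun G => by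
      rw [← Fintype.sum_prod_type']
      exact (Fintype.sum_equiv (Fin.consEquiv fun _ => Fin d) _ _ fun _ => rfl).symm
    have h1 := sum_prod_eq_one hp n
    rw [key, key]
    simp only [Fin.prod_univ_succ, Fin.sum_univ_succ, Fin.cons_zero, Fin.cons_succ]
    constructor
    · have : ∀ (y : Fin d) (x : Fin n → Fin d), p y * (∏ i, p (x i)) * (f y + ∑ i, f (x i)) =
          (p y * f y) * (∏ i, p (x i)) + p y * ((∏ i, p (x i)) * ∑ i, f (x i)) := fun y x => by ring
      simp only [this, Finset.sum_add_distrib, ← Finset.mul_sum, h1, ih.1, hf, mul_one, mul_zero]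
      simp
    · have : ∀ (y : Fin d) (x : Fin n → Fin d), p y * (∏ i, p (x i)) * (f y + ∑ i, f (x i)) ^ 2 =
          (p y * f y ^ 2) * (∏ i, p (x i)) + 2 * (p y * f y) * ((∏ i, p (x i)) * ∑ i, f (x i))
          + p y * ((∏ i, p (x i)) * (∑ i, f (x i)) ^ 2) := fun y x => by ring
      simp only [this, Finset.sum_add_distrib, ← Finset.mul_sum, ← Finset.sum_mul, h1, ih.1, ih.2,
        hp, mul_one, mul_zero]
      simp; ring

/-- Chebyshev's inequality for a sum of independent identically distributed variables. -/
theorem sum_prod_tail_le {p g : Fin d → ℝ} (hp0 : ∀ i, 0 ≤ p i) (hp : ∑ i, p i = 1) (n : ℕ)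
    {w : ℝ} (hw : 0 < w) :
    ∑ x : Fin n → Fin d with ¬ |(∑ i, g (x i)) - n * ∑ j, p j * g j| ≤ w, ∏ i, p (x i)
      ≤ n * (∑ i, p i * (g i - ∑ j, p j * g j) ^ 2) / w ^ 2 := by
  set m := ∑ j, p j * g j
  have hf : ∑ i, p i * (g i - m) = 0 := by
    simp only [mul_sub, Finset.sum_sub_distrib, ← Finset.sum_mul, hp]; simp [m]
  rw [← (sum_prod_mul_sq hp hf n).2, le_div_iff₀ (by positivity), Finset.sum_mul]
  have h0 : ∀ x : Fin n → Fin d, 0 ≤ ∏ i, p (x i) := fun x => Finset.prod_nonneg fun i _ => hp0 _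
  refine (Finset.sum_le_sum fun x hx => ?_).trans
    (Finset.sum_le_univ_sum_of_nonneg fun x => mul_nonneg (h0 x) (sq_nonneg _))
  have hx' := (Finset.mem_filter.1 hx).2
  refine mul_le_mul_of_nonneg_left ?_ (h0 x)
  have : ∑ i, (g (x i) - m) = (∑ i, g (x i)) - n * m := by simp
  rw [this, ← sq_abs ((∑ i, g (x i)) - n * m)]
  gcongr
  exact (not_le.1 hx').le

/-- Typical words are those whose log-likelihood is within `w` of its mean. Chebyshev bounds the
rest, and since each typical word has probability at least `exp (n m - w)`, there are at most `exp
(-n m + w)` of them. -/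
theorem exists_typical {p : Fin d → ℝ} (hp0 : ∀ i, 0 ≤ p i) (hp : ∑ i, p i = 1) :
    ∃ C : ℝ, 0 ≤ C ∧ ∀ (n : ℕ) (w : ℝ), 0 < w → ∃ X : Finset (Fin n → Fin d),
      ∑ x ∈ Xᶜ, ∏ i, p (x i) ≤ n * C / w ^ 2 ∧
      (∀ x ∈ X, ∏ i, p (x i) ≤ Real.exp (n * (∑ j, p j * Real.log (p j)) + w)) ∧
      (X.card : ℝ) ≤ Real.exp (-(n * ∑ j, p j * Real.log (p j)) + w) := by
  set m := ∑ j, p j * Real.log (p j)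
  have h0 : ∀ {n} (x : Fin n → Fin d), 0 ≤ ∏ i, p (x i) :=
    fun x => Finset.prod_nonneg fun i _ => hp0 _
  refine ⟨∑ i, p i * (Real.log (p i) - m) ^ 2,
    Finset.sum_nonneg fun i _ => mul_nonneg (hp0 i) (sq_nonneg _), fun n w hw => ?_⟩
  -- Words of probability zero are excluded explicitly: since `Real.log 0 = 0`, the sum of
  -- logarithms alone does not detect them.
  set X : Finset (Fin n → Fin d) := Finset.univ.filter fun x =>
    ∏ i, p (x i) ≠ 0 ∧ |(∑ i, Real.log (p (x i))) - n * m| ≤ w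
  have hX : ∀ x ∈ X, Real.exp (n * m - w) ≤ ∏ i, p (x i) ∧
      ∏ i, p (x i) ≤ Real.exp (n * m + w) := fun x hx => by
    obtain ⟨hx1, hx2⟩ := (Finset.mem_filter.1 hx).2
    rw [← Real.log_prod fun i _ => Finset.prod_ne_zero_iff.1 hx1 i (Finset.mem_univ i),
      abs_le] at hx2
    have hpos := lt_of_le_of_ne (h0 x) hx1.symm
    rw [← Real.le_log_iff_exp_le hpos, ← Real.log_le_iff_le_exp hpos]
    constructor <;> linarith
  refine ⟨X, ?_, fun x hx => (hX x hx).2, ?_⟩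
  · refine le_trans ?_ (sum_prod_tail_le (g := fun i => Real.log (p i)) hp0 hp n hw)
    rw [← Finset.sum_filter_ne_zero]
    refine Finset.sum_le_sum_of_subset_of_nonneg (fun x hx => ?_) fun x _ _ => h0 x
    simp only [X, Finset.mem_filter, Finset.mem_compl, Finset.mem_univ, true_and, not_and] at hx ⊢
    exact hx.1 hx.2
  · have h1 : X.card * Real.exp (n * m - w) ≤ 1 := by
      rw [← sum_prod_eq_one hp n, ← nsmul_eq_mul]
      refine (Finset.card_nsmul_le_sum _ _ _ fun x hx => (hX x hx).1).trans ?_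
      exact Finset.sum_le_univ_sum_of_nonneg h0
    rw [show -(n * m) + w = -(n * m - w) by ring, Real.exp_neg, ← one_div,
      le_div_iff₀ (Real.exp_pos _)]
    exact h1

end Typicality


/-! ### States, ranks and positivity -/

section States

variable {m n : Type*} [Fintype m] [Fintype n] [DecidableEq m] [DecidableEq n]

theorem IsState.kronecker {ρ : Matrix m m ℂ} {η : Matrix n n ℂ} (hρ : IsState ρ)
    (hη : IsState η) : IsState (ρ ⊗ₖ η) :=
  ⟨hρ.1.kronecker hη.1, by rw [trace_kronecker, hρ.2, hη.2, one_mul]⟩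

theorem IsState.conj {ρ U : Matrix n n ℂ} (hρ : IsState ρ) (hU : Uᴴ * U = 1) :
    IsState (U * ρ * Uᴴ) :=
  ⟨hρ.1.mul_mul_conjTranspose_same U, by
    rw [trace_mul_comm, ← Matrix.mul_assoc, hU, Matrix.one_mul, hρ.2]⟩

theorem IsState.sum_eigenvalues {ρ : Matrix n n ℂ} (hρ : IsState ρ) :
    ∑ i, hρ.1.1.eigenvalues i = 1 := by
  have h := hρ.2
  rw [hρ.1.1.trace_eq_sum_eigenvalues] at h
  simpa using congrArg Complex.re h

theorem IsState.norm_le_one {ρ : Matrix n n ℂ} (hρ : IsState ρ) : ‖ρ‖ ≤ 1 := by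
  obtain ⟨V, hV, -, h, -⟩ := exists_spectral hρ.1.1
  have h1 := hρ.sum_eigenvalues
  have h0 := hρ.1.eigenvalues_nonneg
  have h2 : ‖V * diagonal (fun i => (hρ.1.1.eigenvalues i : ℂ)) * Vᴴ‖ ≤ 1 :=
    norm_conj_diagonal_le hV zero_le_one fun i => by
      rw [abs_of_nonneg (h0 i), ← h1]
      exact Finset.single_le_sum (fun i _ => h0 i) (Finset.mem_univ i)
  rwa [← h] at h2

theorem norm_kronecker_le (A : Matrix m m ℂ) (B : Matrix n n ℂ) : ‖A ⊗ₖ B‖ ≤ ‖A‖ * ‖B‖ := by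
  have : A ⊗ₖ B = (A ⊗ₖ (1 : Matrix n n ℂ)) * ((1 : Matrix m m ℂ) ⊗ₖ B) := by
    rw [← mul_kronecker_mul, Matrix.mul_one, Matrix.one_mul]
  rw [this]
  refine (l2_opNorm_mul _ _).trans ?_
  gcongr
  · exact norm_kronecker_one_le A
  · exact norm_one_kronecker_le B

theorem trace_mul_conj_diagonal_nonneg {P : Matrix m m ℂ} (hP : P.PosSemidef) (V : Matrix m n ℂ)
    {μ : n → ℝ} (hμ : ∀ i, 0 ≤ μ i) :
    0 ≤ (P * (V * diagonal (fun i => (μ i : ℂ)) * Vᴴ)).trace.re := by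
  rw [trace_mul_comm, trace_conj_diagonal_mul, Complex.re_sum]
  refine Finset.sum_nonneg fun i _ => ?_
  rw [Complex.re_ofReal_mul]
  refine mul_nonneg (hμ i) ?_
  have : 0 ≤ (Vᴴ * P * V) i i := (hP.conjTranspose_mul_mul_same V).diag_nonneg
  exact (Complex.nonneg_iff.1 this).1

/-- Each block summed in the partial trace factors through `l`; placing the blocks side by side
factors the sum through `l × n`. -/
theorem rank_trAnc_mul_le {l : Type*} [Fintype l] [DecidableEq l] (Z : Matrix (m × n) l ℂ)
    (B : Matrix l (m × n) ℂ) :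
    (trAnc (Z * B)).rank ≤ Fintype.card l * Fintype.card n := by
  have : trAnc (Z * B) = (of fun i (p : l × n) => Z (i, p.2) p.1) *
      (of fun (p : l × n) j => B p.1 (j, p.2)) := by
    ext i j
    simp only [trAnc, of_apply, mul_apply, Fintype.sum_prod_type]
    exact Finset.sum_comm
  rw [this]
  refine (rank_mul_le_left _ _).trans ((rank_le_card_width _).trans ?_)
  rw [Fintype.card_prod]

end States

/-! ### Typical subspaces of tensor powers -/

section Typical

/-- The tensor powers of `ρ` have typical subspaces: up to a part of small trace, `ρ^{⊗ n}` lives on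
a subspace of dimension at most `exp (-n m + w)` and is bounded there by `exp (n m + w)`. -/
def HasTypicalSubspaces {d : ℕ} (ρ : Matrix (Fin d) (Fin d) ℂ) (m : ℝ) : Prop :=
  ∃ C : ℝ, 0 ≤ C ∧ ∀ (n : ℕ) (w : ℝ), 0 < w →
    ∃ (X : Finset (Fin n → Fin d)) (Z : Matrix (Fin n → Fin d) X ℂ) (μ : X → ℝ),
      Zᴴ * Z = 1 ∧ (∀ i, 0 ≤ μ i) ∧ (∀ i, μ i ≤ Real.exp (n * m + w)) ∧
      (X.card : ℝ) ≤ Real.exp (-(n * m) + w) ∧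
      (tensorPower n ρ - Z * diagonal (fun i => (μ i : ℂ)) * Zᴴ).PosSemidef ∧
      (tensorPower n ρ - Z * diagonal (fun i => (μ i : ℂ)) * Zᴴ).trace.re ≤ n * C / w ^ 2

theorem conj_diagonal_apply {ι κ : Type*} [Fintype κ] [DecidableEq κ] (A : Matrix ι κ ℂ)
    (c : κ → ℂ) (i j : ι) :
    (A * diagonal c * Aᴴ) i j = ∑ k, A i k * c k * star (A j k) := by
  rw [mul_apply]; simp [mul_diagonal]

theorem isometry_submatrix {ι : Type*} [Fintype ι] [DecidableEq ι] {V : Matrix ι ι ℂ}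
    (hV : Vᴴ * V = 1) (X : Finset ι) :
    (V.submatrix id ((↑) : X → ι))ᴴ * V.submatrix id ((↑) : X → ι) = 1 := by
  ext i j
  change (Vᴴ * V) i.1 j.1 = _
  rw [hV, one_apply, one_apply]
  simp only [Subtype.coe_inj]

theorem conj_diagonal_sub_submatrix {ι : Type*} [Fintype ι] [DecidableEq ι] (V : Matrix ι ι ℂ)
    (μ : ι → ℝ) (X : Finset ι) :
    V * diagonal (fun i => (μ i : ℂ)) * Vᴴ - V.submatrix id ((↑) : X → ι) *
      diagonal (fun i : X => (μ i : ℂ)) * (V.submatrix id ((↑) : X → ι))ᴴ =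
    V * diagonal (fun i => ((if i ∈ X then 0 else μ i : ℝ) : ℂ)) * Vᴴ := by
  ext i j
  simp only [Matrix.sub_apply, conj_diagonal_apply, submatrix_apply, id]
  rw [sub_eq_iff_eq_add', Finset.sum_coe_sort X (fun k => V i k * (μ k : ℂ) * star (V j k)),
    ← Finset.sum_add_sum_compl X]
  congr 1
  have h : ∀ k, V i k * ((if k ∈ X then 0 else μ k : ℝ) : ℂ) * star (V j k)
      = if k ∈ X then 0 else V i k * (μ k : ℂ) * star (V j k) := fun k => by
    split_ifs <;> simp
  simp only [h]
  rw [Finset.sum_ite, Finset.sum_const_zero, zero_add]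
  refine Finset.sum_congr ?_ fun _ _ => rfl
  ext k; simp

/-- In an eigenbasis of `ρ` the eigenvalues of `ρ^{⊗ n}` are the probabilities of words under the
spectrum of `ρ`; `Z` collects the eigenvectors of typical words. -/
theorem hasTypicalSubspaces {d : ℕ} {ρ : Matrix (Fin d) (Fin d) ℂ} (hρ : IsState ρ) :
    HasTypicalSubspaces ρ (-entropy ρ) := by
  obtain ⟨V, hV, hV', hρV, hf⟩ := exists_spectral hρ.1.1
  set p := hρ.1.1.eigenvalues
  have hp0 : ∀ i, 0 ≤ p i := hρ.1.eigenvalues_nonneg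
  have hp : ∑ i, p i = 1 := hρ.sum_eigenvalues
  have hS : -entropy ρ = ∑ j, p j * Real.log (p j) := by
    rw [entropy, neg_neg, hf]
    have : ρ * (V * diagonal (fun i => (Real.log (p i) : ℂ)) * Vᴴ) =
        V * diagonal (fun i => ((p i * Real.log (p i) : ℝ) : ℂ)) * Vᴴ := by
      conv_lhs => rw [hρV]
      calc _ = V * diagonal (fun i => (p i : ℂ)) * (Vᴴ * V) *
            (diagonal (fun i => (Real.log (p i) : ℂ)) * Vᴴ) := by simp only [Matrix.mul_assoc]
        _ = V * (diagonal (fun i => (p i : ℂ)) * diagonal (fun i => (Real.log (p i) : ℂ))) * Vᴴ := by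
          rw [hV]; simp only [Matrix.mul_assoc, Matrix.one_mul]
        _ = _ := by rw [diagonal_mul_diagonal]; simp
    rw [this, trace_conj_diagonal hV, Complex.ofReal_re]
  obtain ⟨C, hC, h⟩ := exists_typical hp0 hp
  refine ⟨C, hC, fun n w hw => ?_⟩
  obtain ⟨X, h1, h2, h3⟩ := h n w hw
  have hVn := tensorPower_isometry (n := n) hV
  have h0 : ∀ x : Fin n → Fin d, 0 ≤ ∏ i, p (x i) :=
    fun x => Finset.prod_nonneg fun i _ => hp0 _
  have hdec := conj_diagonal_sub_submatrix (tensorPower n V) (fun x => ∏ i, p (x i)) X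
  rw [← tensorPower_diagonal, ← tensorPower_conj, ← hρV] at hdec
  refine ⟨X, (tensorPower n V).submatrix id (↑), fun x => ∏ i, p (x.1 i), ?_, fun x => h0 _,
    fun x => by rw [hS]; exact h2 _ x.2, by rw [hS]; exact h3, ?_, ?_⟩
  · exact isometry_submatrix hVn X
  · rw [hdec]
    exact posSemidef_conj_diagonal _ fun x => by split_ifs <;> simp [h0]
  · rw [hdec, trace_conj_diagonal hVn, Complex.ofReal_re]
    refine le_of_eq_of_le ?_ h1
    rw [Finset.sum_ite, Finset.sum_const_zero, zero_add]
    refine Finset.sum_congr ?_ fun _ _ => rfl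
    ext k; simp

end Typical

/-! ### Converse: estimates for fixed system and ancilla -/

section Converse

variable {ι κ : Type*} [Fintype ι] [Fintype κ] [DecidableEq ι] [DecidableEq κ]

theorem isometry_of_mem_unitaryGroup {U : Matrix ι ι ℂ} (h : U ∈ unitaryGroup ι ℂ) :
    Uᴴ * U = 1 := by
  rw [← star_eq_conjTranspose]; exact mem_unitaryGroup_iff'.1 h

/-- The total energy is unchanged, so each process alters the system energy by at most the change of
the ancilla energy, which is at most `2 ‖HA‖`. The two final system energies differ by at most `‖K‖`
times the trace distance. -/
theorem abs_trace_sub_le_of_energyPreserving {K R S : Matrix ι ι ℂ} {HA η ν : Matrix κ κ ℂ}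
    (hR : IsState R) (hS : IsState S) (hη : IsState η) (hν : IsState ν)
    {U V : Matrix (ι × κ) (ι × κ) ℂ} (hU : EnergyPreserving (jointHam K HA) U)
    (hV : EnergyPreserving (jointHam K HA) V) :
    |(K * R).trace.re - (K * S).trace.re| ≤
      ‖K‖ * traceNorm (trAnc (U * (R ⊗ₖ η) * Uᴴ - V * (S ⊗ₖ ν) * Vᴴ)) + 4 * ‖HA‖ := by
  have key : ∀ {R : Matrix ι ι ℂ} {η : Matrix κ κ ℂ} {U : Matrix (ι × κ) (ι × κ) ℂ},
      IsState R → IsState η → EnergyPreserving (jointHam K HA) U →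
      ‖(K * R).trace - (trAnc (U * (R ⊗ₖ η) * Uᴴ) * K).trace‖ ≤ 2 * ‖HA‖ := by
    intro R η U hR hη hU
    have hU1 := isometry_of_mem_unitaryGroup hU.1
    have e1 : (jointHam K HA * (U * (R ⊗ₖ η) * Uᴴ)).trace = (jointHam K HA * (R ⊗ₖ η)).trace := by
      rw [← Matrix.mul_assoc, ← Matrix.mul_assoc, ← hU.2, trace_mul_comm, ← Matrix.mul_assoc,
        ← Matrix.mul_assoc, hU1, Matrix.one_mul]
    have e2 : (jointHam K HA * (R ⊗ₖ η)).trace = (K * R).trace + (η * HA).trace := by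
      rw [jointHam, add_mul, trace_add, ← mul_kronecker_mul, ← mul_kronecker_mul, trace_kronecker,
        trace_kronecker, Matrix.one_mul, Matrix.one_mul, hR.2, hη.2, mul_one, one_mul,
        trace_mul_comm HA]
    have e3 : (jointHam K HA * (U * (R ⊗ₖ η) * Uᴴ)).trace =
        (trAnc (U * (R ⊗ₖ η) * Uᴴ) * K).trace +
          ((U * (R ⊗ₖ η) * Uᴴ) * ((1 : Matrix ι ι ℂ) ⊗ₖ HA)).trace := by
      rw [trace_trAnc_mul, jointHam, add_mul, trace_add, trace_mul_comm,
        trace_mul_comm ((1 : Matrix ι ι ℂ) ⊗ₖ HA)]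
    have b1 := norm_trace_mul_le_of_posSemidef hη.1 HA
    have hst := (hR.kronecker hη).conj hU1
    have b2 := norm_trace_mul_le_of_posSemidef hst.1 ((1 : Matrix ι ι ℂ) ⊗ₖ HA)
    rw [hη.2, Complex.one_re, one_mul] at b1
    rw [hst.2, Complex.one_re, one_mul] at b2
    have b3 := b2.trans (norm_one_kronecker_le HA)
    have : (K * R).trace - (trAnc (U * (R ⊗ₖ η) * Uᴴ) * K).trace =
        ((U * (R ⊗ₖ η) * Uᴴ) * ((1 : Matrix ι ι ℂ) ⊗ₖ HA)).trace - (η * HA).trace := by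
      linear_combination e3 - e1 - e2
    rw [this]
    exact (norm_sub_le _ _).trans (by linarith)
  have k1 := key hR hη hU
  have k2 := key hS hν hV
  have hstU := (hR.kronecker hη).conj (isometry_of_mem_unitaryGroup hU.1)
  have hstV := (hS.kronecker hν).conj (isometry_of_mem_unitaryGroup hV.1)
  have k3 := norm_trace_mul_le (IsHermitian.trAnc (hstU.1.1.sub hstV.1.1)) K
  rw [trAnc_sub, sub_mul, trace_sub] at k3
  rw [← Complex.sub_re]
  refine (Complex.abs_re_le_norm _).trans ?_
  have : (K * R).trace - (K * S).trace =
      ((K * R).trace - (trAnc (U * (R ⊗ₖ η) * Uᴴ) * K).trace) -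
      ((K * S).trace - (trAnc (V * (S ⊗ₖ ν) * Vᴴ) * K).trace) +
      ((trAnc (U * (R ⊗ₖ η) * Uᴴ) * K).trace - (trAnc (V * (S ⊗ₖ ν) * Vᴴ) * K).trace) := by ring
  rw [this, trAnc_sub]
  refine (norm_add_le _ _).trans ?_
  have := norm_sub_le ((K * R).trace - (trAnc (U * (R ⊗ₖ η) * Uᴴ) * K).trace)
    ((K * S).trace - (trAnc (V * (S ⊗ₖ ν) * Vᴴ) * K).trace)
  linarith

/-- This takes the place of a continuity bound for the entropy. The test is the projection `P` onto
the support of the output of the typical part of `R`: the first process puts weight at least `1 - ε`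
on it, while the second puts little there because the typical part of `S` is bounded by `M` and `P`
has small rank. -/
theorem one_sub_le_of_typical {R S : Matrix ι ι ℂ} {η ν : Matrix κ κ ℂ}
    (hR : IsState R) (hS : IsState S) (hη : IsState η) (hν : IsState ν)
    {U V : Matrix (ι × κ) (ι × κ) ℂ} (hU : Uᴴ * U = 1) (hV : Vᴴ * V = 1)
    {l l' : Type*} [Fintype l] [DecidableEq l] [Fintype l'] [DecidableEq l']
    {Z : Matrix ι l ℂ} {μ : l → ℝ} (hμ : ∀ i, 0 ≤ μ i)
    (hRZ : (R - Z * diagonal (fun i => (μ i : ℂ)) * Zᴴ).PosSemidef) {ε : ℝ}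
    (hRε : (R - Z * diagonal (fun i => (μ i : ℂ)) * Zᴴ).trace.re ≤ ε)
    {Z' : Matrix ι l' ℂ} (hZ' : Z'ᴴ * Z' = 1) {μ' : l' → ℝ} {M : ℝ} (hμ' : ∀ i, 0 ≤ μ' i)
    (hM : ∀ i, μ' i ≤ M) (hM0 : 0 ≤ M)
    (hSZ : (S - Z' * diagonal (fun i => (μ' i : ℂ)) * Z'ᴴ).PosSemidef) {ε' : ℝ}
    (hSε : (S - Z' * diagonal (fun i => (μ' i : ℂ)) * Z'ᴴ).trace.re ≤ ε') :
    1 - ε - ε' - traceNorm (trAnc (U * (R ⊗ₖ η) * Uᴴ - V * (S ⊗ₖ ν) * Vᴴ)) ≤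
      M * Fintype.card l * Fintype.card κ ^ 3 := by
  set Rt := Z * diagonal (fun i => (μ i : ℂ)) * Zᴴ with hRt
  set St := Z' * diagonal (fun i => (μ' i : ℂ)) * Z'ᴴ with hSt
  have hRt0 : Rt.PosSemidef := posSemidef_conj_diagonal Z hμ
  set A := trAnc (U * (Rt ⊗ₖ η) * Uᴴ) with hA
  have hA0 : A.PosSemidef :=
    PosSemidef.trAnc ((hRt0.kronecker hη.1).mul_mul_conjTranspose_same U)
  have trconj : ∀ {W : Matrix (ι × κ) (ι × κ) ℂ} (hW : Wᴴ * W = 1) (Q : Matrix ι ι ℂ)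
      {ξ : Matrix κ κ ℂ} (hξ : IsState ξ), (W * (Q ⊗ₖ ξ) * Wᴴ).trace = Q.trace := by
    intro W hW Q ξ hξ
    rw [trace_mul_comm, ← Matrix.mul_assoc, hW, Matrix.one_mul, trace_kronecker, hξ.2, mul_one]
  -- One factor `card κ` comes from the ancilla input, the other from the partial trace.
  have hrank : A.rank ≤ Fintype.card l * Fintype.card κ ^ 2 := by
    have : U * (Rt ⊗ₖ η) * Uᴴ = (U * ((Z * diagonal (fun i => (μ i : ℂ))) ⊗ₖ η)) *
        ((Zᴴ ⊗ₖ (1 : Matrix κ κ ℂ)) * Uᴴ) := by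
      have h1 : Rt ⊗ₖ η = ((Z * diagonal (fun i => (μ i : ℂ))) ⊗ₖ η) *
          (Zᴴ ⊗ₖ (1 : Matrix κ κ ℂ)) := by
        rw [← mul_kronecker_mul, Matrix.mul_one]
      rw [h1]; simp only [Matrix.mul_assoc]
    rw [hA, this]
    refine (rank_trAnc_mul_le _ _).trans (le_of_eq ?_)
    rw [Fintype.card_prod]; ring
  obtain ⟨W, hW, -, hAW, -⟩ := exists_spectral hA0.1
  set a := hA0.1.eigenvalues
  set s : ι → ℝ := fun i => if a i ≠ 0 then 1 else 0
  have hs0 : ∀ i, 0 ≤ s i := fun i => by simp only [s]; split_ifs <;> norm_num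
  have hs1 : ∀ i, |s i| ≤ 1 := fun i => by simp only [s]; split_ifs <;> norm_num
  set P := W * diagonal (fun i => (s i : ℂ)) * Wᴴ with hP
  have hP0 : P.PosSemidef := posSemidef_conj_diagonal W hs0
  have hP1 : ‖P‖ ≤ 1 := norm_conj_diagonal_le hW zero_le_one hs1
  have hPtr : P.trace.re = A.rank := by
    rw [hP, trace_conj_diagonal hW, Complex.ofReal_re, hA0.1.rank_eq_card_non_zero_eigs,
      Fintype.card_subtype, Finset.sum_ite]
    simp [a]
  have hAP : A * P = A := by
    calc A * P = W * diagonal (fun i => (a i : ℂ)) * (Wᴴ * W) *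
          (diagonal (fun i => (s i : ℂ)) * Wᴴ) := by
            conv_lhs => rw [hAW, hP]
            simp only [Matrix.mul_assoc]
      _ = W * (diagonal (fun i => (a i : ℂ)) * diagonal (fun i => (s i : ℂ))) * Wᴴ := by
          rw [hW]; simp only [Matrix.mul_assoc, Matrix.one_mul]
      _ = A := by
          conv_rhs => rw [hAW]
          rw [diagonal_mul_diagonal]
          congr 3; ext i
          simp only [s]
          by_cases h : a i = 0 <;> simp [h]
  -- the final state of the first process is mostly supported on `P`
  have low : 1 - ε ≤ (trAnc (U * (R ⊗ₖ η) * Uᴴ) * P).trace.re := by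
    have e : R ⊗ₖ η = Rt ⊗ₖ η + (R - Rt) ⊗ₖ η := by
      rw [← add_kronecker, add_sub_cancel]
    rw [e, Matrix.mul_add, Matrix.add_mul, trAnc_add, Matrix.add_mul, trace_add, ← hA, hAP,
      Complex.add_re]
    have h1 := trace_mul_conj_diagonal_nonneg (PosSemidef.trAnc
      ((hRZ.kronecker hη.1).mul_mul_conjTranspose_same U)) W hs0
    have h2 : A.trace.re = 1 - (R - Rt).trace.re := by
      rw [hA, trace_trAnc, trconj hU _ hη, trace_sub, hR.2]; simp
    linarith
  have up : (trAnc (V * (S ⊗ₖ ν) * Vᴴ) * P).trace.re ≤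
      ε' + M * Fintype.card l * Fintype.card κ ^ 3 := by
    have e : S ⊗ₖ ν = St ⊗ₖ ν + (S - St) ⊗ₖ ν := by
      rw [← add_kronecker, add_sub_cancel]
    rw [trace_trAnc_mul, e, Matrix.mul_add, Matrix.add_mul, Matrix.add_mul, trace_add,
      Complex.add_re]
    have h1 : ((V * ((S - St) ⊗ₖ ν) * Vᴴ) * (P ⊗ₖ (1 : Matrix κ κ ℂ))).trace.re ≤ ε' := by
      refine (Complex.re_le_norm _).trans ((norm_trace_mul_le_of_posSemidef
        ((hSZ.kronecker hν.1).mul_mul_conjTranspose_same V) _).trans ?_)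
      rw [trconj hV _ hν]
      refine le_trans ?_ hSε
      exact mul_le_of_le_one_right (PosSemidef_trace_re_nonneg hSZ)
        ((norm_kronecker_one_le P).trans hP1)
    have h2 : ((V * (St ⊗ₖ ν) * Vᴴ) * (P ⊗ₖ (1 : Matrix κ κ ℂ))).trace.re ≤
        M * Fintype.card l * Fintype.card κ ^ 3 := by
      rw [trace_mul_comm]
      refine (Complex.re_le_norm _).trans ((norm_trace_mul_le_of_posSemidef
        (hP0.kronecker PosSemidef.one) _).trans ?_)
      have hV1 := norm_le_one_of_isometry hV
      have hn : ‖V * (St ⊗ₖ ν) * Vᴴ‖ ≤ M := by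
        refine (norm_conj_le _ hV1 (norm_conjTranspose_le_one hV1)).trans
          ((norm_kronecker_le _ _).trans ?_)
        have : ‖St‖ ≤ M := norm_conj_diagonal_le hZ' hM0 fun i => by
          rw [abs_of_nonneg (hμ' i)]; exact hM i
        calc ‖St‖ * ‖ν‖ ≤ M * 1 := by gcongr; exact hν.norm_le_one
          _ = M := mul_one M
      -- Testing the joint state against `P ⊗ 1` costs the third factor `card κ`.
      have ht : (P ⊗ₖ (1 : Matrix κ κ ℂ)).trace.re = (A.rank : ℝ) * Fintype.card κ := by
        rw [trace_kronecker, trace_one, PosSemidef_trace_eq hP0, hPtr]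
        simp
      rw [ht]
      have hr : (A.rank : ℝ) ≤ Fintype.card l * Fintype.card κ ^ 2 := by exact_mod_cast hrank
      calc (A.rank : ℝ) * Fintype.card κ * ‖V * (St ⊗ₖ ν) * Vᴴ‖
          ≤ (Fintype.card l * Fintype.card κ ^ 2) * Fintype.card κ * M := by gcongr
        _ = _ := by ring
    linarith
  have diff := norm_trace_mul_le (IsHermitian.trAnc (((hR.kronecker hη).conj hU).1.1.sub
    ((hS.kronecker hν).conj hV).1.1)) P
  have h1 := (Complex.re_le_norm _).trans (diff.trans
    (mul_le_of_le_one_right (traceNorm_nonneg (IsHermitian.trAnc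
      (((hR.kronecker hη).conj hU).1.1.sub ((hS.kronecker hν).conj hV).1.1))) hP1))
  rw [trAnc_sub, sub_mul, trace_sub, Complex.sub_re, ← trAnc_sub] at h1
  linarith

end Converse


/-! ### Converse: asymptotics -/

section TwoSided

variable {d : ℕ} {H ρ σ : Matrix (Fin d) (Fin d) ℂ} {D : ℕ → ℕ}

theorem TwoSidedConversion.symm (h : TwoSidedConversion H ρ σ D) :
    TwoSidedConversion H σ ρ D := by
  obtain ⟨HA, η, ν, U, V, h1, h2, h3, h4, h5, h6, h7⟩ := h
  refine ⟨HA, ν, η, V, U, h1, h2, h4, h3, h6, h5, ?_⟩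
  convert h7 using 2 with n
  rw [trAnc_sub, trAnc_sub, traceNorm_sub_comm]

theorem TwoSidedConversion.energy_eq (h : TwoSidedConversion H ρ σ D) (hH : H.IsHermitian)
    (hρ : IsState ρ) (hσ : IsState σ) : energy H ρ = energy H σ := by
  obtain ⟨HA, η, ν, U, V, -, hHA, hη, hν, hU, hV, ht⟩ := h
  obtain ⟨c, hc⟩ := norm_copiesHam_le hH
  set t := fun n => traceNorm (trAnc (U n * (tensorPower n ρ ⊗ₖ η n) * (U n)ᴴ -
    V n * (tensorPower n σ ⊗ₖ ν n) * (V n)ᴴ)) with htdef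
  have ht0 : ∀ n, 0 ≤ t n := fun n => traceNorm_nonneg (IsHermitian.trAnc
    ((((hρ.tensorPower n).kronecker (hη n)).conj (isometry_of_mem_unitaryGroup (hU n).1)).1.1.sub
    (((hσ.tensorPower n).kronecker (hν n)).conj (isometry_of_mem_unitaryGroup (hV n).1)).1.1))
  have hb : ∀ᶠ n : ℕ in atTop, |energy H ρ - energy H σ| ≤ c * t n + 4 * (opNorm (HA n) / n) := by
    filter_upwards [eventually_gt_atTop 0] with n hn
    have hn' : (0 : ℝ) < n := by exact_mod_cast hn
    have h1 := abs_trace_sub_le_of_energyPreserving (hρ.tensorPower n) (hσ.tensorPower n)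
      (hη n) (hν n) (hU n) (hV n)
    rw [trace_copiesHam_mul H hρ.2, trace_copiesHam_mul H hσ.2] at h1
    have h2 : ∀ z : ℂ, ((n : ℂ) * z).re = n * z.re := fun z => by simp
    rw [h2, h2, ← mul_sub, abs_mul, abs_of_pos hn'] at h1
    change (n : ℝ) * |energy H ρ - energy H σ| ≤ _ * t n + 4 * opNorm (HA n) at h1
    have h3 : ‖copiesHam n H‖ * t n ≤ n * c * t n := by gcongr; exacts [ht0 n, hc n]
    have h4 : (n : ℝ) * (c * t n + 4 * (opNorm (HA n) / n)) = n * c * t n + 4 * opNorm (HA n) := by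
      field_simp
    exact le_of_mul_le_mul_left (by linarith) hn'
  have hlim : Tendsto (fun n => c * t n + 4 * (opNorm (HA n) / n)) atTop (𝓝 (c * 0 + 4 * 0)) :=
    (ht.const_mul c).add (hHA.tendsto_div_nhds_zero.const_mul 4)
  rw [mul_zero, mul_zero, add_zero] at hlim
  have := ge_of_tendsto hlim hb
  exact sub_eq_zero.1 (abs_nonpos_iff.1 this)

theorem TwoSidedConversion.entropy_le (h : TwoSidedConversion H ρ σ D)
    (hD : (fun n => Real.log (D n)) =o[atTop] (fun n : ℕ => (n : ℝ)))
    (hρ : IsState ρ) (hσ : IsState σ) : entropy σ ≤ entropy ρ := by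
  by_contra! hlt
  obtain ⟨HA, η, ν, U, V, -, hHA, hη, hν, hU, hV, ht⟩ := h
  set t := fun n => traceNorm (trAnc (U n * (tensorPower n ρ ⊗ₖ η n) * (U n)ᴴ -
    V n * (tensorPower n σ ⊗ₖ ν n) * (V n)ᴴ)) with htdef
  obtain ⟨C, -, hC⟩ := hasTypicalSubspaces hρ
  obtain ⟨C', -, hC'⟩ := hasTypicalSubspaces hσ
  -- The gap `4 δ` per copy pays for two typicality windows of width `n δ` and for the bound `D ^ 3
  -- ≤ exp (n δ)`, leaving `exp (-n δ)`.
  set δ := (entropy σ - entropy ρ) / 4 with hδ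
  have hδ0 : 0 < δ := by rw [hδ]; linarith
  have hb : ∀ᶠ n : ℕ in atTop,
      1 - n * C / (n * δ) ^ 2 - n * C' / (n * δ) ^ 2 - t n ≤ Real.exp (-(n * δ)) := by
    filter_upwards [eventually_gt_atTop 0, hD.bound (show 0 < δ / 3 by positivity)] with n hn hDn
    have hn' : (0 : ℝ) < n := by exact_mod_cast hn
    obtain ⟨X, Z, μ, -, h1, -, h2, h3, h4⟩ := hC n (n * δ) (by positivity)
    obtain ⟨X', Z', μ', h5, h6, h7, -, h8, h9⟩ := hC' n (n * δ) (by positivity)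
    have key := one_sub_le_of_typical (hρ.tensorPower n) (hσ.tensorPower n) (hη n) (hν n)
      (isometry_of_mem_unitaryGroup (hU n).1) (isometry_of_mem_unitaryGroup (hV n).1)
      h1 h3 h4 h5 h6 h7 (Real.exp_pos _).le h8 h9
    refine key.trans ?_
    have hDpos : (0 : ℝ) < D n := by
      rcases Nat.eq_zero_or_pos (D n) with h0 | h0
      · exfalso
        have h10 := (hη n).2
        have : IsEmpty (Fin (D n)) := by rw [h0]; infer_instance
        simp [trace] at h10
      · exact_mod_cast h0
    have hDle : (D n : ℝ) ≤ Real.exp (δ / 3 * n) := by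
      rw [← Real.log_le_iff_le_exp hDpos]
      refine (le_abs_self _).trans ?_
      simpa using hDn
    rw [Fintype.card_coe, Fintype.card_fin]
    calc Real.exp (n * -entropy σ + n * δ) * X.card * (D n : ℝ) ^ 3
        ≤ Real.exp (n * -entropy σ + n * δ) * Real.exp (-(n * -entropy ρ) + n * δ) *
          (Real.exp (δ / 3 * n)) ^ 3 := by gcongr
      _ = Real.exp (-(n * δ)) := by
          rw [← Real.exp_nat_mul, ← Real.exp_add, ← Real.exp_add]
          congr 1
          rw [hδ]; push_cast; ring
  have hinv : ∀ c : ℝ, Tendsto (fun n : ℕ => n * c / (n * δ) ^ 2) atTop (𝓝 0) := fun c => by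
    have h1 : Tendsto (fun n : ℕ => (c / δ ^ 2) / (n : ℝ)) atTop (𝓝 0) :=
      tendsto_const_nhds.div_atTop tendsto_natCast_atTop_atTop
    refine h1.congr' ?_
    filter_upwards [eventually_gt_atTop 0] with n hn
    have hn' : (n : ℝ) ≠ 0 := by positivity
    field_simp
  have hexp : Tendsto (fun n : ℕ => Real.exp (-(n * δ))) atTop (𝓝 0) :=
    Real.tendsto_exp_neg_atTop_nhds_zero.comp
      (tendsto_natCast_atTop_atTop.atTop_mul_const hδ0)
  have hl := ((tendsto_const_nhds (x := (1 : ℝ))).sub (hinv C)).sub (hinv C')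
  have := le_of_tendsto_of_tendsto (hl.sub ht) hexp hb
  norm_num at this

end TwoSided


/-! ### Gentle measurement -/

section Gentle

variable {m n : Type*} [Fintype m] [Fintype n] [DecidableEq m] [DecidableEq n]

/-- Cauchy–Schwarz for the Hilbert–Schmidt inner product. -/
theorem norm_trace_conjTranspose_mul_le (A B : Matrix m n ℂ) :
    ‖(Aᴴ * B).trace‖ ≤ √(Aᴴ * A).trace.re * √(Bᴴ * B).trace.re := by
  have h : ∀ A : Matrix m n ℂ, (Aᴴ * A).trace.re = ∑ p : n × m, ‖A p.2 p.1‖ ^ 2 := fun A => by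
    simp only [trace, diag_apply, mul_apply, conjTranspose_apply, Fintype.sum_prod_type,
      Complex.re_sum]
    refine Finset.sum_congr rfl fun i _ => Finset.sum_congr rfl fun j _ => ?_
    rw [← Complex.normSq_eq_norm_sq, Complex.star_def, ← Complex.normSq_eq_conj_mul_self,
      Complex.ofReal_re]
  rw [h, h]
  refine le_trans ?_ (Real.sum_mul_le_sqrt_mul_sqrt _ _ _)
  simp only [trace, diag_apply, mul_apply, conjTranspose_apply, Fintype.sum_prod_type]
  refine (norm_sum_le _ _).trans (Finset.sum_le_sum fun i _ => (norm_sum_le _ _).trans ?_)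
  simp

/-- Gentle measurement: a projection that `M` passes with high probability hardly disturbs `M`. -/
theorem traceNorm_sub_proj_le {M P : Matrix n n ℂ} (hM : M.PosSemidef) (hP : P.IsHermitian)
    (hPP : P * P = P) {a b : ℝ} (ha : M.trace.re ≤ a) (hb : (M * (1 - P)).trace.re ≤ b) :
    traceNorm (M - P * M * P) ≤ 2 * (√a * √b) := by
  obtain ⟨C, hC⟩ : ∃ C : Matrix n n ℂ, M = Cᴴ * C := by
    obtain ⟨V, -, -, hV, -⟩ := exists_spectral hM.1
    refine ⟨diagonal (fun i => ((√(hM.1.eigenvalues i) : ℝ) : ℂ)) * Vᴴ, ?_⟩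
    conv_lhs => rw [hV]
    rw [conjTranspose_mul, conjTranspose_conjTranspose, diagonal_conjTranspose, Matrix.mul_assoc V,
      Matrix.mul_assoc V, ← Matrix.mul_assoc (diagonal _) (diagonal _), diagonal_mul_diagonal]
    congr 3; ext i
    simp only [Pi.star_apply, RCLike.star_def, Complex.conj_ofReal, ← Complex.ofReal_mul]
    rw [Real.mul_self_sqrt (hM.eigenvalues_nonneg i)]
  set Q := 1 - P with hQ
  have hQh : Qᴴ = Q := by rw [hQ, conjTranspose_sub, hP.eq, conjTranspose_one]
  have hQQ : Q * Q = Q := by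
    rw [hQ, mul_sub, sub_mul, sub_mul, hPP]; simp
  have hP1 : ‖P‖ ≤ 1 := by
    have h1 := l2_opNorm_conjTranspose_mul_self P
    rw [hP.eq, hPP] at h1
    by_contra! h
    nlinarith
  have hb' : ((C * Q)ᴴ * (C * Q)).trace.re ≤ b := by
    refine le_of_eq_of_le ?_ hb
    rw [conjTranspose_mul, hQh, trace_mul_comm, Matrix.mul_assoc, ← Matrix.mul_assoc Q, hQQ,
      trace_mul_comm, Matrix.mul_assoc, trace_mul_comm, hC]
  have hY' : ∀ Y : Matrix n n ℂ, ‖Y‖ ≤ 1 → ((C * Y)ᴴ * (C * Y)).trace.re ≤ a := fun Y hY => by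
    have : ((C * Y)ᴴ * (C * Y)).trace = (M * (Y * Yᴴ)).trace := by
      rw [conjTranspose_mul, hC, Matrix.mul_assoc, trace_mul_comm]; simp only [Matrix.mul_assoc]
    rw [this]
    refine (Complex.re_le_norm _).trans ((norm_trace_mul_le_of_posSemidef hM _).trans
      (le_trans (mul_le_of_le_one_right (PosSemidef_trace_re_nonneg hM) ?_) ha))
    refine (l2_opNorm_mul _ _).trans ?_
    rw [l2_opNorm_conjTranspose]
    exact mul_le_one₀ hY (norm_nonneg _) hY
  refine traceNorm_le (hM.1.sub ?_) fun Y hY => ?_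
  · have := isHermitian_mul_mul_conjTranspose P hM.1
    rwa [hP.eq] at this
  -- With `M = Cᴴ C`, the identity `M - P M P = Q M + P M Q` gives two inner products, each having
  -- `C Q` as one factor, of Hilbert–Schmidt norm at most `√b`.
  have e : ((M - P * M * P) * Y).trace = ((C * Q)ᴴ * (C * Y)).trace +
      ((C * (P * Yᴴ))ᴴ * (C * Q)).trace := by
    have e1 : M - P * M * P = Q * M + P * M * Q := by
      rw [hQ]; noncomm_ring
    rw [e1, add_mul, trace_add]
    congr 1
    · rw [conjTranspose_mul, hQh, hC]; simp only [Matrix.mul_assoc]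
    · rw [conjTranspose_mul, conjTranspose_mul, conjTranspose_conjTranspose, hP.eq, hC,
        trace_mul_comm]
      simp only [Matrix.mul_assoc]
  rw [e, two_mul]
  refine (norm_add_le _ _).trans (add_le_add ?_ ?_)
  · rw [mul_comm]
    refine (norm_trace_conjTranspose_mul_le _ _).trans ?_
    gcongr
    exact hY' Y hY
  · refine (norm_trace_conjTranspose_mul_le _ _).trans ?_
    gcongr
    refine hY' _ ((l2_opNorm_mul _ _).trans ?_)
    rw [l2_opNorm_conjTranspose]
    exact mul_le_one₀ hP1 (norm_nonneg _) hY

end Gentle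

/-! ### Combinatorics: packing and extension to permutations -/

section Packing

variable {α β : Type*} [Fintype α] [Fintype β] [DecidableEq α] [DecidableEq β]

/-- Take a packing of maximal total size. If an item were left out while some bin had more than `m`
room, that item would fit and increase the total. -/
theorem exists_packing (s : Finset α) {c : α → ℝ} {b : β → ℝ} {m : ℝ} (hc : ∀ i ∈ s, 0 < c i)
    (hm : ∀ i ∈ s, c i ≤ m) (hb : ∀ t, 0 ≤ b t) :
    ∃ f : α → Option β, (∀ i, f i ≠ none → i ∈ s) ∧
      (∀ t, (∑ i with f i = some t, c i) ≤ b t) ∧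
      ((∀ i ∈ s, f i ≠ none) ∨ ∀ t, b t - (∑ i with f i = some t, c i) ≤ m) := by
  classical
  let S : Finset (α → Option β) := Finset.univ.filter fun f =>
    (∀ i, f i ≠ none → i ∈ s) ∧ ∀ t, (∑ i with f i = some t, c i) ≤ b t
  have hS : S.Nonempty := ⟨fun _ => none, by simp [S, hb]⟩
  obtain ⟨f, hf, hmax⟩ := S.exists_max_image (fun f => ∑ i with f i ≠ none, c i) hS
  obtain ⟨hf1, hf2⟩ := (Finset.mem_filter.1 hf).2
  refine ⟨f, hf1, hf2, ?_⟩
  by_contra! hcon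
  obtain ⟨⟨i₀, hi₀, hfi₀⟩, t₀, ht₀⟩ := hcon
  set g := Function.update f i₀ (some t₀) with hg
  have hg0 : g i₀ = some t₀ := by simp [hg]
  have hgne : ∀ i, i ≠ i₀ → g i = f i := fun i hi => by simp [hg, hi]
  have h1 : ∀ t, t ≠ t₀ → (Finset.univ.filter fun i => g i = some t) =
      Finset.univ.filter fun i => f i = some t := fun t ht => by
    ext i
    by_cases hi : i = i₀
    · subst hi; simp [hg0, hfi₀, ht.symm]
    · simp [hgne i hi]
  have h2 : (Finset.univ.filter fun i => g i = some t₀) =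
      insert i₀ (Finset.univ.filter fun i => f i = some t₀) := by
    ext i
    by_cases hi : i = i₀
    · subst hi; simp [hg0]
    · simp [hgne i hi, hi]
  have h3 : (Finset.univ.filter fun i => g i ≠ none) =
      insert i₀ (Finset.univ.filter fun i => f i ≠ none) := by
    ext i
    by_cases hi : i = i₀
    · subst hi; simp [hg0]
    · simp [hgne i hi, hi]
  have hgS : g ∈ S := by
    refine Finset.mem_filter.2 ⟨Finset.mem_univ _, fun i hi => ?_, fun t => ?_⟩
    · by_cases h : i = i₀
      · exact h ▸ hi₀
      · exact hf1 i (hgne i h ▸ hi)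
    · by_cases h : t = t₀
      · subst h
        rw [h2, Finset.sum_insert (by simp [hfi₀])]
        linarith [hm i₀ hi₀]
      · rw [h1 t h]; exact hf2 t
  have h4 := hmax g hgS
  rw [h3, Finset.sum_insert (by simp [hfi₀])] at h4
  linarith [hc i₀ hi₀]

/-- The items assigned to `t` are placed injectively in `{t} × R`; a bijection between two subsets
of a finite set extends to a permutation. -/
theorem exists_perm_of_card_fiber_le {T R : Type*} [Fintype T] [Fintype R] (f : α → Option T)
    (hf : ∀ t, Nat.card {a // f a = some t} ≤ Nat.card R) {e : α → T × R}
    (he : Function.Injective e) :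
    ∃ π : Equiv.Perm (T × R), ∀ a t, f a = some t → (π (e a)).1 = t := by
  classical
  have hg : ∀ t, Nonempty ({a // f a = some t} ↪ R) := fun t => by
    rw [Function.Embedding.nonempty_iff_card_le, ← Nat.card_eq_fintype_card,
      ← Nat.card_eq_fintype_card]
    exact hf t
  let A := {p : α × T // f p.1 = some p.2}
  let u : A → T × R := fun p => e p.1.1
  let v : A → T × R := fun p => (p.1.2, (hg p.1.2).some ⟨p.1.1, p.2⟩)
  have hu : Function.Injective u := fun p q h => by
    have h1 : p.1.1 = q.1.1 := he h
    have h2 : some p.1.2 = some q.1.2 := by rw [← p.2, ← q.2, h1]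
    exact Subtype.ext (Prod.ext h1 (Option.some_injective _ h2))
  have hv : Function.Injective v := by
    rintro ⟨⟨a, t⟩, h⟩ ⟨⟨a', t'⟩, h'⟩ hh
    obtain ⟨h1, h2⟩ := Prod.ext_iff.1 hh
    change t = t' at h1
    subst h1
    have := (hg t).some.injective h2
    simp only [Subtype.mk.injEq] at this
    subst this; rfl
  let E : {x // x ∈ Set.range u} ≃ {x // x ∈ Set.range v} :=
    (Equiv.ofInjective u hu).symm.trans (Equiv.ofInjective v hv)
  refine ⟨E.extendSubtype, fun a t hat => ?_⟩
  have hx : e a ∈ Set.range u := ⟨⟨(a, t), hat⟩, rfl⟩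
  rw [E.extendSubtype_apply_of_mem _ hx]
  have : (⟨e a, hx⟩ : {x // x ∈ Set.range u}) = Equiv.ofInjective u hu ⟨(a, t), hat⟩ := rfl
  rw [this]
  simp only [E, Equiv.trans_apply, Equiv.symm_apply_apply]
  rfl

end Packing


/-! ### Matching two spectra with a mixed register -/

section Matching

variable {T R : Type*} [Fintype T] [Fintype R] [DecidableEq T] [DecidableEq R]

/-- The maximally mixed state on `R`, tensored with the pure state `r₀`. -/
noncomputable def mixedPureState (r₀ : R) : Matrix (R × R) (R × R) ℂ :=
  diagonal fun r => ((if r.2 = r₀ then (Fintype.card R : ℝ)⁻¹ else 0 : ℝ) : ℂ)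

theorem isState_mixedPureState (r₀ : R) : IsState (mixedPureState r₀) := by
  have : Nonempty R := ⟨r₀⟩
  constructor
  · refine PosSemidef.diagonal fun r => ?_
    simp only [Pi.zero_apply, Complex.zero_le_real]
    split_ifs <;> positivity
  · rw [mixedPureState, trace_diagonal, Fintype.sum_prod_type]
    have h : ∑ _x : R, ∑ y : R, (if y = r₀ then (Fintype.card R : ℝ)⁻¹ else 0) = 1 := by simp
    rw [← Complex.ofReal_one, ← h]
    simp only [Complex.ofReal_sum]

theorem trAnc_diagonal {R : Type*} [Fintype R] [DecidableEq R] (g : T × R → ℂ) :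
    trAnc (diagonal g) = diagonal fun t => ∑ r, g (t, r) := by
  ext i j
  by_cases h : i = j
  · subst h; simp [trAnc]
  · simp [trAnc, h]

theorem norm_eigenvalue_le {A : Matrix T T ℂ} (hA : A.IsHermitian) (i : T) :
    |hA.eigenvalues i| ≤ ‖A‖ := by
  obtain ⟨V, hV, -, h, -⟩ := exists_spectral hA
  have h1 : Vᴴ * A * V = diagonal fun i => (hA.eigenvalues i : ℂ) := by
    conv_lhs => rw [h]
    calc _ = (Vᴴ * V) * diagonal (fun i => (hA.eigenvalues i : ℂ)) * (Vᴴ * V) := by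
          simp only [Matrix.mul_assoc]
      _ = _ := by rw [hV]; simp
  have hV1 := norm_le_one_of_isometry hV
  have h2 := (norm_entry_le (Vᴴ * A * V) i i).trans
    (norm_conj_le A (norm_conjTranspose_le_one hV1) hV1)
  rw [h1] at h2
  simpa using h2

/-- The mixed register cuts each `a t` into `D` equal pieces of size at most `M / D`, which are
packed into bins of capacities `b t`. The second register, initially pure, leaves room for `D ^ 2`
pieces per bin. -/
theorem exists_distribution_matching {a b : T → ℝ} (ha : ∀ t, 0 ≤ a t) (hb : ∀ t, 0 ≤ b t)
    {M N θ : ℝ} (haM : ∀ t, a t ≤ M) (hbM : ∀ t, b t ≤ M) (hM : 0 ≤ M)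
    (haN : (Fintype.card {t // a t ≠ 0} : ℝ) ≤ N) (hbN : (Fintype.card {t // b t ≠ 0} : ℝ) ≤ N)
    (hθ : 0 < θ) (hD : M / θ ≤ Fintype.card R) (r₀ : R) :
    ∃ π : Equiv.Perm (T × (R × R)),
      ∑ t, |(∑ r, a (π.symm (t, r)).1 *
        (if (π.symm (t, r)).2.2 = r₀ then (Fintype.card R : ℝ)⁻¹ else 0)) - b t| ≤
      2 * (|(∑ t, a t) - ∑ t, b t| + N * θ + N * (M / Fintype.card R)) +
        |(∑ t, a t) - ∑ t, b t| := by
  classical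
  have : Nonempty R := ⟨r₀⟩
  set D : ℝ := (Fintype.card R : ℝ) with hDdef
  have hD0 : 0 < D := by simp only [D]; exact_mod_cast Fintype.card_pos
  -- Only pieces of weights above `θ` are packed, at a loss of at most `N θ`. Each is larger than `θ
  -- / D`, so a bin of capacity at most `M` receives at most `(M / θ) D ≤ D ^ 2` of them.
  let s : Finset (T × R) := Finset.univ.filter fun p => θ < a p.1
  let c : T × R → ℝ := fun p => a p.1 * D⁻¹
  have hc0 : ∀ p, 0 ≤ c p := fun p => mul_nonneg (ha _) (inv_nonneg.2 hD0.le)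
  obtain ⟨f, hf1, hf2, hf3⟩ := exists_packing s (c := c) (b := b) (m := M / D)
    (fun i hi => mul_pos (hθ.trans (Finset.mem_filter.1 hi).2) (inv_pos.2 hD0))
    (fun i _ => by rw [div_eq_mul_inv]; exact mul_le_mul_of_nonneg_right (haM _) (inv_nonneg.2 hD0.le))
    hb
  have hcard : ∀ t, Nat.card {p // f p = some t} ≤ Nat.card (R × R) := fun t => by
    rw [Nat.card_eq_fintype_card, Nat.card_eq_fintype_card, Fintype.card_subtype, Fintype.card_prod]
    have h1 : ((Finset.univ.filter fun p => f p = some t).card : ℝ) * (θ / D) ≤ M := by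
      rw [← nsmul_eq_mul]
      refine (Finset.card_nsmul_le_sum _ c _ fun p hp => ?_).trans ((hf2 t).trans (hbM t))
      have hps := hf1 p (by rw [(Finset.mem_filter.1 hp).2]; simp)
      rw [div_eq_mul_inv]
      exact mul_le_mul_of_nonneg_right (Finset.mem_filter.1 hps).2.le (inv_nonneg.2 hD0.le)
    have h2 : ((Finset.univ.filter fun p => f p = some t).card : ℝ) ≤ D * D := by
      rw [← le_div_iff₀ (by positivity)] at h1
      refine h1.trans ?_
      rw [div_div_eq_mul_div, mul_comm M D, mul_div_assoc]
      gcongr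
    simp only [D] at h2
    exact_mod_cast h2
  obtain ⟨π, hπ⟩ := exists_perm_of_card_fiber_le f hcard (e := fun p => (p.1, (p.2, r₀)))
    (fun p q h => by
      simp only [Prod.mk.injEq, and_true] at h
      exact Prod.ext h.1 h.2)
  refine ⟨π, ?_⟩
  let c' : T × (R × R) → ℝ := fun x => a x.1 * (if x.2.2 = r₀ then D⁻¹ else 0)
  have hc'0 : ∀ x, 0 ≤ c' x := fun x => mul_nonneg (ha _) (by split_ifs <;> positivity)
  let load : T → ℝ := fun t => ∑ p with f p = some t, c p
  let load' : T → ℝ := fun t => ∑ r, c' (π.symm (t, r))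
  change ∑ t, |load' t - b t| ≤ _
  -- The permutation also sends the unpacked pieces somewhere; these only add to the loads.
  have hll : ∀ t, load t ≤ load' t := fun t => by
    have h1 : load' t = ∑ y ∈ Finset.univ.map ⟨fun r : R × R => ((t, r) : T × (R × R)),
        fun r r' h => (Prod.ext_iff.1 h).2⟩, c' (π.symm y) := by
      rw [Finset.sum_map]; rfl
    have h2 : load t = ∑ y ∈ (Finset.univ.filter fun p => f p = some t).map
        ⟨fun p : T × R => π (p.1, (p.2, r₀)), fun p q h => by
          have := π.injective h
          simp only [Prod.mk.injEq, and_true] at this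
          exact Prod.ext this.1 this.2⟩, c' (π.symm y) := by
      rw [Finset.sum_map]
      refine Finset.sum_congr rfl fun p _ => ?_
      change c p = c' (π.symm (π (p.1, (p.2, r₀))))
      rw [Equiv.symm_apply_apply]
      simp [c, c']
    rw [h1, h2]
    refine Finset.sum_le_sum_of_subset_of_nonneg (fun y hy => ?_) fun y _ _ => hc'0 _
    obtain ⟨p, hp, rfl⟩ := Finset.mem_map.1 hy
    have := hπ p t (Finset.mem_filter.1 hp).2
    refine Finset.mem_map.2 ⟨(π (p.1, (p.2, r₀))).2, Finset.mem_univ _, ?_⟩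
    exact Prod.ext this.symm rfl
  have hsum' : ∑ t, load' t = ∑ t, a t := by
    have h1 : ∑ t, load' t = ∑ x, c' x := by
      rw [← Equiv.sum_comp π.symm c', Fintype.sum_prod_type]
    rw [h1, Fintype.sum_prod_type]
    refine Finset.sum_congr rfl fun t _ => ?_
    simp only [c', ← Finset.mul_sum]
    rw [Fintype.sum_prod_type]
    simp only [Finset.sum_ite_eq', Finset.mem_univ, if_true, Finset.sum_const, Finset.card_univ,
      nsmul_eq_mul]
    rw [← hDdef, mul_inv_cancel₀ hD0.ne', mul_one]
  have hN0 : 0 ≤ N := le_trans (Nat.cast_nonneg _) haN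
  have hslack : (∑ t, b t) - ∑ t, load t ≤
      |(∑ t, a t) - ∑ t, b t| + N * θ + N * (M / D) := by
    have hMD : 0 ≤ N * (M / D) := by positivity
    have hNθ : 0 ≤ N * θ := by positivity
    have habs := abs_nonneg ((∑ t, a t) - ∑ t, b t)
    -- Either all heavy pieces are packed, and only light ones are missing, or every bin is full up
    -- to `M / D`, and at most `N` bins have positive capacity.
    rcases hf3 with h | h
    · have h1 : ∑ t, load t = ∑ p ∈ s, c p := by
        have hs : s = Finset.univ.filter fun p => f p ≠ none := by
          ext p
          simp only [Finset.mem_filter, Finset.mem_univ, true_and]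
          exact ⟨h p, hf1 p⟩
        rw [hs]
        have h2 : ∀ t, load t = ∑ p, if f p = some t then c p else 0 := fun t => by
          rw [← Finset.sum_filter]
        simp only [h2]
        rw [Finset.sum_comm, Finset.sum_filter]
        refine Finset.sum_congr rfl fun p _ => ?_
        rcases hfp : f p with _ | t
        · simp
        · simp
      have h2 : ∑ p ∈ s, c p = ∑ t with θ < a t, a t := by
        simp only [s, c]
        rw [Finset.sum_filter, Fintype.sum_prod_type, Finset.sum_filter]
        refine Finset.sum_congr rfl fun t _ => ?_
        split_ifs
        · change ∑ _x : R, a t * D⁻¹ = a t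
          rw [Finset.sum_const, Finset.card_univ, nsmul_eq_mul, ← hDdef]
          field_simp
        · simp
      have h3 : ∑ t, a t ≤ (∑ t with θ < a t, a t) + N * θ := by
        rw [← Finset.sum_filter_add_sum_filter_not Finset.univ (fun t => θ < a t)]
        gcongr
        rw [← Finset.sum_filter_ne_zero]
        refine (Finset.sum_le_card_nsmul _ _ θ fun t ht => ?_).trans ?_
        · simpa using (Finset.mem_filter.1 (Finset.mem_filter.1 ht).1).2
        · rw [nsmul_eq_mul]
          gcongr
          refine le_trans ?_ haN
          rw [Fintype.card_subtype]
          gcongr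
          simp
      have h4 := neg_abs_le ((∑ t, a t) - ∑ t, b t)
      linarith
    · rw [← Finset.sum_sub_distrib]
      have h1 : ∑ t, (b t - load t) ≤ N * (M / D) := by
        have h2 : ∀ t, b t - load t ≤ if b t ≠ 0 then M / D else 0 := fun t => by
          split_ifs with hbt
          · exact h t
          · have : 0 ≤ load t := Finset.sum_nonneg fun p _ => hc0 p
            rw [not_not] at hbt
            linarith
        refine (Finset.sum_le_sum fun t _ => h2 t).trans ?_
        rw [← Finset.sum_filter, Finset.sum_const, nsmul_eq_mul, ← Fintype.card_subtype]
        gcongr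
      linarith
  -- Both excess `load' - load` and deficit `b - load` are nonnegative; as `load'` and `a` have the
  -- same total, everything reduces to the total deficit.
  calc ∑ t, |load' t - b t| ≤ ∑ t, ((load' t - load t) + (b t - load t)) := by
        refine Finset.sum_le_sum fun t _ => ?_
        have h1 := hll t
        have h2 : load t ≤ b t := hf2 t
        rw [abs_le]; constructor <;> linarith
    _ = ((∑ t, a t) - ∑ t, b t) + 2 * ((∑ t, b t) - ∑ t, load t) := by
        rw [Finset.sum_add_distrib, Finset.sum_sub_distrib, Finset.sum_sub_distrib, hsum']; ring
    _ ≤ _ := by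
        have := le_abs_self ((∑ t, a t) - ∑ t, b t)
        linarith

/-- `W` goes from an eigenbasis of `A` to one of `B` through the permutation of basis vectors. The
output is diagonal in the eigenbasis of `B`, so the trace distance is bounded by the classical `ℓ¹`
distance. -/
theorem exists_unitary_matching {A B : Matrix T T ℂ} (hA : A.PosSemidef) (hB : B.PosSemidef)
    {M N θ : ℝ} (hAM : ‖A‖ ≤ M) (hBM : ‖B‖ ≤ M) (hAN : (A.rank : ℝ) ≤ N) (hBN : (B.rank : ℝ) ≤ N)
    (hθ : 0 < θ) (hD : M / θ ≤ Fintype.card R) (r₀ : R) :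
    ∃ W : Matrix (T × (R × R)) (T × (R × R)) ℂ, Wᴴ * W = 1 ∧ W * Wᴴ = 1 ∧
      traceNorm (trAnc (W * (A ⊗ₖ mixedPureState r₀) * Wᴴ) - B) ≤
      2 * (|A.trace.re - B.trace.re| + N * θ + N * (M / Fintype.card R)) +
        |A.trace.re - B.trace.re| := by
  obtain ⟨V, hV, hV', hAV, -⟩ := exists_spectral hA.1
  obtain ⟨Y, hY, hY', hBY, -⟩ := exists_spectral hB.1
  set a := hA.1.eigenvalues with ha
  set b := hB.1.eigenvalues with hb
  have haM : ∀ t, a t ≤ M := fun t =>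
    (le_abs_self _).trans ((norm_eigenvalue_le hA.1 t).trans hAM)
  have hbM : ∀ t, b t ≤ M := fun t =>
    (le_abs_self _).trans ((norm_eigenvalue_le hB.1 t).trans hBM)
  have hAtr : A.trace.re = ∑ t, a t := by
    conv_lhs => rw [hAV]
    rw [trace_conj_diagonal hV, Complex.ofReal_re]
  have hBtr : B.trace.re = ∑ t, b t := by
    conv_lhs => rw [hBY]
    rw [trace_conj_diagonal hY, Complex.ofReal_re]
  rw [hA.1.rank_eq_card_non_zero_eigs] at hAN
  rw [hB.1.rank_eq_card_non_zero_eigs] at hBN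
  obtain ⟨π, hπ⟩ := exists_distribution_matching (R := R) hA.eigenvalues_nonneg
    hB.eigenvalues_nonneg haM hbM ((norm_nonneg _).trans hAM) hAN hBN hθ hD r₀
  set Q : Matrix (T × (R × R)) (T × (R × R)) ℂ := (1 : Matrix _ _ ℂ).submatrix π.symm id with hQ
  have hQmul : ∀ X : Matrix (T × (R × R)) (T × (R × R)) ℂ, Q * X * Qᴴ =
      X.submatrix π.symm π.symm := fun X => by
    ext i j
    simp [hQ, mul_apply, one_apply]
  have hQQ : Q * Qᴴ = 1 := by
    have := hQmul 1
    rw [Matrix.mul_one] at this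
    rw [this, submatrix_one_equiv]
  have hQQ' : Qᴴ * Q = 1 := mul_eq_one_comm.1 hQQ
  set V' := V ⊗ₖ (1 : Matrix (R × R) (R × R) ℂ) with hV'def
  set Y' := Y ⊗ₖ (1 : Matrix (R × R) (R × R) ℂ) with hY'def
  have hVV : V'ᴴ * V' = 1 := by
    rw [hV'def, conjTranspose_kronecker, conjTranspose_one, ← mul_kronecker_mul, hV,
      Matrix.one_mul, one_kronecker_one]
  have hYY : Y'ᴴ * Y' = 1 := by
    rw [hY'def, conjTranspose_kronecker, conjTranspose_one, ← mul_kronecker_mul, hY,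
      Matrix.one_mul, one_kronecker_one]
  have hVV' : V' * V'ᴴ = 1 := mul_eq_one_comm.1 hVV
  have hW : (Y' * Q * V'ᴴ)ᴴ * (Y' * Q * V'ᴴ) = 1 := by
    simp only [conjTranspose_mul, conjTranspose_conjTranspose]
    calc V' * (Qᴴ * Y'ᴴ) * (Y' * Q * V'ᴴ) = V' * (Qᴴ * (Y'ᴴ * Y') * Q) * V'ᴴ := by
          simp only [Matrix.mul_assoc]
      _ = 1 := by rw [hYY, Matrix.mul_one, hQQ', Matrix.mul_one, hVV']
  refine ⟨Y' * Q * V'ᴴ, hW, mul_eq_one_comm.1 hW, ?_⟩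
  set g : T × (R × R) → ℝ := fun x => a x.1 *
    (if x.2.2 = r₀ then (Fintype.card R : ℝ)⁻¹ else 0) with hg
  have e1 : A ⊗ₖ mixedPureState r₀ = V' * diagonal (fun x => (g x : ℂ)) * V'ᴴ := by
    conv_lhs => rw [hAV]
    rw [hV'def, conjTranspose_kronecker, conjTranspose_one, mixedPureState]
    have : diagonal (fun x => (g x : ℂ)) = diagonal (fun t => (a t : ℂ)) ⊗ₖ
        diagonal (fun r : R × R => ((if r.2 = r₀ then (Fintype.card R : ℝ)⁻¹ else 0 : ℝ) : ℂ)) := by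
      rw [diagonal_kronecker_diagonal]
      simp only [hg, Complex.ofReal_mul]
    rw [this, ← mul_kronecker_mul, ← mul_kronecker_mul, Matrix.one_mul, Matrix.mul_one]
  have e2 : Y' * Q * V'ᴴ * (A ⊗ₖ mixedPureState r₀) * (Y' * Q * V'ᴴ)ᴴ =
      Y' * diagonal (fun x => (g (π.symm x) : ℂ)) * (Yᴴ ⊗ₖ (1 : Matrix (R × R) (R × R) ℂ)) := by
    have h1 : Y'ᴴ = Yᴴ ⊗ₖ (1 : Matrix (R × R) (R × R) ℂ) := by
      rw [hY'def, conjTranspose_kronecker, conjTranspose_one]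
    rw [← h1, e1]
    simp only [conjTranspose_mul, conjTranspose_conjTranspose]
    calc Y' * Q * V'ᴴ * (V' * diagonal (fun x => (g x : ℂ)) * V'ᴴ) * (V' * (Qᴴ * Y'ᴴ))
        = Y' * (Q * ((V'ᴴ * V') * diagonal (fun x => (g x : ℂ)) * (V'ᴴ * V')) * Qᴴ) * Y'ᴴ := by
          simp only [Matrix.mul_assoc]
      _ = _ := by
          rw [hVV, Matrix.one_mul, Matrix.mul_one, hQmul, submatrix_diagonal_equiv]
          rfl
  have e3 : trAnc (Y' * Q * V'ᴴ * (A ⊗ₖ mixedPureState r₀) * (Y' * Q * V'ᴴ)ᴴ) - B =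
      Y * diagonal (fun t => (((∑ r, g (π.symm (t, r))) - b t : ℝ) : ℂ)) * Yᴴ := by
    rw [e2, hY'def, trAnc_conj_kronecker_one, trAnc_diagonal]
    conv_lhs => rw [hBY]
    rw [← Matrix.sub_mul, ← Matrix.mul_sub, diagonal_sub]
    simp
  rw [e3, hAtr, hBtr]
  exact (traceNorm_conj_diagonal_le hY _).trans hπ

end Matching


/-! ### Energy conservation through a reference ancilla -/

section ReferenceFrame

variable {I : Type*} [Fintype I] [DecidableEq I]

open scoped Classical in
/-- The energy-conserving lift of an operator `N` on a system with energies `e` to the system and an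
ancilla with energy levels `A`: it acts as `N` on each sector of total energy `c` for which
`c - e t ∈ A` for all `t ∈ T`, and as zero on the others. -/
noncomputable def energyLift (e : I → ℝ) (T : Set I) (A : Finset ℝ) (N : Matrix I I ℂ) :
    Matrix (I × A) (I × A) ℂ :=
  of fun x y => if e x.1 + x.2 = e y.1 + y.2 ∧ ∀ t ∈ T, e x.1 + x.2 - e t ∈ A then N x.1 y.1 else 0

variable {e : I → ℝ} {T : Set I} {A : Finset ℝ}

theorem energyLift_add (N N' : Matrix I I ℂ) :
    energyLift e T A (N + N') = energyLift e T A N + energyLift e T A N' := by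
  ext x y
  simp only [energyLift, of_apply, Matrix.add_apply]
  split_ifs <;> simp

theorem energyLift_conjTranspose (N : Matrix I I ℂ) :
    (energyLift e T A N)ᴴ = energyLift e T A Nᴴ := by
  ext x y
  simp only [energyLift, of_apply, conjTranspose_apply]
  by_cases h : e x.1 + x.2 = e y.1 + y.2
  · rw [h]
    split_ifs <;> first | rfl | simp
  · have h' : ¬ e y.1 + y.2 = e x.1 + x.2 := fun h' => h h'.symm
    simp [h, h']

theorem energyLift_zero : energyLift e T A (0 : Matrix I I ℂ) = 0 := by
  ext x y; simp [energyLift]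

/-- Energy conservation fixes the intermediate level once the intermediate state `j` is chosen. For
`j ∈ T` the sector condition puts that level in `A`; for `j ∉ T` the entry of `N` vanishes. Hence
the lift is multiplicative. -/
theorem energyLift_mul {N N' : Matrix I I ℂ} (hN : ∀ i j, j ∉ T → N i j = 0) :
    energyLift e T A N * energyLift e T A N' = energyLift e T A (N * N') := by
  ext x y
  rw [mul_apply, Fintype.sum_prod_type]
  by_cases hxy : e x.1 + x.2 = e y.1 + y.2 ∧ ∀ t ∈ T, e x.1 + x.2 - e t ∈ A
  · have hr : energyLift e T A (N * N') x y = ∑ j, N x.1 j * N' j y.1 := by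
      simp only [energyLift, of_apply, if_pos hxy, mul_apply]
    rw [hr]
    refine Finset.sum_congr rfl fun j _ => ?_
    by_cases hj : j ∈ T
    · rw [Finset.sum_eq_single ⟨e x.1 + x.2 - e j, hxy.2 j hj⟩]
      · have h1 : e x.1 + x.2 = e j + (e x.1 + x.2 - e j) := by ring
        have h2 : e j + (e x.1 + x.2 - e j) = e y.1 + y.2 := by rw [← h1]; exact hxy.1
        simp only [energyLift, of_apply]
        rw [if_pos ⟨h1, hxy.2⟩, if_pos ⟨h2, by rw [← h1]; exact hxy.2⟩]
      · intro b _ hb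
        have : ¬ (e x.1 + x.2 = e j + b) := fun h => hb (Subtype.ext (by simp [h]))
        simp [energyLift, this]
      · simp
    · rw [hN _ _ hj, zero_mul]
      refine Finset.sum_eq_zero fun b _ => ?_
      simp [energyLift, hN _ _ hj]
  · have hr : energyLift e T A (N * N') x y = 0 := by
      simp only [energyLift, of_apply, if_neg hxy]
    rw [hr]
    refine Finset.sum_eq_zero fun j _ => Finset.sum_eq_zero fun b _ => ?_
    simp only [energyLift, of_apply]
    by_cases h1 : e x.1 + x.2 = e j + b ∧ ∀ t ∈ T, e x.1 + x.2 - e t ∈ A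
    · have h2 : ¬ (e j + b = e y.1 + y.2 ∧ ∀ t ∈ T, e j + b - e t ∈ A) := fun h2 =>
        hxy ⟨h1.1.trans h2.1, h1.2⟩
      rw [if_neg h2, mul_zero]
    · rw [if_neg h1, zero_mul]

/-- An energy-preserving extension of a unitary `W` by an ancilla serving as energy reference. -/
noncomputable def frameUnitary (e : I → ℝ) (T : Set I) (A : Finset ℝ) (W : Matrix I I ℂ) :
    Matrix (I × A) (I × A) ℂ := 1 + energyLift e T A (W - 1)

/-- Unitarity of `1 + N` is the relation `N + Nᴴ + N Nᴴ = 0`, which the lift preserves. Lifting `W -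
1` instead of `W` makes the extension the identity on the incomplete sectors. -/
theorem frameUnitary_mul_conjTranspose {W : Matrix I I ℂ} (hW : W * Wᴴ = 1)
    (hWT : ∀ i j, ¬ (i ∈ T ∧ j ∈ T) → (W - 1) i j = 0) :
    frameUnitary e T A W * (frameUnitary e T A W)ᴴ = 1 := by
  have h : (W - 1) + (W - 1)ᴴ + (W - 1) * (W - 1)ᴴ = 0 := by
    rw [conjTranspose_sub, conjTranspose_one, mul_sub, sub_mul, hW]
    simp only [Matrix.one_mul, Matrix.mul_one]
    abel
  rw [frameUnitary, conjTranspose_add, conjTranspose_one, energyLift_conjTranspose]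
  simp only [mul_add, add_mul, Matrix.one_mul, Matrix.mul_one]
  have h2 : ∀ a b c : Matrix (I × A) (I × A) ℂ, a + b + c = 0 → 1 + a + (b + c) = 1 := by
    intro a b c h
    rw [add_assoc, ← add_assoc a, h, add_zero]
  rw [energyLift_mul fun i j hj => hWT i j fun h' => hj h'.2]
  apply h2
  rw [← energyLift_add, ← energyLift_add, h, energyLift_zero]

theorem jointHam_diagonal {κ : Type*} [DecidableEq κ] (e : I → ℝ) (f : κ → ℝ) :
    jointHam (diagonal fun i => (e i : ℂ)) (diagonal fun a => (f a : ℂ)) =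
      diagonal fun x : I × κ => ((e x.1 + f x.2 : ℝ) : ℂ) := by
  rw [jointHam, ← diagonal_one, ← diagonal_one, diagonal_kronecker_diagonal,
    diagonal_kronecker_diagonal, diagonal_add]
  simp

theorem energyPreserving_frameUnitary {W : Matrix I I ℂ} (hW : W * Wᴴ = 1)
    (hWT : ∀ i j, ¬ (i ∈ T ∧ j ∈ T) → (W - 1) i j = 0) :
    EnergyPreserving (jointHam (diagonal fun i => (e i : ℂ)) (diagonal fun a : A => ((a : ℝ) : ℂ)))
      (frameUnitary e T A W) := by
  refine ⟨mem_unitaryGroup_iff.2 (frameUnitary_mul_conjTranspose hW hWT), ?_⟩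
  rw [jointHam_diagonal e (fun a : A => (a : ℝ)), frameUnitary, add_mul, mul_add, Matrix.one_mul,
    Matrix.mul_one]
  congr 1
  ext x y
  rw [mul_diagonal, diagonal_mul]
  simp only [energyLift, of_apply]
  split_ifs with h
  · rw [h.1, mul_comm]
  · simp

open scoped Classical in
/-- The uniform superposition of the energy levels in `B`. -/
noncomputable def uniformVec (A B : Finset ℝ) (a : A) : ℂ :=
  if (a : ℝ) ∈ B then ((√(B.card : ℝ))⁻¹ : ℝ) else 0

theorem uniformVec_sq {B : Finset ℝ} (hB : B.Nonempty) (hBA : B ⊆ A) :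
    ∑ a, uniformVec A B a * star (uniformVec A B a) = 1 := by
  classical
  have hpos : (0 : ℝ) < B.card := by exact_mod_cast hB.card_pos
  have h1 : ∀ a : A, uniformVec A B a * star (uniformVec A B a) =
      if (a : ℝ) ∈ B then (((B.card : ℝ)⁻¹ : ℝ) : ℂ) else 0 := fun a => by
    unfold uniformVec
    split_ifs with h
    · rw [RCLike.star_def, Complex.conj_ofReal, ← Complex.ofReal_mul, ← mul_inv,
        Real.mul_self_sqrt hpos.le]
    · simp
  simp only [h1]
  rw [← Finset.sum_filter, Finset.sum_const]
  have h2 : (Finset.univ.filter fun a : A => (a : ℝ) ∈ B).card = B.card := by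
    rw [← Finset.card_map (Function.Embedding.subtype _)]
    congr 1
    ext b
    simp only [Finset.mem_map, Finset.mem_filter, Finset.mem_univ, true_and,
      Function.Embedding.subtype_apply]
    exact ⟨fun ⟨a, ha, hab⟩ => hab ▸ ha, fun hb => ⟨⟨b, hBA hb⟩, hb, rfl⟩⟩
  rw [h2, nsmul_eq_mul]
  push_cast
  have : (B.card : ℂ) ≠ 0 := by exact_mod_cast hpos.ne'
  field_simp

theorem isState_vecMulVec {κ : Type*} [Fintype κ] {v : κ → ℂ} (hv : ∑ a, v a * star (v a) = 1) :
    IsState (vecMulVec v (star v)) :=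
  ⟨posSemidef_vecMulVec_self_star v, by rw [trace_vecMulVec]; exact hv⟩

/-- Kraus decomposition: one operator for each basis state `b` in which the ancilla may be found. -/
theorem trAnc_conj_kronecker_vecMulVec {κ : Type*} [Fintype κ] [DecidableEq κ]
    (U : Matrix (I × κ) (I × κ) ℂ) (τ : Matrix I I ℂ) (v : κ → ℂ) :
    trAnc (U * (τ ⊗ₖ vecMulVec v (star v)) * Uᴴ) =
      ∑ b, (of fun i j => ∑ a, U (i, b) (j, a) * v a) * τ *
        (of fun i j => ∑ a, U (i, b) (j, a) * v a)ᴴ := by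
  let G : Matrix (I × κ) I ℂ := of fun x j => (1 : Matrix I I ℂ) x.1 j * v x.2
  have h1 : τ ⊗ₖ vecMulVec v (star v) = G * τ * Gᴴ := by
    ext x y
    simp [G, mul_apply, one_apply, vecMulVec_apply, apply_ite (starRingEnd ℂ)]
    ring
  have h2 : ∀ b, (of fun i j => ∑ a, U (i, b) (j, a) * v a) =
      (U * G).submatrix (fun i => (i, b)) id := fun b => by
    ext i j
    rw [submatrix_apply, mul_apply, Fintype.sum_prod_type]
    rw [Finset.sum_eq_single j]
    · simp [G]
    · intro k _ hk; simp [G, hk]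
    · simp
  have h3 : U * (τ ⊗ₖ vecMulVec v (star v)) * Uᴴ = (U * G) * τ * (U * G)ᴴ := by
    rw [h1, conjTranspose_mul]; simp only [Matrix.mul_assoc]
  rw [h3]
  simp only [h2]
  ext i j
  rw [Matrix.sum_apply]
  rfl

/-- For `b ∈ B₀` all the levels `b + (e i - e j)` that can lead to `b` lie in `B₁`, where the
amplitude is constant. The Kraus operator of `b` is therefore proportional to `W` on `T`. -/
theorem sum_frameUnitary_mul_uniformVec {B₀ B₁ : Finset ℝ} (h01 : B₀ ⊆ B₁)
    (h1A : ∀ a ∈ B₁, ∀ i ∈ T, ∀ j ∈ T, a + (e i - e j) ∈ A)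
    (h0 : ∀ b ∈ B₀, ∀ i ∈ T, ∀ j ∈ T, b + (e i - e j) ∈ B₁)
    {W : Matrix I I ℂ} (hWT : ∀ i j, ¬ (i ∈ T ∧ j ∈ T) → (W - 1) i j = 0)
    {b : A} (hb : (b : ℝ) ∈ B₀) (i j : I) (hj : j ∈ T) :
    ∑ a, frameUnitary e T A W (i, b) (j, a) * uniformVec A B₁ a =
      ((√(B₁.card : ℝ))⁻¹ : ℝ) * W i j := by
  have h1 : ∑ a, (1 : Matrix (I × A) (I × A) ℂ) (i, b) (j, a) * uniformVec A B₁ a =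
      ((√(B₁.card : ℝ))⁻¹ : ℝ) * (1 : Matrix I I ℂ) i j := by
    rw [Finset.sum_eq_single b]
    · by_cases hij : i = j
      · subst hij; simp [uniformVec, h01 hb]
      · simp [one_apply, hij]
    · intro a _ ha; simp [one_apply, ha.symm]
    · simp
  have h2 : ∑ a, energyLift e T A (W - 1) (i, b) (j, a) * uniformVec A B₁ a =
      ((√(B₁.card : ℝ))⁻¹ : ℝ) * (W - 1) i j := by
    by_cases hi : i ∈ T
    · have hB1 := h0 b hb i hi j hj
      have hmem : (b : ℝ) + (e i - e j) ∈ A := h1A b (h01 hb) i hi j hj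
      rw [Finset.sum_eq_single ⟨b + (e i - e j), hmem⟩]
      · have hg : e i + b = e j + (b + (e i - e j)) ∧ ∀ t ∈ T, e i + b - e t ∈ A :=
          ⟨by ring, fun t ht => by
            rw [show e i + b - e t = b + (e i - e t) by ring]
            exact h1A b (h01 hb) i hi t ht⟩
        simp only [energyLift, of_apply, if_pos hg, uniformVec, if_pos hB1]
        rw [mul_comm]
      · intro a _ ha
        have : ¬ (e i + b = e j + a) := fun h => ha (Subtype.ext (by
          change (a : ℝ) = b + (e i - e j); linarith))
        simp [energyLift, this]
      · simp
    · have hz : (W - 1) i j = 0 := hWT i j fun h => hi h.1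
      rw [hz, mul_zero]
      refine Finset.sum_eq_zero fun a _ => ?_
      simp only [energyLift, of_apply, hz, ite_self, zero_mul]
  have h3 : W i j = (1 : Matrix I I ℂ) i j + (W - 1) i j := by
    rw [Matrix.sub_apply]; ring
  rw [h3, mul_add, ← h1, ← h2, ← Finset.sum_add_distrib]
  refine Finset.sum_congr rfl fun a _ => ?_
  rw [frameUnitary, Matrix.add_apply, add_mul]

/-- The outcomes in `B₀` contribute exactly the fraction `κ = |B₀| / |B₁|` of `W τ Wᴴ`. The rest is
positive with trace `(1 - κ) Tr τ`, and so is what is missing from `W τ Wᴴ`. -/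
theorem traceNorm_frameUnitary_sub_le {B₀ B₁ : Finset ℝ} (hB : B₁.Nonempty) (h01 : B₀ ⊆ B₁)
    (hBA : B₁ ⊆ A)
    (h1A : ∀ a ∈ B₁, ∀ i ∈ T, ∀ j ∈ T, a + (e i - e j) ∈ A)
    (h0 : ∀ b ∈ B₀, ∀ i ∈ T, ∀ j ∈ T, b + (e i - e j) ∈ B₁)
    {W : Matrix I I ℂ} (hW : W * Wᴴ = 1) (hWT : ∀ i j, ¬ (i ∈ T ∧ j ∈ T) → (W - 1) i j = 0)
    {τ : Matrix I I ℂ} (hτ : τ.PosSemidef) (hτT : ∀ i j, i ∉ T → τ i j = 0) :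
    traceNorm (trAnc (frameUnitary e T A W *
      (τ ⊗ₖ vecMulVec (uniformVec A B₁) (star (uniformVec A B₁))) * (frameUnitary e T A W)ᴴ)
        - W * τ * Wᴴ) ≤ 2 * (1 - (B₀.card : ℝ) / B₁.card) * τ.trace.re := by
  classical
  have hpos : (0 : ℝ) < B₁.card := by exact_mod_cast hB.card_pos
  have hWW : Wᴴ * W = 1 := mul_eq_one_comm.1 hW
  set U := frameUnitary e T A W with hU
  have hUU : Uᴴ * U = 1 := mul_eq_one_comm.1 (frameUnitary_mul_conjTranspose hW hWT)
  set v := uniformVec A B₁ with hv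
  set κ : ℝ := (B₀.card : ℝ) / B₁.card with hκ
  have hκ1 : κ ≤ 1 := by
    rw [hκ, div_le_one hpos]; exact_mod_cast Finset.card_le_card h01
  let G : A → Matrix I I ℂ := fun b => of fun i j => ∑ a, U (i, b) (j, a) * v a
  have hG : ∀ b : A, (b : ℝ) ∈ B₀ → G b * τ * (G b)ᴴ = ((B₁.card : ℝ)⁻¹ : ℂ) • (W * τ * Wᴴ) := by
    intro b hb
    set c : ℂ := (((√(B₁.card : ℝ))⁻¹ : ℝ) : ℂ) with hc
    have h1 : G b * τ = c • (W * τ) := by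
      ext i l
      rw [Matrix.smul_apply, mul_apply, mul_apply, smul_eq_mul, Finset.mul_sum]
      refine Finset.sum_congr rfl fun j _ => ?_
      by_cases hj : j ∈ T
      · have := sum_frameUnitary_mul_uniformVec h01 h1A h0 hWT hb i j hj
        rw [← mul_assoc, ← this]; rfl
      · rw [hτT j l hj]; simp
    have h2 : τ * (G b)ᴴ = c • (τ * Wᴴ) := by
      have := congrArg conjTranspose h1
      rw [conjTranspose_mul, conjTranspose_smul, conjTranspose_mul, hτ.1.eq] at this
      rw [this, hc, RCLike.star_def, Complex.conj_ofReal]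
    rw [h1, Matrix.smul_mul, Matrix.mul_assoc, h2, Matrix.mul_smul, smul_smul, Matrix.mul_assoc]
    congr 1
    rw [hc, ← Complex.ofReal_mul, ← mul_inv, Real.mul_self_sqrt hpos.le]
    simp
  have hcard : (Finset.univ.filter fun b : A => (b : ℝ) ∈ B₀).card = B₀.card := by
    rw [← Finset.card_map (Function.Embedding.subtype _)]
    congr 1
    ext b
    simp only [Finset.mem_map, Finset.mem_filter, Finset.mem_univ, true_and,
      Function.Embedding.subtype_apply]
    exact ⟨fun ⟨a, ha, hab⟩ => hab ▸ ha, fun hb => ⟨⟨b, hBA (h01 hb)⟩, hb, rfl⟩⟩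
  set Rem := ∑ b ∈ Finset.univ.filter fun b : A => (b : ℝ) ∉ B₀, G b * τ * (G b)ᴴ with hRem
  have hdec : trAnc (U * (τ ⊗ₖ vecMulVec v (star v)) * Uᴴ) = (κ : ℂ) • (W * τ * Wᴴ) + Rem := by
    rw [trAnc_conj_kronecker_vecMulVec]
    change ∑ b, G b * τ * (G b)ᴴ = _
    rw [← Finset.sum_filter_add_sum_filter_not Finset.univ (fun b : A => (b : ℝ) ∈ B₀)]
    congr 1
    rw [Finset.sum_congr rfl fun b hb => hG b (Finset.mem_filter.1 hb).2, Finset.sum_const, hcard,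
      ← Nat.cast_smul_eq_nsmul ℂ, smul_smul]
    congr 1
    rw [hκ]; push_cast; rw [div_eq_mul_inv]
  have hRem0 : Rem.PosSemidef :=
    posSemidef_sum _ fun b _ => hτ.mul_mul_conjTranspose_same (G b)
  have hWτ : (W * τ * Wᴴ).PosSemidef := hτ.mul_mul_conjTranspose_same W
  have hWτtr : (W * τ * Wᴴ).trace = τ.trace := by
    rw [trace_mul_comm, ← Matrix.mul_assoc, hWW, Matrix.one_mul]
  have htr : Rem.trace.re = (1 - κ) * τ.trace.re := by
    have h1 := congrArg trace hdec
    rw [trace_trAnc, trace_mul_comm, ← Matrix.mul_assoc, hUU, Matrix.one_mul, trace_kronecker,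
      (isState_vecMulVec (uniformVec_sq hB hBA)).2, mul_one, trace_add, trace_smul, hWτtr] at h1
    have h2 := congrArg Complex.re h1
    rw [Complex.add_re, smul_eq_mul, Complex.re_ofReal_mul] at h2
    linarith
  have e : (κ : ℂ) • (W * τ * Wᴴ) + Rem - W * τ * Wᴴ = Rem - ((1 - κ : ℝ) : ℂ) • (W * τ * Wᴴ) := by
    push_cast
    rw [sub_smul, one_smul]; abel
  have hps : (((1 - κ : ℝ) : ℂ) • (W * τ * Wᴴ)).PosSemidef :=
    hWτ.smul (by rw [Complex.zero_le_real]; linarith)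
  rw [hdec, e]
  refine (traceNorm_sub_le hRem0.1 hps.1).trans (le_of_eq ?_)
  rw [PosSemidef_traceNorm hRem0, PosSemidef_traceNorm hps, htr, trace_smul, hWτtr, smul_eq_mul,
    Complex.re_ofReal_mul]
  ring

end ReferenceFrame


/-! ### Almost invariant sets of energy levels -/

section Growth

open scoped Pointwise

/-- Telescoping average; applied to the logarithms of the sizes of iterated sumsets. -/
theorem exists_increment_le (a : ℕ → ℝ) {K : ℕ} (hK : 0 < K) :
    ∃ k < K, a (k + 1) - a k ≤ (a K - a 0) / K := by
  by_contra! h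
  have h1 : ∑ _k ∈ Finset.range K, (a K - a 0) / K < ∑ k ∈ Finset.range K, (a (k + 1) - a k) :=
    Finset.sum_lt_sum_of_nonempty ⟨0, Finset.mem_range.2 hK⟩ fun k hk => h k (Finset.mem_range.1 hk)
  rw [Finset.sum_range_sub, Finset.sum_const, Finset.card_range, nsmul_eq_mul] at h1
  have : (K : ℝ) ≠ 0 := by positivity
  rw [mul_div_cancel₀ _ this] at h1
  exact lt_irrefl _ h1

/-- The energy of a word depends only on its letter counts. -/
theorem exists_int_combination {d n : ℕ} (h : Fin d → ℝ) (x y : Fin n → Fin d) :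
    ∃ z : Fin d → ℤ, (∀ j, |z j| ≤ n) ∧
      (∑ i, h (x i)) - ∑ i, h (y i) = ∑ j, z j * h j := by
  have key : ∀ x : Fin n → Fin d, ∑ i, h (x i) =
      ∑ j, ((Finset.univ.filter fun i => x i = j).card : ℝ) * h j := fun x => by
    rw [← Finset.sum_fiberwise_of_maps_to (g := x) (t := Finset.univ) fun _ _ => Finset.mem_univ _]
    refine Finset.sum_congr rfl fun j _ => ?_
    rw [Finset.sum_congr rfl fun i hi => by rw [(Finset.mem_filter.1 hi).2], Finset.sum_const,
      nsmul_eq_mul]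
  refine ⟨fun j => (Finset.univ.filter fun i => x i = j).card -
    (Finset.univ.filter fun i => y i = j).card, fun j => ?_, ?_⟩
  · have h1 := Finset.card_le_univ (Finset.univ.filter fun i => x i = j)
    have h2 := Finset.card_le_univ (Finset.univ.filter fun i => y i = j)
    rw [Fintype.card_fin] at h1 h2
    rw [abs_le]
    dsimp only
    constructor <;> omega
  · rw [key, key, ← Finset.sum_sub_distrib]
    refine Finset.sum_congr rfl fun j _ => ?_
    push_cast; ring

theorem nsmul_int_combination {d : ℕ} (h : Fin d → ℝ) {Δ : Finset ℝ} {n : ℕ}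
    (hΔ : ∀ δ ∈ Δ, ∃ z : Fin d → ℤ, (∀ j, |z j| ≤ n) ∧ δ = ∑ j, z j * h j) (k : ℕ) :
    ∀ b ∈ k • Δ, ∃ z : Fin d → ℤ, (∀ j, |z j| ≤ n * k) ∧ b = ∑ j, z j * h j := by
  induction k with
  | zero =>
    intro b hb
    rw [zero_nsmul, Finset.mem_zero] at hb
    exact ⟨0, by simp, by simp [hb]⟩
  | succ k ih =>
    intro b hb
    rw [succ_nsmul] at hb
    obtain ⟨b', hb', δ, hδ, rfl⟩ := Finset.mem_add.1 hb
    obtain ⟨z, hz, rfl⟩ := ih b' hb'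
    obtain ⟨z', hz', rfl⟩ := hΔ δ hδ
    refine ⟨z + z', fun j => ?_, ?_⟩
    · refine (abs_add_le _ _).trans ((add_le_add (hz j) (hz' j)).trans (le_of_eq ?_))
      push_cast; ring
    · rw [← Finset.sum_add_distrib]
      refine Finset.sum_congr rfl fun j _ => ?_
      simp; ring

/-- Polynomial growth: an element of the sumset is given by `d` integers of size at most `n k`,
whatever the number of words. -/
theorem card_nsmul_le {d : ℕ} (h : Fin d → ℝ) {Δ : Finset ℝ} {n : ℕ}
    (hΔ : ∀ δ ∈ Δ, ∃ z : Fin d → ℤ, (∀ j, |z j| ≤ n) ∧ δ = ∑ j, z j * h j) (k : ℕ) :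
    (k • Δ).card ≤ (2 * n * k + 1) ^ d := by
  classical
  have hsub : k • Δ ⊆ (Fintype.piFinset fun _ : Fin d => Finset.Icc (-(n * k : ℤ)) (n * k)).image
      fun z => ∑ j, (z j : ℝ) * h j := fun b hb => by
    obtain ⟨z, hz, rfl⟩ := nsmul_int_combination h hΔ k b hb
    exact Finset.mem_image.2 ⟨z, Fintype.mem_piFinset.2 fun j =>
      Finset.mem_Icc.2 (abs_le.1 (hz j)), rfl⟩
  refine (Finset.card_le_card hsub).trans (Finset.card_image_le.trans (le_of_eq ?_))
  rw [Fintype.card_piFinset, Finset.prod_const, Finset.card_univ, Fintype.card_fin, Int.card_Icc]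
  congr 1
  have : (n * k : ℤ) + 1 - -(n * k) = ((2 * n * k + 1 : ℕ) : ℤ) := by push_cast; ring
  rw [this, Int.toNat_natCast]

theorem abs_le_of_mem_nsmul {Δ : Finset ℝ} {L : ℝ} (hΔ : ∀ δ ∈ Δ, |δ| ≤ L) (k : ℕ) :
    ∀ b ∈ k • Δ, |b| ≤ k * L := by
  induction k with
  | zero => intro b hb; rw [zero_nsmul, Finset.mem_zero] at hb; simp [hb]
  | succ k ih =>
    intro b hb
    rw [succ_nsmul] at hb
    obtain ⟨b', hb', δ, hδ, rfl⟩ := Finset.mem_add.1 hb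
    refine (abs_add_le _ _).trans ((add_le_add (ih b' hb') (hΔ δ hδ)).trans (le_of_eq ?_))
    push_cast; ring

/-- Energy levels for a reference frame: `B₀ ⊆ B₁ ⊆ A` are sets of energies that absorb the energy
differences between words of `T`, and `B₀` is almost all of `B₁`. -/
theorem exists_frame_levels {d n : ℕ} (h : Fin d → ℝ) (T : Finset (Fin n → Fin d)) {K : ℕ}
    (hK : 0 < K) {L : ℝ} (hL : 0 ≤ L)
    (hT : ∀ x ∈ T, ∀ y ∈ T, |(∑ i, h (x i)) - ∑ i, h (y i)| ≤ L) {N : ℕ}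
    (hN : (2 * n * (K + 1) + 1) ^ d ≤ N) :
    ∃ A B₀ B₁ : Finset ℝ, A.card = N ∧ B₀ ⊆ B₁ ∧ B₁ ⊆ A ∧ B₁.Nonempty ∧
      (∀ a ∈ B₁, ∀ x ∈ T, ∀ y ∈ T, a + ((∑ i, h (x i)) - ∑ i, h (y i)) ∈ A) ∧
      (∀ a ∈ B₀, ∀ x ∈ T, ∀ y ∈ T, a + ((∑ i, h (x i)) - ∑ i, h (y i)) ∈ B₁) ∧
      (∀ a ∈ A, |a| ≤ (K + 1) * L + 1) ∧
      1 - (B₀.card : ℝ) / B₁.card ≤ d * Real.log (2 * n * K + 1) / K := by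
  classical
  -- Including `0` makes the sumsets nested, and nonempty even when `T` is empty.
  set Δ : Finset ℝ := insert 0 ((T ×ˢ T).image fun p => (∑ i, h (p.1 i)) - ∑ i, h (p.2 i)) with hΔ
  have h0 : (0 : ℝ) ∈ Δ := Finset.mem_insert_self _ _
  have hmem : ∀ x ∈ T, ∀ y ∈ T, (∑ i, h (x i)) - ∑ i, h (y i) ∈ Δ := fun x hx y hy =>
    Finset.mem_insert_of_mem (Finset.mem_image.2 ⟨(x, y), Finset.mem_product.2 ⟨hx, hy⟩, rfl⟩)
  have hcomb : ∀ δ ∈ Δ, ∃ z : Fin d → ℤ, (∀ j, |z j| ≤ n) ∧ δ = ∑ j, z j * h j := fun δ hδ => by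
    rcases Finset.mem_insert.1 hδ with rfl | hδ
    · exact ⟨0, by simp, by simp⟩
    · obtain ⟨p, -, rfl⟩ := Finset.mem_image.1 hδ
      exact exists_int_combination h p.1 p.2
  have hΔL : ∀ δ ∈ Δ, |δ| ≤ L := fun δ hδ => by
    rcases Finset.mem_insert.1 hδ with rfl | hδ
    · simpa using hL
    · obtain ⟨p, hp, rfl⟩ := Finset.mem_image.1 hδ
      exact hT _ (Finset.mem_product.1 hp).1 _ (Finset.mem_product.1 hp).2
  have hne : ∀ k : ℕ, (k • Δ).Nonempty := fun k => ⟨0, by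
    induction k with
    | zero => simp
    | succ k ih => rw [succ_nsmul]; exact Finset.mem_add.2 ⟨0, ih, 0, h0, by simp⟩⟩
  have hstep : ∀ k : ℕ, ∀ a ∈ k • Δ, ∀ δ ∈ Δ, a + δ ∈ (k + 1) • Δ := fun k a ha δ hδ => by
    rw [succ_nsmul]; exact Finset.add_mem_add ha hδ
  have hmono : ∀ k : ℕ, k • Δ ⊆ (k + 1) • Δ := fun k a ha => by
    have := hstep k a ha 0 h0
    rwa [add_zero] at this
  -- Among `K` successive sumsets one grows by a factor at most `|K • Δ| ^ (1 / K)`, which is close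
  -- to one.
  obtain ⟨k, hkK, hk⟩ := exists_increment_le (fun k => Real.log ((k • Δ).card : ℝ)) hK
  have hpos : ∀ k : ℕ, (0 : ℝ) < (k • Δ).card := fun k => by exact_mod_cast (hne k).card_pos
  set c : ℝ := (K + 1) * L + 1 with hc
  have hB2 : ∀ a ∈ (k + 2) • Δ, |a| ≤ c := fun a ha => by
    refine (abs_le_of_mem_nsmul hΔL _ a ha).trans ?_
    have : ((k + 2 : ℕ) : ℝ) ≤ K + 1 := by exact_mod_cast (by omega : k + 2 ≤ K + 1)
    have := mul_le_mul_of_nonneg_right this hL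
    linarith
  have hcard2 : ((k + 2) • Δ).card ≤ N := by
    refine (card_nsmul_le h hcomb _).trans (le_trans ?_ hN)
    exact Nat.pow_le_pow_left (Nat.succ_le_succ (Nat.mul_le_mul_left _ (by omega))) _
  -- Arbitrary further levels bring the dimension to exactly `N`. The `+ 1` in `c` keeps the
  -- interval infinite when `L = 0`.
  have hinf : (Set.Icc (-c) c \ ((k + 2) • Δ : Finset ℝ)).Infinite := by
    refine (Set.Icc_infinite ?_).sdiff (Finset.finite_toSet _)
    have : 0 ≤ (K + 1) * L := by positivity
    linarith
  obtain ⟨t, htsub, htcard⟩ := hinf.exists_subset_card_eq (N - ((k + 2) • Δ).card)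
  refine ⟨(k + 2) • Δ ∪ t, k • Δ, (k + 1) • Δ, ?_, hmono k,
    (hmono (k + 1)).trans Finset.subset_union_left, hne _, ?_, ?_, ?_, ?_⟩
  · rw [Finset.card_union_of_disjoint, htcard]
    · omega
    · rw [Finset.disjoint_left]
      exact fun a ha hat => (htsub hat).2 ha
  · exact fun a ha x hx y hy => Finset.mem_union_left _ (hstep _ a ha _ (hmem x hx y hy))
  · exact fun a ha x hx y hy => hstep _ a ha _ (hmem x hx y hy)
  · intro a ha
    rcases Finset.mem_union.1 ha with ha | ha
    · exact hB2 a ha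
    · exact abs_le.2 (htsub ha).1
  · have hK' : (0 : ℝ) < K := by exact_mod_cast hK
    have h1 : Real.log ((K • Δ).card : ℝ) ≤ d * Real.log (2 * n * K + 1) := by
      rw [← Real.log_pow]
      refine Real.log_le_log (hpos K) ?_
      exact_mod_cast card_nsmul_le h hcomb K
    have h2 : Real.log ((0 • Δ).card : ℝ) = 0 := by simp
    simp only [h2, sub_zero] at hk
    -- This is `1 - log r ≤ 1 / r` for the growth ratio `r`.
    have h3 : 1 - Real.log (((k + 1) • Δ).card / (k • Δ).card : ℝ) ≤
        ((k • Δ).card : ℝ) / ((k + 1) • Δ).card := by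
      have := Real.add_one_le_exp (-Real.log (((k + 1) • Δ).card / (k • Δ).card : ℝ))
      rw [Real.exp_neg, Real.exp_log (div_pos (hpos _) (hpos _)), inv_div] at this
      linarith
    rw [Real.log_div (hpos _).ne' (hpos _).ne'] at h3
    have h4 : Real.log ((K • Δ).card : ℝ) / K ≤ d * Real.log (2 * n * K + 1) / K := by gcongr
    linarith

end Growth


/-! ### Compression to an energy window -/

section Compression

variable {ι l : Type*} [Fintype ι] [DecidableEq ι] [Fintype l] [DecidableEq l]

/-- The inclusion of the span of the basis vectors in `T`. -/
def inclusion (T : Finset ι) : Matrix ι T ℂ := (1 : Matrix ι ι ℂ).submatrix id (↑)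

theorem inclusion_isometry (T : Finset ι) : (inclusion T)ᴴ * inclusion T = 1 :=
  isometry_submatrix (by simp) T

theorem inclusion_mul_conjTranspose (T : Finset ι) : inclusion T * (inclusion T)ᴴ =
    diagonal fun i => ((if i ∈ T then 1 else 0 : ℝ) : ℂ) := by
  have h := conj_diagonal_sub_submatrix (1 : Matrix ι ι ℂ) (fun _ => 1) T
  simp only [Complex.ofReal_one, diagonal_one, Matrix.mul_one, conjTranspose_one] at h
  rw [inclusion, ← sub_sub_cancel (1 : Matrix ι ι ℂ) (submatrix _ _ _ * _), h, Matrix.one_mul,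
    ← diagonal_one, diagonal_sub]
  congr 1; ext i
  split_ifs <;> simp

/-- `A` is the typical part `Rt` of `R` cut down to `T`, which increases neither rank nor norm. As
`Rt ≤ R`, the cut loses trace at most `ε`, and gentle measurement bounds the disturbance by `2 √ε`.
-/
theorem compression_of_typical {R : Matrix ι ι ℂ} (hR : IsState R) (T : Finset ι)
    {Z : Matrix ι l ℂ} (hZ : Zᴴ * Z = 1) {μ : l → ℝ} (hμ : ∀ i, 0 ≤ μ i) {M : ℝ} (hM0 : 0 ≤ M)
    (hM : ∀ i, μ i ≤ M) (hRZ : (R - Z * diagonal (fun i => (μ i : ℂ)) * Zᴴ).PosSemidef) {ε : ℝ}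
    (hRε : (R - Z * diagonal (fun i => (μ i : ℂ)) * Zᴴ).trace.re ≤ ε)
    (hRT : ∑ x ∈ Tᶜ, (R x x).re ≤ ε) :
    ∃ A : Matrix T T ℂ, A.PosSemidef ∧ ‖A‖ ≤ M ∧ A.rank ≤ Fintype.card l ∧
      A.trace.re ≤ 1 ∧ 1 - 2 * ε ≤ A.trace.re ∧
      traceNorm (R - inclusion T * A * (inclusion T)ᴴ) ≤ ε + 2 * √ε := by
  set Rt := Z * diagonal (fun i => (μ i : ℂ)) * Zᴴ with hRt
  set J := inclusion T with hJ
  have hJJ : Jᴴ * J = 1 := inclusion_isometry T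
  have hJ1 := norm_le_one_of_isometry hJJ
  have hRt0 : Rt.PosSemidef := posSemidef_conj_diagonal Z hμ
  set P := J * Jᴴ with hP
  have hPh : P.IsHermitian := isHermitian_mul_conjTranspose_self J
  have hPP : P * P = P := by
    rw [hP, Matrix.mul_assoc, ← Matrix.mul_assoc Jᴴ, hJJ, Matrix.one_mul]
  have h1P : 1 - P = (1 : Matrix ι ι ℂ) *
      diagonal (fun i => ((if i ∈ T then 0 else 1 : ℝ) : ℂ)) * (1 : Matrix ι ι ℂ)ᴴ := by
    rw [hP, hJ, inclusion_mul_conjTranspose, conjTranspose_one, Matrix.mul_one, Matrix.one_mul,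
      ← diagonal_one, diagonal_sub]
    congr 1; ext i
    split_ifs <;> simp
  have hRtrace : (R * (1 - P)).trace.re ≤ ε := by
    refine le_of_eq_of_le ?_ hRT
    rw [h1P, Matrix.one_mul, conjTranspose_one, Matrix.mul_one]
    simp only [trace, diag_apply, mul_diagonal, Complex.re_sum, Complex.re_mul_ofReal]
    rw [← Finset.sum_compl_add_sum T]
    rw [Finset.sum_congr rfl fun x hx => by rw [if_neg (Finset.mem_compl.1 hx), mul_one],
      Finset.sum_congr (s₁ := T) rfl fun x hx => by rw [if_pos hx, mul_zero],
      Finset.sum_const_zero, add_zero]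
  have hRtT : (Rt * (1 - P)).trace.re ≤ ε := by
    have h1 : 0 ≤ ((R - Rt) * (1 - P)).trace.re := by
      rw [h1P]
      exact trace_mul_conj_diagonal_nonneg hRZ 1 fun i => by split_ifs <;> norm_num
    rw [sub_mul, trace_sub, Complex.sub_re] at h1
    linarith
  have hRttr : Rt.trace.re = 1 - (R - Rt).trace.re := by
    rw [trace_sub, hR.2, Complex.sub_re, Complex.one_re]; ring
  have hRt1 : Rt.trace.re ≤ 1 := by
    have := PosSemidef_trace_re_nonneg hRZ
    linarith
  have hAtr : (Jᴴ * Rt * J).trace.re = Rt.trace.re - (Rt * (1 - P)).trace.re := by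
    rw [Matrix.mul_assoc, trace_mul_comm, Matrix.mul_assoc, mul_sub, Matrix.mul_one, trace_sub,
      Complex.sub_re, hP]
    ring
  have hA0 : (Jᴴ * Rt * J).PosSemidef := hRt0.conjTranspose_mul_mul_same J
  have hpos : 0 ≤ (Rt * (1 - P)).trace.re := by
    rw [h1P]
    exact trace_mul_conj_diagonal_nonneg hRt0 1 fun i => by split_ifs <;> norm_num
  refine ⟨Jᴴ * Rt * J, hA0, ?_, ?_, ?_, ?_, ?_⟩
  · refine (norm_conj_le _ (norm_conjTranspose_le_one hJ1) hJ1).trans ?_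
    exact norm_conj_diagonal_le hZ hM0 fun i => by rw [abs_of_nonneg (hμ i)]; exact hM i
  · have : Jᴴ * Rt * J = (Jᴴ * Z) * (diagonal (fun i => (μ i : ℂ)) * Zᴴ * J) := by
      rw [hRt]; simp only [Matrix.mul_assoc]
    rw [this]
    exact (rank_mul_le_left _ _).trans (rank_le_card_width _)
  · linarith
  · linarith
  · have e : J * (Jᴴ * Rt * J) * Jᴴ = P * Rt * P := by
      rw [hP]; simp only [Matrix.mul_assoc]
    have hPRP : (P * Rt * P).IsHermitian := by
      have := isHermitian_mul_mul_conjTranspose P hRt0.1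
      rwa [hPh.eq] at this
    rw [e]
    refine (traceNorm_sub_le_add hR.1.1 hRt0.1 hPRP).trans (add_le_add ?_ ?_)
    · rwa [PosSemidef_traceNorm hRZ]
    · have := traceNorm_sub_proj_le hRt0 hPh hPP hRt1 hRtT
      simpa using this

end Compression

theorem sub_kronecker {m n : Type*} (A B : Matrix m m ℂ) (C : Matrix n n ℂ) :
    (A - B) ⊗ₖ C = A ⊗ₖ C - B ⊗ₖ C := by
  rw [eq_sub_iff_add_eq, ← add_kronecker, sub_add_cancel]

/-! ### Conversion by an energy-preserving unitary -/

section Core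

variable {ι R₀ : Type*} [Fintype ι] [DecidableEq ι] [Fintype R₀] [DecidableEq R₀]

/-- Combines the matching unitary with the energy reference. The matching registers carry no energy.
The terms of the bound are the errors of compressing `R` and `S`, of the reference, and of the
matching. -/
theorem exists_energyPreserving_conversion (e : ι → ℝ) (T : Finset ι) {R S : Matrix ι ι ℂ}
    (hR : IsState R) (hS : IsState S) {X Y : Matrix T T ℂ} (hX : X.PosSemidef)
    (hY : Y.PosSemidef) {M N θ : ℝ} (hXM : ‖X‖ ≤ M) (hYM : ‖Y‖ ≤ M) (hXN : (X.rank : ℝ) ≤ N)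
    (hYN : (Y.rank : ℝ) ≤ N) (hX1 : X.trace.re ≤ 1) (hθ : 0 < θ)
    (hD : M / θ ≤ Fintype.card R₀) (r₀ : R₀)
    {A B₀ B₁ : Finset ℝ} (hB : B₁.Nonempty) (h01 : B₀ ⊆ B₁) (hBA : B₁ ⊆ A)
    (h1A : ∀ a ∈ B₁, ∀ i ∈ T, ∀ j ∈ T, a + (e i - e j) ∈ A)
    (h0 : ∀ b ∈ B₀, ∀ i ∈ T, ∀ j ∈ T, b + (e i - e j) ∈ B₁) :
    ∃ (η : Matrix A A ℂ) (U : Matrix ((ι × (R₀ × R₀)) × A) ((ι × (R₀ × R₀)) × A) ℂ),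
      IsState η ∧
      EnergyPreserving (jointHam (diagonal fun i : ι × (R₀ × R₀) => (e i.1 : ℂ))
        (diagonal fun a : A => ((a : ℝ) : ℂ))) U ∧
      traceNorm (trAnc (trAnc (U * ((R ⊗ₖ mixedPureState r₀) ⊗ₖ η) * Uᴴ)) - S) ≤
        traceNorm (R - inclusion T * X * (inclusion T)ᴴ) +
        traceNorm (S - inclusion T * Y * (inclusion T)ᴴ) +
        2 * (1 - (B₀.card : ℝ) / B₁.card) +
        (2 * (|X.trace.re - Y.trace.re| + N * θ + N * (M / Fintype.card R₀)) +
          |X.trace.re - Y.trace.re|) := by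
  obtain ⟨W₀, -, hW₀, hmatch⟩ := exists_unitary_matching hX hY hXM hYM hXN hYN hθ hD r₀
  set J := inclusion T with hJ
  have hJJ : Jᴴ * J = 1 := inclusion_isometry T
  have hJ1 := norm_le_one_of_isometry hJJ
  set J' := J ⊗ₖ (1 : Matrix (R₀ × R₀) (R₀ × R₀) ℂ) with hJ'
  have hJ'h : J'ᴴ = Jᴴ ⊗ₖ (1 : Matrix (R₀ × R₀) (R₀ × R₀) ℂ) := by
    rw [hJ', conjTranspose_kronecker, conjTranspose_one]
  have hJJ' : J'ᴴ * J' = 1 := by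
    rw [hJ'h, hJ', ← mul_kronecker_mul, hJJ, Matrix.one_mul, one_kronecker_one]
  -- `W` is `W₀` on the window and the identity off it, so `W - 1` is supported on `T`, as the
  -- reference requires.
  set W : Matrix (ι × (R₀ × R₀)) (ι × (R₀ × R₀)) ℂ := 1 + J' * (W₀ - 1) * J'ᴴ with hW
  have hWW : W * Wᴴ = 1 := by
    have h1 : (W₀ - 1) + (W₀ - 1)ᴴ + (W₀ - 1) * (W₀ - 1)ᴴ = 0 := by
      rw [conjTranspose_sub, conjTranspose_one, mul_sub, sub_mul, hW₀]
      simp only [Matrix.one_mul, Matrix.mul_one]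
      abel
    have h2 : W * Wᴴ = 1 + J' * ((W₀ - 1) + (W₀ - 1)ᴴ + (W₀ - 1) * (W₀ - 1)ᴴ) * J'ᴴ := by
      rw [hW, conjTranspose_add, conjTranspose_mul, conjTranspose_mul, conjTranspose_conjTranspose,
        conjTranspose_one]
      have h3 : J' * (W₀ - 1) * J'ᴴ * (J' * ((W₀ - 1)ᴴ * J'ᴴ)) =
          J' * ((W₀ - 1) * (W₀ - 1)ᴴ) * J'ᴴ := by
        calc _ = J' * (W₀ - 1) * (J'ᴴ * J') * ((W₀ - 1)ᴴ * J'ᴴ) := by simp only [Matrix.mul_assoc]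
          _ = _ := by rw [hJJ', Matrix.mul_one]; simp only [Matrix.mul_assoc]
      rw [mul_add, add_mul, add_mul, h3, Matrix.mul_add, Matrix.mul_add, Matrix.add_mul,
        Matrix.add_mul, ← Matrix.mul_assoc J' (W₀ - 1)ᴴ]
      simp only [Matrix.one_mul, Matrix.mul_one]
      abel
    rw [h2, h1]; simp
  set Tset : Set (ι × (R₀ × R₀)) := {p | p.1 ∈ T} with hTset
  have hJ0 : ∀ i k, i ∉ Tset → J' i k = 0 := by
    rintro ⟨i, r⟩ ⟨k, r'⟩ hi
    rw [hJ', kronecker_apply]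
    have : J i k = 0 := by
      rw [hJ, inclusion, submatrix_apply]
      exact one_apply_ne fun h => hi (by simp only [hTset, Set.mem_ofPred_eq]; rw [show i = _ from h]; exact k.2)
    rw [this, zero_mul]
  have hJleft : ∀ (Q : Matrix (T × (R₀ × R₀)) (ι × (R₀ × R₀)) ℂ) i j, i ∉ Tset →
      (J' * Q) i j = 0 := fun Q i j hi => by
    rw [mul_apply]
    exact Finset.sum_eq_zero fun k _ => by rw [hJ0 i k hi, zero_mul]
  have hWT : ∀ i j, ¬ (i ∈ Tset ∧ j ∈ Tset) → (W - 1) i j = 0 := by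
    intro i j hij
    have e1 : W - 1 = J' * (W₀ - 1) * J'ᴴ := by rw [hW]; abel
    rw [e1]
    rcases not_and_or.1 hij with h | h
    · rw [Matrix.mul_assoc]; exact hJleft _ i j h
    · rw [mul_apply]
      exact Finset.sum_eq_zero fun k _ => by
        rw [conjTranspose_apply, hJ0 j k h, star_zero, mul_zero]
  set ηR : Matrix (R₀ × R₀) (R₀ × R₀) ℂ := mixedPureState r₀ with hηR
  have hηRs : IsState ηR := isState_mixedPureState r₀
  set R' := J * X * Jᴴ with hR'
  set S' := J * Y * Jᴴ with hS'
  have hR'0 : R'.PosSemidef := hX.mul_mul_conjTranspose_same J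
  have hS'0 : S'.PosSemidef := hY.mul_mul_conjTranspose_same J
  have hR'tr : R'.trace = X.trace := by
    rw [hR', trace_mul_comm, ← Matrix.mul_assoc, hJJ, Matrix.one_mul]
  set τ := R' ⊗ₖ ηR with hτ
  have hτ0 : τ.PosSemidef := hR'0.kronecker hηRs.1
  have hτJ : τ = J' * (X ⊗ₖ ηR) * J'ᴴ := by
    rw [hτ, hR', hJ'h, hJ', ← mul_kronecker_mul, ← mul_kronecker_mul, Matrix.one_mul,
      Matrix.mul_one]
  have hτT : ∀ i j, i ∉ Tset → τ i j = 0 := fun i j hi => by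
    rw [hτJ, Matrix.mul_assoc]; exact hJleft _ i j hi
  have hWτ : W * τ * Wᴴ = J' * (W₀ * (X ⊗ₖ ηR) * W₀ᴴ) * J'ᴴ := by
    have h1 : W * J' = J' * W₀ := by
      rw [hW, Matrix.add_mul, Matrix.one_mul, Matrix.mul_assoc, hJJ', Matrix.mul_one, Matrix.mul_sub,
        Matrix.mul_one]
      abel
    have h2 : J'ᴴ * Wᴴ = W₀ᴴ * J'ᴴ := by
      rw [← conjTranspose_mul, h1, conjTranspose_mul]
    calc W * τ * Wᴴ = (W * J') * (X ⊗ₖ ηR) * (J'ᴴ * Wᴴ) := by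
          rw [hτJ]; simp only [Matrix.mul_assoc]
      _ = _ := by rw [h1, h2]; simp only [Matrix.mul_assoc]
  have hframe := traceNorm_frameUnitary_sub_le (e := fun i : ι × (R₀ × R₀) => e i.1) (T := Tset)
    hB h01 hBA (fun a ha i hi j hj => h1A a ha i.1 hi j.1 hj)
    (fun a ha i hi j hj => h0 a ha i.1 hi j.1 hj) hWW hWT hτ0 hτT
  set U := frameUnitary (fun i : ι × (R₀ × R₀) => e i.1) Tset A W with hU
  have hUU : Uᴴ * U = 1 := mul_eq_one_comm.1 (frameUnitary_mul_conjTranspose hWW hWT)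
  have hU1 := norm_le_one_of_isometry hUU
  set η : Matrix A A ℂ := vecMulVec (uniformVec A B₁) (star (uniformVec A B₁)) with hη
  have hηs : IsState η := isState_vecMulVec (uniformVec_sq hB hBA)
  refine ⟨η, U, hηs, energyPreserving_frameUnitary hWW hWT, ?_⟩
  have hherm : ∀ {Q : Matrix ι ι ℂ}, Q.IsHermitian →
      (U * ((Q ⊗ₖ ηR) ⊗ₖ η) * Uᴴ).IsHermitian := fun hQ =>
    isHermitian_mul_mul_conjTranspose _ (by
      rw [Matrix.IsHermitian, conjTranspose_kronecker, conjTranspose_kronecker, hQ.eq,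
        hηRs.1.1.eq, hηs.1.1.eq])
  have s1 : traceNorm (trAnc (trAnc (U * ((R ⊗ₖ ηR) ⊗ₖ η) * Uᴴ)) -
      trAnc (trAnc (U * ((R' ⊗ₖ ηR) ⊗ₖ η) * Uᴴ))) ≤ traceNorm (R - R') := by
    have hd := hR.1.1.sub hR'0.1
    have e1 : trAnc (trAnc (U * ((R ⊗ₖ ηR) ⊗ₖ η) * Uᴴ)) -
      trAnc (trAnc (U * ((R' ⊗ₖ ηR) ⊗ₖ η) * Uᴴ)) =
        trAnc (trAnc (U * (((R - R') ⊗ₖ ηR) ⊗ₖ η) * Uᴴ)) := by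
      rw [← trAnc_sub, ← trAnc_sub, ← Matrix.sub_mul, ← Matrix.mul_sub]
      rw [sub_kronecker, sub_kronecker]
    have hd' : ((R - R') ⊗ₖ ηR).IsHermitian := by
      rw [Matrix.IsHermitian, conjTranspose_kronecker, hd.eq, hηRs.1.1.eq]
    have hd'' : (((R - R') ⊗ₖ ηR) ⊗ₖ η).IsHermitian := by
      rw [Matrix.IsHermitian, conjTranspose_kronecker, hd'.eq, hηs.1.1.eq]
    rw [e1]
    exact (traceNorm_trAnc_le (IsHermitian.trAnc (hherm hd))).trans
      ((traceNorm_trAnc_le (hherm hd)).trans ((traceNorm_conj_le hd'' hU1).trans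
      ((traceNorm_kronecker_le hd' hηs).trans (traceNorm_kronecker_le hd hηRs))))
  have hWτh : (W * τ * Wᴴ).IsHermitian := isHermitian_mul_mul_conjTranspose _ hτ0.1
  have s2 : traceNorm (trAnc (trAnc (U * ((R' ⊗ₖ ηR) ⊗ₖ η) * Uᴴ)) - trAnc (W * τ * Wᴴ)) ≤
      2 * (1 - (B₀.card : ℝ) / B₁.card) := by
    rw [← trAnc_sub]
    refine (traceNorm_trAnc_le ((IsHermitian.trAnc (hherm hR'0.1)).sub hWτh)).trans
      (hframe.trans ?_)
    have hpos : (0 : ℝ) < B₁.card := by exact_mod_cast hB.card_pos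
    have hκ1 : (B₀.card : ℝ) / B₁.card ≤ 1 := by
      rw [div_le_one hpos]; exact_mod_cast Finset.card_le_card h01
    have htr : τ.trace.re ≤ 1 := by
      rw [hτ, trace_kronecker, hηRs.2, mul_one, hR'tr]; exact hX1
    exact mul_le_of_le_one_right (by linarith) htr
  have hm0 : (trAnc (W₀ * (X ⊗ₖ ηR) * W₀ᴴ)).IsHermitian := IsHermitian.trAnc
    (isHermitian_mul_mul_conjTranspose _ (hX.kronecker hηRs.1).1)
  have s3 : traceNorm (trAnc (W * τ * Wᴴ) - S') ≤
      (2 * (|X.trace.re - Y.trace.re| + N * θ + N * (M / Fintype.card R₀)) +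
          |X.trace.re - Y.trace.re|) := by
    rw [hWτ, hJ'h, hJ', trAnc_conj_kronecker_one, hS', ← Matrix.sub_mul, ← Matrix.mul_sub]
    exact (traceNorm_conj_le (hm0.sub hY.1) hJ1).trans hmatch
  have s4 : traceNorm (S' - S) = traceNorm (S - S') := traceNorm_sub_comm
  have o1 := IsHermitian.trAnc (IsHermitian.trAnc (hherm hR.1.1))
  have o2 := IsHermitian.trAnc (IsHermitian.trAnc (hherm hR'0.1))
  have o3 := IsHermitian.trAnc hWτh
  have t1 := traceNorm_sub_le_add o1 o2 hS.1.1
  have t2 := traceNorm_sub_le_add o2 o3 hS.1.1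
  have t3 := traceNorm_sub_le_add o3 hS'0.1 hS.1.1
  linarith

/-- Regrouping the two ancillas of a process into one of dimension `D`, and changing the basis of
the system. -/
theorem exists_regrouped_conversion {κ₁ κ₂ : Type*} [Fintype κ₁] [DecidableEq κ₁] [Fintype κ₂]
    [DecidableEq κ₂] {D : ℕ} (hD : D = Fintype.card κ₁ * Fintype.card κ₂) {e : ι → ℝ} {f : κ₂ → ℝ}
    {V : Matrix ι ι ℂ} (hV : V * Vᴴ = 1)
    {R S : Matrix ι ι ℂ} (hR : R.IsHermitian) (hS : S.IsHermitian) {η₁ : Matrix κ₁ κ₁ ℂ}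
    {η₂ : Matrix κ₂ κ₂ ℂ} (h₁ : IsState η₁) (h₂ : IsState η₂)
    {U : Matrix ((ι × κ₁) × κ₂) ((ι × κ₁) × κ₂) ℂ}
    (hU : EnergyPreserving (jointHam (diagonal fun i : ι × κ₁ => (e i.1 : ℂ))
        (diagonal fun a => (f a : ℂ))) U) {c : ℝ} (hc : 0 ≤ c) (hf : ∀ a, |f a| ≤ c) :
    ∃ (HA η : Matrix (Fin D) (Fin D) ℂ) (U' : Matrix (ι × Fin D) (ι × Fin D) ℂ),
      HA.IsHermitian ∧ opNorm HA ≤ c ∧ IsState η ∧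
      EnergyPreserving (jointHam (V * diagonal (fun i => (e i : ℂ)) * Vᴴ) HA) U' ∧
      traceNorm (trAnc (U' * ((V * R * Vᴴ) ⊗ₖ η) * U'ᴴ) - V * S * Vᴴ) ≤
        traceNorm (trAnc (trAnc (U * ((R ⊗ₖ η₁) ⊗ₖ η₂) * Uᴴ)) - S) := by
  have hVV : Vᴴ * V = 1 := mul_eq_one_comm.1 hV
  let φ : Fin D ≃ κ₁ × κ₂ := Fintype.equivOfCardEq (by simp [hD])
  let E : ι × Fin D ≃ (ι × κ₁) × κ₂ :=
    ((Equiv.refl ι).prodCongr φ).trans (Equiv.prodAssoc ι κ₁ κ₂).symm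
  set HA : Matrix (Fin D) (Fin D) ℂ := diagonal fun a => (f (φ a).2 : ℂ) with hHA
  set η := (η₁ ⊗ₖ η₂).submatrix φ φ with hη
  have hsub : ∀ M N : Matrix ((ι × κ₁) × κ₂) ((ι × κ₁) × κ₂) ℂ,
      M.submatrix E E * N.submatrix E E = (M * N).submatrix E E :=
    fun M N => submatrix_mul_equiv M N E E E
  set U₀ := U.submatrix E E with hU₀
  have hU₀h : U₀ᴴ = Uᴴ.submatrix E E := conjTranspose_submatrix _ _ _
  have hUU : U₀ᴴ * U₀ = 1 := by
    rw [hU₀h, hU₀, hsub, isometry_of_mem_unitaryGroup hU.1, submatrix_one_equiv]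
  have hK : (jointHam (diagonal fun i : ι × κ₁ => (e i.1 : ℂ))
        (diagonal fun a => (f a : ℂ))).submatrix E E =
      jointHam (diagonal fun i => (e i : ℂ)) HA := by
    rw [jointHam_diagonal, hHA, jointHam_diagonal e fun a => f (φ a).2, submatrix_diagonal_equiv]
    rfl
  set V' := V ⊗ₖ (1 : Matrix (Fin D) (Fin D) ℂ) with hV'
  have hV'h : V'ᴴ = Vᴴ ⊗ₖ (1 : Matrix (Fin D) (Fin D) ℂ) := by
    rw [hV', conjTranspose_kronecker, conjTranspose_one]
  have hVV' : V'ᴴ * V' = 1 := by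
    rw [hV'h, hV', ← mul_kronecker_mul, hVV, Matrix.one_mul, one_kronecker_one]
  have hjoint : jointHam (V * diagonal (fun i => (e i : ℂ)) * Vᴴ) HA =
      V' * jointHam (diagonal fun i => (e i : ℂ)) HA * V'ᴴ := by
    rw [hV'h, hV', jointHam, jointHam, mul_add, add_mul, ← mul_kronecker_mul, ← mul_kronecker_mul,
      ← mul_kronecker_mul, ← mul_kronecker_mul]
    simp only [Matrix.one_mul, Matrix.mul_one, hV]
  refine ⟨HA, η, V' * U₀ * V'ᴴ, ?_, ?_, ?_, ⟨?_, ?_⟩, ?_⟩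
  · exact isHermitian_diagonal_of_self_adjoint _ (by ext i; simp)
  · change ‖HA‖ ≤ c
    rw [hHA, l2_opNorm_diagonal]
    exact (pi_norm_le_iff_of_nonneg hc).2 fun a => by simpa using hf _
  · refine ⟨(h₁.1.kronecker h₂.1).submatrix _, ?_⟩
    have := (h₁.kronecker h₂).2
    rw [← this, hη]
    simp only [trace, diag_apply, submatrix_apply]
    exact Equiv.sum_comp φ fun p => (η₁ ⊗ₖ η₂) p p
  · rw [mem_unitaryGroup_iff', star_eq_conjTranspose]
    simp only [conjTranspose_mul, conjTranspose_conjTranspose]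
    calc V' * (U₀ᴴ * V'ᴴ) * (V' * U₀ * V'ᴴ) = V' * (U₀ᴴ * (V'ᴴ * V') * U₀) * V'ᴴ := by
          simp only [Matrix.mul_assoc]
      _ = 1 := by
          rw [hVV', Matrix.mul_one, hUU, Matrix.mul_one]
          exact mul_eq_one_comm.1 hVV'
  · have hcomm : U₀ * jointHam (diagonal fun i => (e i : ℂ)) HA =
        jointHam (diagonal fun i => (e i : ℂ)) HA * U₀ := by
      rw [← hK, hU₀, hsub, hsub, hU.2]
    rw [hjoint]
    set K := jointHam (diagonal fun i => (e i : ℂ)) HA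
    calc V' * U₀ * V'ᴴ * (V' * K * V'ᴴ) = V' * (U₀ * (V'ᴴ * V') * K) * V'ᴴ := by
          simp only [Matrix.mul_assoc]
      _ = V' * (K * (V'ᴴ * V') * U₀) * V'ᴴ := by rw [hVV', Matrix.mul_one, Matrix.mul_one, hcomm]
      _ = _ := by simp only [Matrix.mul_assoc]
  · have e1 : (V * R * Vᴴ) ⊗ₖ η = V' * (R ⊗ₖ η) * V'ᴴ := by
      rw [hV'h, hV', ← mul_kronecker_mul, ← mul_kronecker_mul, Matrix.one_mul, Matrix.mul_one]
    have e2 : V' * U₀ * V'ᴴ * ((V * R * Vᴴ) ⊗ₖ η) * (V' * U₀ * V'ᴴ)ᴴ =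
        V' * (U₀ * (R ⊗ₖ η) * U₀ᴴ) * (Vᴴ ⊗ₖ (1 : Matrix (Fin D) (Fin D) ℂ)) := by
      rw [e1, ← hV'h]
      simp only [conjTranspose_mul, conjTranspose_conjTranspose]
      calc V' * U₀ * V'ᴴ * (V' * (R ⊗ₖ η) * V'ᴴ) * (V' * (U₀ᴴ * V'ᴴ))
          = V' * (U₀ * (V'ᴴ * V') * (R ⊗ₖ η) * (V'ᴴ * V') * U₀ᴴ) * V'ᴴ := by
            simp only [Matrix.mul_assoc]
        _ = _ := by rw [hVV', Matrix.mul_one, Matrix.mul_one]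
    have e3 : R ⊗ₖ η = ((R ⊗ₖ η₁) ⊗ₖ η₂).submatrix E E := by
      ext x y
      simp [hη, E, mul_assoc]
    have e4 : trAnc (U₀ * (R ⊗ₖ η) * U₀ᴴ) = trAnc (trAnc (U * ((R ⊗ₖ η₁) ⊗ₖ η₂) * Uᴴ)) := by
      rw [e3, hU₀h, hU₀, hsub, hsub]
      ext i j
      simp only [trAnc, of_apply, submatrix_apply]
      rw [← Fintype.sum_prod_type']
      exact Equiv.sum_comp φ fun p : κ₁ × κ₂ =>
        (U * ((R ⊗ₖ η₁) ⊗ₖ η₂) * Uᴴ) ((i, p.1), p.2) ((j, p.1), p.2)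
    rw [e2, hV', trAnc_conj_kronecker_one, ← Matrix.sub_mul, ← Matrix.mul_sub, e4]
    refine traceNorm_conj_le ?_ (norm_le_one_of_isometry hVV)
    refine (IsHermitian.trAnc (IsHermitian.trAnc (isHermitian_mul_mul_conjTranspose _ ?_))).sub hS
    rw [Matrix.IsHermitian, conjTranspose_kronecker, conjTranspose_kronecker, hR.eq, h₁.1.1.eq,
      h₂.1.1.eq]

end Core


/-! ### Error bound for fixed `n` -/

section FiniteConversion

variable {d : ℕ}

theorem HasTypicalSubspaces.conj {ρ V : Matrix (Fin d) (Fin d) ℂ} {m : ℝ}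
    (h : HasTypicalSubspaces ρ m) (hV : Vᴴ * V = 1) : HasTypicalSubspaces (V * ρ * Vᴴ) m := by
  obtain ⟨C, hC, h⟩ := h
  refine ⟨C, hC, fun n w hw => ?_⟩
  obtain ⟨X, Z, μ, h1, h2, h3, h4, h5, h6⟩ := h n w hw
  have hVn := tensorPower_isometry (n := n) hV
  set Vn := tensorPower n V
  have e : tensorPower n (V * ρ * Vᴴ) - (Vn * Z) * diagonal (fun i => (μ i : ℂ)) * (Vn * Z)ᴴ =
      Vn * (tensorPower n ρ - Z * diagonal (fun i => (μ i : ℂ)) * Zᴴ) * Vnᴴ := by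
    rw [tensorPower_conj, Matrix.mul_sub, Matrix.sub_mul, conjTranspose_mul]
    simp only [Matrix.mul_assoc, Vn]
  refine ⟨X, Vn * Z, μ, ?_, h2, h3, h4, ?_, ?_⟩
  · rw [conjTranspose_mul, Matrix.mul_assoc, ← Matrix.mul_assoc Vnᴴ, hVn, Matrix.one_mul, h1]
  · rw [e]; exact h5.mul_mul_conjTranspose_same Vn
  · rw [e, trace_mul_comm, ← Matrix.mul_assoc, hVn, Matrix.one_mul]; exact h6

open scoped Classical in
/-- The words whose energy is within `w` of `n E`. -/
noncomputable def energyWindow (n : ℕ) (h : Fin d → ℝ) (E w : ℝ) : Finset (Fin n → Fin d) :=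
  Finset.univ.filter fun x => |(∑ i, h (x i)) - n * E| ≤ w

/-- The diagonal of `ρ` in the energy basis is a probability distribution, and Chebyshev applies to
it; `ρ` need not commute with the Hamiltonian. -/
theorem exists_energy_tail {ρ : Matrix (Fin d) (Fin d) ℂ} (hρ : IsState ρ) (h : Fin d → ℝ) :
    ∃ C : ℝ, 0 ≤ C ∧ ∀ (n : ℕ) (w : ℝ), 0 < w →
      ∑ x ∈ (energyWindow n h (energy (diagonal fun i => (h i : ℂ)) ρ) w)ᶜ,
        (tensorPower n ρ x x).re ≤ n * C / w ^ 2 := by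
  classical
  set p : Fin d → ℝ := fun i => (ρ i i).re with hp
  have hpc : ∀ i, ρ i i = (p i : ℂ) := fun i => (hρ.1.1.coe_re_apply_self i).symm
  have hp0 : ∀ i, 0 ≤ p i := fun i => (Complex.nonneg_iff.1 hρ.1.diag_nonneg).1
  have hp1 : ∑ i, p i = 1 := by
    have := congrArg Complex.re hρ.2
    simpa [trace] using this
  have hE : energy (diagonal fun i => (h i : ℂ)) ρ = ∑ j, p j * h j := by
    simp only [energy, trace, diag_apply, diagonal_mul, Complex.re_sum, Complex.re_ofReal_mul, hp]
    exact Finset.sum_congr rfl fun i _ => mul_comm _ _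
  refine ⟨∑ i, p i * (h i - ∑ j, p j * h j) ^ 2,
    Finset.sum_nonneg fun i _ => mul_nonneg (hp0 i) (sq_nonneg _), fun n w hw => ?_⟩
  refine le_of_eq_of_le ?_ (sum_prod_tail_le (g := h) hp0 hp1 n hw)
  rw [hE]
  refine Finset.sum_congr ?_ fun x _ => ?_
  · ext x; simp [energyWindow]
  · simp only [tensorPower, tensorFamily, of_apply, hpc]
    rw [← Complex.ofReal_prod, Complex.ofReal_re]

/-- `T` enters through an equation so that two states of equal energy yield matrices over the same
index type. -/
theorem HasTypicalSubspaces.exists_compression {ρ : Matrix (Fin d) (Fin d) ℂ} {m : ℝ}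
    (hm : HasTypicalSubspaces ρ m) (hρ : IsState ρ) (h : Fin d → ℝ) :
    ∃ C : ℝ, 0 ≤ C ∧ ∀ (n : ℕ) (w ε : ℝ), 0 < w → n * C / w ^ 2 ≤ ε →
      ∀ T, T = energyWindow n h (energy (diagonal fun i => (h i : ℂ)) ρ) w →
      ∃ A : Matrix T T ℂ, A.PosSemidef ∧ ‖A‖ ≤ Real.exp (n * m + w) ∧
        (A.rank : ℝ) ≤ Real.exp (-(n * m) + w) ∧ A.trace.re ≤ 1 ∧ 1 - 2 * ε ≤ A.trace.re ∧
        traceNorm (tensorPower n ρ - inclusion T * A * (inclusion T)ᴴ) ≤ ε + 2 * √ε := by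
  obtain ⟨C₁, hC₁, h1⟩ := hm
  obtain ⟨C₂, hC₂, h2⟩ := exists_energy_tail hρ h
  refine ⟨C₁ + C₂, by positivity, ?_⟩
  rintro n w ε hw hε T hT
  obtain ⟨X, Z, μ, a1, a2, a3, a4, a5, a6⟩ := h1 n w hw
  have hb := h2 n w hw
  rw [← hT] at hb
  have hn : (0 : ℝ) ≤ n := n.cast_nonneg
  have e1 : n * C₁ / w ^ 2 ≤ ε := le_trans (by gcongr; linarith) hε
  have e2 : n * C₂ / w ^ 2 ≤ ε := le_trans (by gcongr; linarith) hε
  obtain ⟨A, b1, b2, b3, b4, b5, b6⟩ := compression_of_typical (hρ.tensorPower n) T a1 a2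
    (Real.exp_pos _).le a3 a5 (a6.trans e1) (hb.trans e2)
  refine ⟨A, b1, b2, le_trans ?_ a4, b4, b5, b6⟩
  rw [Fintype.card_coe] at b3
  exact_mod_cast b3

theorem exists_ancilla_conversion {ι R₀ : Type*} [Fintype ι] [DecidableEq ι] [Fintype R₀]
    [DecidableEq R₀] (e : ι → ℝ) (T : Finset ι) {V R S : Matrix ι ι ℂ} (hV : V * Vᴴ = 1)
    (hR : IsState R) (hS : IsState S) {X Y : Matrix T T ℂ} (hX : X.PosSemidef)
    (hY : Y.PosSemidef) {M N θ : ℝ} (hXM : ‖X‖ ≤ M) (hYM : ‖Y‖ ≤ M) (hXN : (X.rank : ℝ) ≤ N)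
    (hYN : (Y.rank : ℝ) ≤ N) (hX1 : X.trace.re ≤ 1) (hθ : 0 < θ)
    (hM : M / θ ≤ Fintype.card R₀) (r₀ : R₀)
    {A B₀ B₁ : Finset ℝ} (hB : B₁.Nonempty) (h01 : B₀ ⊆ B₁) (hBA : B₁ ⊆ A)
    (h1A : ∀ a ∈ B₁, ∀ i ∈ T, ∀ j ∈ T, a + (e i - e j) ∈ A)
    (h0 : ∀ b ∈ B₀, ∀ i ∈ T, ∀ j ∈ T, b + (e i - e j) ∈ B₁)
    {D : ℕ} (hD : D = Fintype.card R₀ * Fintype.card R₀ * A.card)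
    {c : ℝ} (hc : 0 ≤ c) (hA : ∀ a ∈ A, |a| ≤ c) :
    ∃ (HA η : Matrix (Fin D) (Fin D) ℂ) (U : Matrix (ι × Fin D) (ι × Fin D) ℂ),
      HA.IsHermitian ∧ opNorm HA ≤ c ∧ IsState η ∧
      EnergyPreserving (jointHam (V * diagonal (fun i => (e i : ℂ)) * Vᴴ) HA) U ∧
      traceNorm (trAnc (U * ((V * R * Vᴴ) ⊗ₖ η) * Uᴴ) - V * S * Vᴴ) ≤
        traceNorm (R - inclusion T * X * (inclusion T)ᴴ) +
        traceNorm (S - inclusion T * Y * (inclusion T)ᴴ) +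
        2 * (1 - (B₀.card : ℝ) / B₁.card) +
        (2 * (|X.trace.re - Y.trace.re| + N * θ + N * (M / Fintype.card R₀)) +
          |X.trace.re - Y.trace.re|) := by
  obtain ⟨η₂, U, e1, e2, e3⟩ := exists_energyPreserving_conversion e T hR hS hX hY hXM hYM hXN
    hYN hX1 hθ hM r₀ hB h01 hBA h1A h0
  have hD' : D = Fintype.card (R₀ × R₀) * Fintype.card A := by
    rw [hD, Fintype.card_prod, Fintype.card_coe]
  obtain ⟨HA, η, U', f1, f2, f3, f4, f5⟩ := exists_regrouped_conversion hD' hV hR.1.1 hS.1.1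
    (isState_mixedPureState r₀) e1 e2 hc fun a : A => hA a a.2
  exact ⟨HA, η, U', f1, f2, f3, f4, f5.trans e3⟩

/-- Equal entropies give both states the same bounds on rank and norm; equal energies give them the
same window. In `D` the two factors `D₀` are the matching registers and `N₀` is the number of
reference levels. -/
theorem exists_conversion_bound {H ρ σ : Matrix (Fin d) (Fin d) ℂ} (hH : H.IsHermitian)
    (hρ : IsState ρ) (hσ : IsState σ) (hS : entropy ρ = entropy σ)
    (hE : energy H ρ = energy H σ) :
    ∃ C : ℝ, 0 ≤ C ∧ ∀ (n K D₀ N₀ D : ℕ) (w : ℝ), 0 < w → 0 < K → Real.exp (3 * w) ≤ D₀ →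
      (2 * n * (K + 1) + 1) ^ d ≤ N₀ → D = D₀ * D₀ * N₀ →
      ∃ (HA η : Matrix (Fin D) (Fin D) ℂ)
        (U : Matrix ((Fin n → Fin d) × Fin D) ((Fin n → Fin d) × Fin D) ℂ),
        HA.IsHermitian ∧ opNorm HA ≤ (K + 1) * (2 * w) + 1 ∧ IsState η ∧
        EnergyPreserving (jointHam (copiesHam n H) HA) U ∧
        traceNorm (trAnc (U * (tensorPower n ρ ⊗ₖ η) * Uᴴ) - tensorPower n σ) ≤
          8 * (n * C / w ^ 2) + 4 * √(n * C / w ^ 2) +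
            2 * (d * Real.log (2 * n * K + 1) / K) + 4 * Real.exp (-w) := by
  obtain ⟨V, hV', hV, hHV, -⟩ := exists_spectral hH
  generalize hH.eigenvalues = h at hHV
  have hVh : Vᴴᴴ * Vᴴ = 1 := by rw [conjTranspose_conjTranspose, hV]
  have hconj : ∀ ξ : Matrix (Fin d) (Fin d) ℂ, V * (Vᴴ * ξ * Vᴴᴴ) * Vᴴ = ξ := fun ξ => by
    rw [conjTranspose_conjTranspose]
    calc _ = (V * Vᴴ) * ξ * (V * Vᴴ) := by simp only [Matrix.mul_assoc]
      _ = ξ := by rw [hV]; simp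
  have hen : ∀ ξ : Matrix (Fin d) (Fin d) ℂ,
      energy (diagonal fun i => (h i : ℂ)) (Vᴴ * ξ * Vᴴᴴ) = energy H ξ := fun ξ => by
    unfold energy
    conv_rhs => rw [hHV]
    rw [conjTranspose_conjTranspose, ← Matrix.mul_assoc, trace_mul_comm]
    simp only [Matrix.mul_assoc]
  have hten : ∀ (n : ℕ) (ξ : Matrix (Fin d) (Fin d) ℂ),
      tensorPower n V * tensorPower n (Vᴴ * ξ * Vᴴᴴ) * (tensorPower n V)ᴴ = tensorPower n ξ :=
    fun n ξ => by rw [← tensorPower_conj, hconj]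
  have hcop : ∀ n : ℕ, tensorPower n V * diagonal (fun x => ((∑ i, h (x i) : ℝ) : ℂ)) *
      (tensorPower n V)ᴴ = copiesHam n H := fun n => by
    rw [hHV, copiesHam_conj hV, copiesHam_diagonal]
  have hρ0 := hρ.conj hVh
  have hσ0 := hσ.conj hVh
  obtain ⟨C₁, hC₁, h1⟩ := ((hasTypicalSubspaces hρ).conj hVh).exists_compression hρ0 h
  obtain ⟨C₂, hC₂, h2⟩ := ((hasTypicalSubspaces hσ).conj hVh).exists_compression hσ0 h
  rw [hen] at h1 h2
  rw [← hE, ← hS] at h2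
  generalize energy H ρ = E at h1 h2
  generalize -entropy ρ = m at h1 h2
  refine ⟨C₁ + C₂, by positivity, ?_⟩
  intro n K D₀ N₀ D w hw hK hD₀ hN₀ hD
  obtain ⟨ε, hε⟩ : ∃ ε, ε = n * (C₁ + C₂) / w ^ 2 := ⟨_, rfl⟩
  rw [← hε]
  have hn : (0 : ℝ) ≤ n := n.cast_nonneg
  obtain ⟨T, hT⟩ : ∃ T, T = energyWindow n h E w := ⟨_, rfl⟩
  obtain ⟨X, a1, a2, a3, a4, a5, a6⟩ := h1 n w ε hw (by rw [hε]; gcongr; linarith) T hT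
  obtain ⟨Y, b1, b2, b3, b4, b5, b6⟩ := h2 n w ε hw (by rw [hε]; gcongr; linarith) T hT
  have hTL : ∀ x ∈ T, ∀ y ∈ T, |(∑ i, h (x i)) - ∑ i, h (y i)| ≤ 2 * w := fun x hx y hy => by
    rw [hT] at hx hy
    have hx' := (Finset.mem_filter.1 hx).2
    have hy' := (Finset.mem_filter.1 hy).2
    rw [abs_le] at hx' hy' ⊢
    constructor <;> linarith [hx'.1, hx'.2, hy'.1, hy'.2]
  obtain ⟨A, B₀, B₁, c1, c2, c3, c4, c5, c6, c7, c8⟩ :=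
    exists_frame_levels h T hK (by positivity : 0 ≤ 2 * w) hTL hN₀
  have hD₀pos : (0 : ℝ) < D₀ := lt_of_lt_of_le (Real.exp_pos _) hD₀
  have : NeZero D₀ := ⟨by rintro rfl; simp at hD₀pos⟩
  -- With `N = exp (-n m + w)` and `M = exp (n m + w)`, the threshold `θ = exp (n m - 2 w)` makes `N
  -- θ = exp (-w)` and `M / θ = exp (3 w)`. A register of that dimension also makes `N M / D₀ ≤ exp
  -- (-w)`.
  have hθ : Real.exp (n * m + w) / Real.exp (n * m - 2 * w) ≤ Fintype.card (Fin D₀) := by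
    rw [← Real.exp_sub, Fintype.card_fin]
    refine le_trans (le_of_eq ?_) hD₀
    congr 1; ring
  have hVn : tensorPower n V * (tensorPower n V)ᴴ = 1 :=
    mul_eq_one_comm.1 (tensorPower_isometry hV')
  have key := exists_ancilla_conversion (fun x : Fin n → Fin d => ∑ i, h (x i)) T hVn
    (hρ0.tensorPower n) (hσ0.tensorPower n) a1 b1 a2 b2 a3 b3 a4 (Real.exp_pos _) hθ 0 c4 c2 c3
    c5 c6 (D := D) (by rw [hD, Fintype.card_fin, c1])
    (by positivity : (0 : ℝ) ≤ (K + 1) * (2 * w) + 1) c7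
  rw [hcop, hten, hten] at key
  obtain ⟨HA, η, U', f1, f2, f3, f4, f5⟩ := key
  refine ⟨HA, η, U', f1, f2, f3, f4, f5.trans ?_⟩
  have g1 : Real.exp (-(n * m) + w) * Real.exp (n * m - 2 * w) = Real.exp (-w) := by
    rw [← Real.exp_add]; congr 1; ring
  have g2 : Real.exp (-(n * m) + w) * (Real.exp (n * m + w) / Fintype.card (Fin D₀)) ≤
      Real.exp (-w) := by
    rw [Fintype.card_fin, ← mul_div_assoc, ← Real.exp_add, div_le_iff₀ hD₀pos]
    calc _ = Real.exp (-w) * Real.exp (3 * w) := by rw [← Real.exp_add]; congr 1; ring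
      _ ≤ _ := by gcongr
  have g3 : |X.trace.re - Y.trace.re| ≤ 2 * ε := by
    rw [abs_le]; constructor <;> linarith
  rw [g1]
  linarith

end FiniteConversion


/-! ### Choice of the parameters -/

section Asymptotics

theorem exp_le_pow_ceil {d : ℕ} (hd : 2 ≤ d) (x : ℝ) :
    Real.exp x ≤ ((d ^ ⌈x / Real.log 2⌉₊ : ℕ) : ℝ) := by
  have h2 : 0 < Real.log 2 := Real.log_pos one_lt_two
  have h : x ≤ ⌈x / Real.log 2⌉₊ * Real.log 2 := (div_le_iff₀ h2).1 (Nat.le_ceil _)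
  calc Real.exp x ≤ Real.exp (⌈x / Real.log 2⌉₊ * Real.log 2) := Real.exp_le_exp.2 h
    _ = 2 ^ ⌈x / Real.log 2⌉₊ := by rw [Real.exp_nat_mul, Real.exp_log two_pos]
    _ ≤ _ := by push_cast; gcongr; exact_mod_cast hd

theorem one_le_log_natCast {n : ℕ} (hn : 3 ≤ n) : 1 ≤ Real.log n := by
  rw [Real.le_log_iff_exp_le (by positivity)]
  have : (3 : ℝ) ≤ n := by exact_mod_cast hn
  linarith [Real.exp_one_lt_d9]

theorem log_le_sqrt_mul_log {n : ℕ} (hn : 3 ≤ n) :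
    Real.log n ≤ √(n * Real.log n) := by
  have h1 := one_le_log_natCast hn
  refine Real.le_sqrt_of_sq_le ?_
  rw [sq]
  gcongr
  linarith [Real.log_le_sub_one_of_pos (show (0 : ℝ) < n by positivity)]

/-- The exponent `7 / 12` and the ladder exponent `1 / 12` add up to the `2 / 3` allowed for the
ancilla Hamiltonian. -/
theorem sqrt_mul_log_le {n : ℕ} (hn : 3 ≤ n) :
    √(n * Real.log n) ≤ 3 * (n : ℝ) ^ (7 / 12 : ℝ) := by
  have hn0 : (0 : ℝ) < n := by positivity
  have hl := Real.log_le_rpow_div hn0.le (show (0 : ℝ) < 1 / 6 by norm_num)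
  rw [Real.sqrt_le_left (by positivity), mul_pow, ← Real.rpow_mul_natCast hn0.le]
  calc (n : ℝ) * Real.log n ≤ n * ((n : ℝ) ^ (1 / 6 : ℝ) / (1 / 6)) := by gcongr
    _ = 6 * ((n : ℝ) ^ (1 : ℝ) * (n : ℝ) ^ (1 / 6 : ℝ)) := by rw [Real.rpow_one]; ring
    _ = 6 * (n : ℝ) ^ (7 / 12 * (2 : ℕ) : ℝ) := by rw [← Real.rpow_add hn0]; norm_num
    _ ≤ _ := by gcongr; norm_num

theorem isLittleO_natCast_rpow {a : ℝ} (ha : a < 1) :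
    (fun n : ℕ => (n : ℝ) ^ a) =o[atTop] (fun n : ℕ => (n : ℝ)) := by
  rw [isLittleO_iff_tendsto' (by
    filter_upwards [eventually_gt_atTop 0] with n hn h
    exact absurd h (by positivity))]
  refine ((tendsto_rpow_neg_atTop (sub_pos.2 ha)).comp tendsto_natCast_atTop_atTop).congr' ?_
  filter_upwards [eventually_gt_atTop 0] with n hn
  rw [Function.comp_apply, neg_sub, Real.rpow_sub_one (by positivity)]

theorem isLittleO_sqrt_mul_log :
    (fun n : ℕ => √(n * Real.log n)) =o[atTop] (fun n : ℕ => (n : ℝ)) := by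
  have h1 : (fun n : ℕ => √(n * Real.log n)) =O[atTop] fun n : ℕ => (n : ℝ) ^ (7 / 12 : ℝ) := by
    refine IsBigO.of_bound 3 ?_
    filter_upwards [eventually_ge_atTop 3] with n hn
    rw [Real.norm_of_nonneg (Real.sqrt_nonneg _), Real.norm_of_nonneg (by positivity)]
    exact sqrt_mul_log_le hn
  exact h1.trans_isLittleO (isLittleO_natCast_rpow (by norm_num))

/-- The half-width of the energy window. -/
noncomputable def windowWidth (n : ℕ) : ℝ := √(n * Real.log n) + 1

/-- The number of energy steps that the ancilla ladder absorbs at each side. -/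
noncomputable def ladderLength (n : ℕ) : ℕ := ⌈(n : ℝ) ^ (1 / 12 : ℝ)⌉₊ + 1

/-- The summand `1` in the width matters at `n = 0` and `n = 1`, where the square root vanishes. -/
theorem windowWidth_pos (n : ℕ) : 0 < windowWidth n := by unfold windowWidth; positivity

theorem windowWidth_le {n : ℕ} (hn : 3 ≤ n) : windowWidth n ≤ 2 * √(n * Real.log n) := by
  have := log_le_sqrt_mul_log hn
  have := one_le_log_natCast hn
  unfold windowWidth; linarith

theorem rpow_le_ladderLength (n : ℕ) : (n : ℝ) ^ (1 / 12 : ℝ) ≤ ladderLength n := by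
  have := Nat.le_ceil ((n : ℝ) ^ (1 / 12 : ℝ))
  unfold ladderLength; push_cast; linarith

theorem ladderLength_add_one_le {n : ℕ} (hn : 3 ≤ n) :
    (ladderLength n : ℝ) + 1 ≤ 4 * (n : ℝ) ^ (1 / 12 : ℝ) := by
  have h1 := Nat.ceil_lt_add_one (show (0 : ℝ) ≤ (n : ℝ) ^ (1 / 12 : ℝ) by positivity)
  have h2 : (1 : ℝ) ≤ (n : ℝ) ^ (1 / 12 : ℝ) :=
    Real.one_le_rpow (by exact_mod_cast (by omega : 1 ≤ n)) (by norm_num)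
  unfold ladderLength; push_cast; linarith

theorem log_ladder_le {n : ℕ} (hn : 3 ≤ n) :
    Real.log (2 * n * (ladderLength n + 1) + 1) ≤ 4 * Real.log n := by
  have hn3 : (3 : ℝ) ≤ n := by exact_mod_cast hn
  have h1 := ladderLength_add_one_le hn
  have h2 : (n : ℝ) ^ (1 / 12 : ℝ) ≤ n := by
    conv_rhs => rw [← Real.rpow_one (n : ℝ)]
    exact Real.rpow_le_rpow_of_exponent_le (by linarith) (by norm_num)
  have h3 : (2 * n * (ladderLength n + 1) + 1 : ℝ) ≤ n ^ 4 := by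
    have h4 : (2 * n * (ladderLength n + 1) : ℝ) ≤ 2 * n * (4 * n) := by gcongr; linarith
    have h5 : (9 : ℝ) ≤ n ^ 2 := by nlinarith
    nlinarith
  calc _ ≤ Real.log ((n : ℝ) ^ 4) := Real.log_le_log (by positivity) h3
    _ = _ := by rw [Real.log_pow]; norm_num

theorem tendsto_windowWidth : Tendsto windowWidth atTop atTop := by
  have h : Tendsto (fun n : ℕ => Real.log n) atTop atTop :=
    Real.tendsto_log_atTop.comp tendsto_natCast_atTop_atTop
  refine tendsto_atTop_mono' _ ?_ h
  filter_upwards [eventually_ge_atTop 3] with n hn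
  have := log_le_sqrt_mul_log hn
  unfold windowWidth; linarith

/-- The factor `log n` inside the width makes the Chebyshev error `O(1 / log n)`; the reference
error is `O(log n / n^{1/12})`. -/
theorem tendsto_conversion_bound (C : ℝ) (hC : 0 ≤ C) (d : ℕ) :
    Tendsto (fun n : ℕ => 8 * (n * C / windowWidth n ^ 2) + 4 * √(n * C / windowWidth n ^ 2) +
      2 * (d * Real.log (2 * n * ladderLength n + 1) / ladderLength n) +
      4 * Real.exp (-windowWidth n)) atTop (𝓝 0) := by
  have hlog : Tendsto (fun n : ℕ => Real.log n) atTop atTop :=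
    Real.tendsto_log_atTop.comp tendsto_natCast_atTop_atTop
  have h1 : Tendsto (fun n : ℕ => n * C / windowWidth n ^ 2) atTop (𝓝 0) := by
    refine squeeze_zero' (.of_forall fun n => by positivity) ?_ (hlog.const_div_atTop C)
    filter_upwards [eventually_ge_atTop 3] with n hn
    have hl := one_le_log_natCast hn
    have hn0 : (0 : ℝ) < n := by positivity
    rw [div_le_div_iff₀ (pow_pos (windowWidth_pos n) 2) (by linarith)]
    have : (n : ℝ) * Real.log n ≤ windowWidth n ^ 2 := by
      have := Real.sq_sqrt (show (0 : ℝ) ≤ n * Real.log n by positivity)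
      have := Real.sqrt_nonneg ((n : ℝ) * Real.log n)
      unfold windowWidth; nlinarith
    calc (n : ℝ) * C * Real.log n = C * (n * Real.log n) := by ring
      _ ≤ _ := by gcongr
  have h2 : Tendsto (fun n : ℕ => d * Real.log (2 * n * ladderLength n + 1) / ladderLength n)
      atTop (𝓝 0) := by
    have h3 := (((isLittleO_log_rpow_atTop (show (0 : ℝ) < 1 / 12 by norm_num)).comp_tendsto
      (tendsto_natCast_atTop_atTop (R := ℝ))).tendsto_div_nhds_zero).const_mul (4 * d : ℝ)
    rw [mul_zero] at h3
    refine squeeze_zero' (.of_forall fun n => ?_) ?_ h3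
    · have : 0 ≤ Real.log (2 * n * ladderLength n + 1) :=
        Real.log_nonneg (by linarith [show (0 : ℝ) ≤ 2 * n * ladderLength n by positivity])
      positivity
    · filter_upwards [eventually_ge_atTop 3] with n hn
      have hn0 : (0 : ℝ) < n := by positivity
      have hl := one_le_log_natCast hn
      simp only [Function.comp_apply]
      rw [← mul_div_assoc]
      have h5 : Real.log (2 * n * ladderLength n + 1) ≤ 4 * Real.log n :=
        (Real.log_le_log (by positivity) (by gcongr; linarith)).trans (log_ladder_le hn)
      have h6 := rpow_le_ladderLength n
      refine div_le_div₀ (by positivity) ?_ (by positivity) h6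
      calc _ ≤ d * (4 * Real.log n) := by gcongr
        _ = _ := by ring
  have h3 : Tendsto (fun n => Real.exp (-windowWidth n)) atTop (𝓝 0) :=
    Real.tendsto_exp_neg_atTop_nhds_zero.comp tendsto_windowWidth
  have := (((h1.const_mul 8).add (h1.sqrt.const_mul 4)).add (h2.const_mul 2)).add (h3.const_mul 4)
  simpa using this

end Asymptotics

/-! ### The equivalence -/

section Equivalence

variable {d : ℕ} {H ρ σ : Matrix (Fin d) (Fin d) ℂ}

/-- Each matching register takes `k₁ = O(w)` qudits, since its dimension is about `exp (3 w)`; the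
reference has polynomially many levels and takes only `k₂ = O(log n)`. -/
theorem exists_oneSidedConversion_of_two_le (hd : 2 ≤ d) (hH : H.IsHermitian) (hρ : IsState ρ)
    (hσ : IsState σ) (hS : entropy ρ = entropy σ) (hE : energy H ρ = energy H σ) :
    ∃ k : ℕ → ℕ, (fun n => (k n : ℝ)) =O[atTop] (fun n : ℕ => √(n * Real.log n)) ∧
      OneSidedConversion H ρ σ (fun n => d ^ k n) := by
  obtain ⟨C, hC, h⟩ := exists_conversion_bound hH hρ hσ hS hE
  set k₁ : ℕ → ℕ := fun n => ⌈3 * windowWidth n / Real.log 2⌉₊ with hk₁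
  set k₂ : ℕ → ℕ := fun n =>
    ⌈d * Real.log (2 * n * (ladderLength n + 1) + 1) / Real.log 2⌉₊ with hk₂
  have hN : ∀ n : ℕ, (2 * n * (ladderLength n + 1) + 1) ^ d ≤ d ^ k₂ n := fun n => by
    have := exp_le_pow_ceil hd (d * Real.log (2 * n * (ladderLength n + 1) + 1))
    rw [Real.exp_nat_mul, Real.exp_log (by positivity)] at this
    have h' : (((2 * n * (ladderLength n + 1) + 1) ^ d : ℕ) : ℝ) ≤ (d ^ k₂ n : ℕ) := by
      push_cast at this ⊢; exact this
    exact_mod_cast h'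
  have key := fun n => h n (ladderLength n) (d ^ k₁ n) (d ^ k₂ n) (d ^ (k₁ n + k₁ n + k₂ n))
    (windowWidth n) (windowWidth_pos n) (Nat.succ_pos _) (exp_le_pow_ceil hd _) (hN n)
    (by rw [pow_add, pow_add])
  choose HA η U a1 a2 a3 a4 a5 using key
  refine ⟨fun n => k₁ n + k₁ n + k₂ n, ?_, HA, η, U, a1, ?_, a3, a4, ?_⟩
  · refine IsBigO.of_bound (27 + 8 * d) ?_
    filter_upwards [eventually_ge_atTop 3] with n hn
    have hlog := one_le_log_natCast hn
    have hs := log_le_sqrt_mul_log hn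
    have hw := windowWidth_le hn
    have hw0 := windowWidth_pos n
    have hl := log_ladder_le hn
    have hl0 : 0 ≤ Real.log (2 * n * (ladderLength n + 1) + 1) := Real.log_nonneg
      (by linarith [show (0 : ℝ) ≤ 2 * n * (ladderLength n + 1) by positivity])
    have hlog2 : ∀ x : ℝ, 0 ≤ x → x / Real.log 2 ≤ 2 * x := fun x hx => by
      rw [div_le_iff₀ (Real.log_pos one_lt_two)]
      nlinarith [Real.log_two_gt_d9]
    have h1 : (k₁ n : ℝ) ≤ 2 * (3 * windowWidth n) + 1 :=
      (Nat.ceil_lt_add_one (by have := Real.log_pos one_lt_two; positivity)).le.trans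
        (by gcongr; exact hlog2 _ (by positivity))
    have h2 : (k₂ n : ℝ) ≤ 2 * (d * (4 * Real.log n)) + 1 :=
      (Nat.ceil_lt_add_one (by have := Real.log_pos one_lt_two; positivity)).le.trans
        (by
          gcongr
          refine (hlog2 _ (by positivity)).trans ?_
          gcongr)
    rw [Real.norm_of_nonneg (by positivity), Real.norm_of_nonneg (by positivity)]
    have h3 : (d : ℝ) * Real.log n ≤ d * √(n * Real.log n) := by gcongr
    push_cast
    nlinarith
  · refine IsBigO.of_bound 49 ?_
    filter_upwards [eventually_ge_atTop 3] with n hn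
    have hn0 : (0 : ℝ) < n := by positivity
    have h1 : (1 : ℝ) ≤ (n : ℝ) ^ (2 / 3 : ℝ) :=
      Real.one_le_rpow (by exact_mod_cast (by omega : 1 ≤ n)) (by norm_num)
    have h2 : windowWidth n ≤ 2 * (3 * (n : ℝ) ^ (7 / 12 : ℝ)) :=
      (windowWidth_le hn).trans (by gcongr; exact sqrt_mul_log_le hn)
    rw [Real.norm_of_nonneg (show 0 ≤ opNorm (HA n) from norm_nonneg _),
      Real.norm_of_nonneg (by positivity)]
    have h3 : (n : ℝ) ^ (1 / 12 : ℝ) * (n : ℝ) ^ (7 / 12 : ℝ) = (n : ℝ) ^ (2 / 3 : ℝ) := by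
      rw [← Real.rpow_add hn0]; norm_num
    calc _ ≤ (ladderLength n + 1) * (2 * windowWidth n) + 1 := a2 n
      _ ≤ (4 * (n : ℝ) ^ (1 / 12 : ℝ)) * (2 * (2 * (3 * (n : ℝ) ^ (7 / 12 : ℝ)))) + 1 := by
        have := (windowWidth_pos n).le
        gcongr
        exact ladderLength_add_one_le hn
      _ = 48 * ((n : ℝ) ^ (1 / 12 : ℝ) * (n : ℝ) ^ (7 / 12 : ℝ)) + 1 := by ring
      _ ≤ _ := by rw [h3]; linarith
  · refine squeeze_zero (fun n => traceNorm_nonneg ?_) a5 (tendsto_conversion_bound C hC d)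
    exact (IsHermitian.trAnc (((hρ.tensorPower n).kronecker (a3 n)).conj
      (isometry_of_mem_unitaryGroup (a4 n).1)).1.1).sub (hσ.tensorPower n).1.1

theorem trAnc_kronecker {ι κ : Type*} [Fintype κ] (A : Matrix ι ι ℂ) (B : Matrix κ κ ℂ) :
    trAnc (A ⊗ₖ B) = B.trace • A := by
  ext i j
  simp [trAnc, trace, ← Finset.mul_sum, mul_comm]

theorem oneSidedConversion_refl : OneSidedConversion H ρ ρ (fun _ => d ^ 0) := by
  have hη : IsState (1 : Matrix (Fin (d ^ 0)) (Fin (d ^ 0)) ℂ) :=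
    ⟨PosSemidef.one, by rw [trace_one, Fintype.card_fin, pow_zero, Nat.cast_one]⟩
  refine ⟨fun _ => 0, fun _ => 1, fun _ => 1, fun _ => isHermitian_zero, ?_, fun _ => hη,
    fun n => ⟨one_mem _, by rw [Matrix.one_mul, Matrix.mul_one]⟩, ?_⟩
  · simp only [opNorm, map_zero, norm_zero]
    exact isBigO_zero _ _
  · refine Tendsto.congr (fun n => ?_) tendsto_const_nhds
    rw [Matrix.one_mul, conjTranspose_one, Matrix.mul_one, trAnc_kronecker, hη.2, one_smul,
      sub_self, PosSemidef_traceNorm PosSemidef.zero]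
    simp

theorem exists_oneSidedConversion (hH : H.IsHermitian) (hρ : IsState ρ) (hσ : IsState σ)
    (hS : entropy ρ = entropy σ) (hE : energy H ρ = energy H σ) :
    ∃ k : ℕ → ℕ, (fun n => (k n : ℝ)) =O[atTop] (fun n : ℕ => √(n * Real.log n)) ∧
      OneSidedConversion H ρ σ (fun n => d ^ k n) := by
  -- Powers of `d` give large ancillas only for `d ≥ 2`. For `d = 0` there are no states, and for `d
  -- = 1` there is only one.
  rcases Nat.lt_or_ge d 2 with hd | hd
  · refine ⟨fun _ => 0, by simpa using isBigO_zero _ _, ?_⟩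
    have h1 := hρ.2
    have h2 := hσ.2
    interval_cases d
    · simp [trace] at h1
    · have : ρ = σ := by
        ext i j
        rw [Subsingleton.elim i 0, Subsingleton.elim j 0]
        simp [trace] at h1 h2
        rw [h1, h2]
      rw [this]
      exact oneSidedConversion_refl
  · exact exists_oneSidedConversion_of_two_le hd hH hρ hσ hS hE

theorem OneSidedConversion.twoSidedConversion {D : ℕ → ℕ} (h : OneSidedConversion H ρ σ D) :
    TwoSidedConversion H ρ σ D := by
  obtain ⟨HA, η, U, h1, h2, h3, h4, h5⟩ := h
  refine ⟨HA, η, η, U, fun _ => 1, h1, h2.trans_isLittleO (isLittleO_natCast_rpow (by norm_num)), h3, h3, h4,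
    fun n => ⟨one_mem _, by rw [Matrix.one_mul, Matrix.mul_one]⟩, ?_⟩
  refine h5.congr fun n => ?_
  rw [Matrix.one_mul, conjTranspose_one, Matrix.mul_one, trAnc_sub, trAnc_kronecker, (h3 n).2,
    one_smul]

theorem log_natCast_pow (k : ℕ → ℕ) :
    (fun n => Real.log ((d ^ k n : ℕ) : ℝ)) = fun n => Real.log d * k n := by
  ext n
  rw [Nat.cast_pow, Real.log_pow, mul_comm]

end Equivalence

end QThermo

theorem theorem1 (d : ℕ) (H ρ σ : Matrix (Fin d) (Fin d) ℂ) (hH : H.IsHermitian)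
    (hρ : QThermo.IsState ρ) (hσ : QThermo.IsState σ) :
    List.TFAE [
      -- equal entropy and average energy
      QThermo.entropy ρ = QThermo.entropy σ ∧ QThermo.energy H ρ = QThermo.energy H σ,
      -- one-sided conversion with an ancilla of `O(√(n log n))` qudits
      ∃ k : ℕ → ℕ,
        (fun n => (k n : ℝ)) =O[atTop] (fun n : ℕ => Real.sqrt (n * Real.log n)) ∧
        QThermo.OneSidedConversion H ρ σ (fun n => d ^ k n),
      -- one-sided conversion with an ancilla of size (log-dimension) `O(√(n log n))`
      ∃ D : ℕ → ℕ,
        (fun n => Real.log (D n)) =O[atTop] (fun n : ℕ => Real.sqrt (n * Real.log n)) ∧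
        QThermo.OneSidedConversion H ρ σ D,
      -- two-sided conversion with an ancilla of `o(n)` qudits
      ∃ k : ℕ → ℕ,
        (fun n => (k n : ℝ)) =o[atTop] (fun n : ℕ => (n : ℝ)) ∧
        QThermo.TwoSidedConversion H ρ σ (fun n => d ^ k n),
      -- two-sided conversion with an ancilla of size (log-dimension) `o(n)`
      ∃ D : ℕ → ℕ,
        (fun n => Real.log (D n)) =o[atTop] (fun n : ℕ => (n : ℝ)) ∧
        QThermo.TwoSidedConversion H ρ σ D] := by
  tfae_have 1 → 2 := fun h => QThermo.exists_oneSidedConversion hH hρ hσ h.1 h.2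
  tfae_have 2 → 3 := fun ⟨k, h1, h2⟩ =>
    ⟨_, by rw [QThermo.log_natCast_pow]; exact h1.const_mul_left _, h2⟩
  tfae_have 2 → 4 := fun ⟨k, h1, h2⟩ =>
    ⟨k, h1.trans_isLittleO QThermo.isLittleO_sqrt_mul_log, h2.twoSidedConversion⟩
  tfae_have 4 → 5 := fun ⟨k, h1, h2⟩ =>
    ⟨_, by rw [QThermo.log_natCast_pow]; exact h1.const_mul_left _, h2⟩
  tfae_have 3 → 5 := fun ⟨D, h1, h2⟩ =>
    ⟨D, h1.trans_isLittleO QThermo.isLittleO_sqrt_mul_log, h2.twoSidedConversion⟩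
  tfae_have 5 → 1 := fun ⟨D, h1, h2⟩ =>
    ⟨le_antisymm (h2.symm.entropy_le h1 hσ hρ) (h2.entropy_le h1 hρ hσ), h2.energy_eq hH hρ hσ⟩
  tfae_finish
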